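/- Let $D\subset\mathbb R^d$ ($d\ge 1$) be a nonempty bounded open set (for instance a bounded Lipschitz domain), let $(\Omega,\mathcal F,\mathbb P)$ be a probability space and $\xi:\Omega\to\Xi$ a random variable with values in a measurable space $\Xi$ (for instance $\Xi\subset\mathbb R^n$). Let the diffusion coefficient $a:\mathbb R^d\times\Xi\to\mathbb R$ be jointly measurable with $0<a_{\min}<a(x,t)<a_{\max}<\infty$ for all $x\in D$, $t\in\Xi$. For $u\in L^2(D)$ and $t\in\Xi$ let $y(u,t)\in H_0^1(D)$ be the weak solution of $-\nabla\cdot(a(\cdot,t)\nabla y)=u$ in $D$, $y=0$ on $\partial D$. Let $y_d\in L^2(D)$, $\alpha,\beta\ge 0$, $u_{\min}\le u_{\max}$, and put $$F(u,t)=\tfrac12\|y(u,t)-y_d\|_{L^2(D)}^2+\tfrac{\alpha}{2}\|u\|_{L^2(D)}^2,\quad f(u)=\mathbb E[F(u,\xi)],\quad g(u)=\beta\|u\|_{L^1(D)},$$ $$U_{ad}=\{u\in L^2(D):\ u_{\min}\le u(x)\le u_{\max}\text{ for a.e. }x\in D\}.$$ Consider $\min_{u\in U_{ad}} f(u)+g(u)$,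 i.e. $\min f(u)+g(z)$ subject to $u\in U_{ad}$, $z\in L^2(D)$, $u=z$. Let $(u^*,z^*,\lambda^*)$ be a saddle point of $f(u)+g(z)-\langle\lambda,u-z\rangle$ over $u\in U_{ad}$ and $z,\lambda\in L^2(D)$ (minimized in $(u,z)$, maximized in $\lambda$), and let $c>0$ with $c\ge 2\|\lambda^*\|$. Algorithm. Let $\mu\in(0,1)$ and let $m_k>1$ be integers with $\sum_{k\ge 0}1/m_k=1/M<\infty$. Let $\xi_{k,i}$ ($k\ge 0$, $1\le i\le m_k$) be independent random variables with the law of $\xi$. Start from deterministic $u_0=v_0\in U_{ad}$, $z_0=s_0\in L^2(D)$, $\lambda_0=\psi_0\in L^2(D)$, and for $k\ge 0$ set $G_k=\frac1{m_k}\sum_{i=1}^{m_k}\nabla F(v_k,\xi_{k,i})$ (gradient in $u$) and $$s_{k+1}=\arg\min_{z\in L^2(D)}\{g(z)+\langle\lambda_k,z\rangle+\tfrac{\rho_k}{2}\|z-v_k\|^2\},$$ $$v_{k+1}=\arg\min_{u\in U_{ad}}\{\langle G_k-\lambda_k,u\rangle+\tfrac{\rho_k}{2}\|u-s_{k+1}\|^2+\tfrac{\eta_k}{2}\|u-v_k\|^2\},$$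 $$\psi_{k+1}=\psi_k-\mu\rho_k(v_{k+1}-s_{k+1}),\quad u_{k+1}=(1-\theta_k^{-1})u_k+\theta_k^{-1}v_{k+1},$$ $$z_{k+1}=(1-\theta_k^{-1})z_k+\theta_k^{-1}s_{k+1},\quad \lambda_{k+1}=\psi_{k+1}-\mu\rho_k\theta_k(u_{k+1}-z_{k+1}).$$ Constants. Let $C_P$ be the Poincaré constant of $D$ (the least $C\geq 0$ with $\|y\|_{L^2(D)}\le C\|\nabla y\|_{L^2(D)}$ for all $y\in H^1_0(D)$), let $|D|$ be the Lebesgue measure of $D$, and let, for $\rho,\eta>0$, $$L=\alpha+\frac{C_P^4}{a_{\min}^2},\quad \kappa=\Big\lceil\frac{L(1-\mu)}{\eta(1-\mu)-\rho\mu}\Big\rceil,\quad \phi_t=\frac{1-\mu}{\eta(1-\mu)-\mu\rho-t^{-1}L(1-\mu)},$$ $$B_1=\frac{C_P^4}{a_{\min}^2}\max\{|u_{\min}|,|u_{\max}|\}\sqrt{|D|}+\frac{C_P^2}{a_{\min}}\|y_d\|_{L^2(D)},$$ $$C_3=\frac{8\phi_{\theta_{2\kappa}}B_1^2}{M}+2|D|(u_{\max}-u_{\min})^2L\,\theta_{2\kappa-1}^2+\frac{4(\|\lambda_0\|^2+c^2)}{\mu\rho},\quad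 C_4=2(u_{\max}-u_{\min})B_1\sqrt{\frac{2|D|}{(1-e^{-2})M}},$$ $$C_5=\frac{2\phi_1B_1^2}{M}+\frac{\eta+\rho}{2}\|u_0-u^*\|^2+\frac{\|\lambda_0\|^2+c^2}{\mu\rho}.$$ (a) Strongly convex case. Let $\alpha>0$, $\rho_k=\rho\theta_k$, $\eta_k=\eta\theta_k$ with $\rho,\eta>0$, $\rho+\eta\le\alpha$, $\eta(1-\mu)>\rho\mu$, and let $\theta_k>0$ be given by $\theta_0=1$, $\theta_{k+1}^2=\theta_k^2+\theta_{k+1}$. Then for every $\delta>0$ and every $K\ge 1$ $$\mathbb P\Big\{f(u_K)+g(z_K)-f(u^*)-g(z^*)<\frac{C_3}{K^2}+\frac{\delta C_4\sqrt{\ln K}}{K}\Big\}\ge 1-\Big(\frac1K\Big)^{\delta^2/3},$$ $$\mathbb P\Big\{\|u_K-z_K\|_{L^2(D)}<\frac{2C_3}{cK^2}+\frac{2\delta C_4\sqrt{\ln K}}{cK}\Big\}\ge 1-\Big(\frac1K\Big)^{\delta^2/3}.$$ (b) General convex case. Let $\alpha=0$, $\rho_k=\rho$, $\eta_k=\eta$,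 $\theta_k=k+1$ with $\rho,\eta>0$ and $\eta>\mu\rho/(1-\mu)+L$. Then for every $\delta>0$ and every $K\ge 1$ $$\mathbb P\Big\{f(u_K)+g(z_K)-f(u^*)-g(z^*)<\frac{C_5}{K}+\frac{\delta C_4\sqrt{\ln K}}{K}\Big\}\ge 1-\Big(\frac1K\Big)^{\delta^2/3},$$ $$\mathbb P\Big\{\|u_K-z_K\|_{L^2(D)}<\frac{2C_5}{cK}+\frac{2\delta C_4\sqrt{\ln K}}{cK}\Big\}\ge 1-\Big(\frac1K\Big)^{\delta^2/3}.$$ -/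

import Mathlib

open MeasureTheory ProbabilityTheory Set
open scoped InnerProductSpace

noncomputable section

/-! ### Function spaces on a subset of Euclidean space -/

/-- The space `L²(D)` of square integrable real functions on `D`. -/
abbrev L2 {d : ℕ} (D : Set (EuclideanSpace ℝ (Fin d))) : Type :=
  Lp ℝ 2 (volume.restrict D)

/-- The space `L²(D; ℝᵈ)` of square integrable vector fields on `D`. -/
abbrev L2Vec {d : ℕ} (D : Set (EuclideanSpace ℝ (Fin d))) : Type :=
  Lp (EuclideanSpace ℝ (Fin d)) 2 (volume.restrict D)

/-- The pairs `(φ, ∇φ)` with `φ` a smooth function compactly supported in `D`, seen in the Hilbert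
space `L²(D) × L²(D; ℝᵈ)`. -/
def testPairs {d : ℕ} (D : Set (EuclideanSpace ℝ (Fin d))) :
    Set (WithLp 2 (L2 D × L2Vec D)) :=
  {w | ∃ φ : EuclideanSpace ℝ (Fin d) → ℝ, ContDiff ℝ ((⊤ : ℕ∞) : WithTop ℕ∞) φ ∧ HasCompactSupport φ ∧
    tsupport φ ⊆ D ∧ w.fst =ᵐ[volume.restrict D] φ ∧ w.snd =ᵐ[volume.restrict D] gradient φ}

/-- The Sobolev space `H¹₀(D)`: the closure of `C_c^∞(D)` in the norm of `H¹`. An element `y` is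
represented by the pair `(y, ∇y)` of its value and its weak gradient. -/
def H10 {d : ℕ} (D : Set (EuclideanSpace ℝ (Fin d))) :
    Submodule ℝ (WithLp 2 (L2 D × L2Vec D)) :=
  (Submodule.span ℝ (testPairs D)).topologicalClosure

/-- The Poincaré constant of `D`: the smallest `C ≥ 0` with `‖y‖ ≤ C ‖∇y‖` on `H¹₀(D)`. -/
def poincareConst {d : ℕ} (D : Set (EuclideanSpace ℝ (Fin d))) : ℝ :=
  sInf {C : ℝ | 0 ≤ C ∧ ∀ w ∈ H10 D, ‖w.fst‖ ≤ C * ‖w.snd‖}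

/-! ### The elliptic equation -/

/-- `y` is the value of a weak solution in `H¹₀(D)` of `-∇·(a ∇y) = u` in `D`, `y = 0` on `∂D`. -/
def IsWeakSolution {d : ℕ} (D : Set (EuclideanSpace ℝ (Fin d)))
    (a : EuclideanSpace ℝ (Fin d) → ℝ) (u y : L2 D) : Prop :=
  ∃ w ∈ H10 D, w.fst = y ∧ ∀ v ∈ H10 D,
    ∫ x in D, a x * ⟪w.snd x, v.snd x⟫_ℝ = ∫ x in D, u x * v.fst x

open Classical in
/-- The state `y(u)`: the solution of the elliptic equation with diffusion coefficient `a` and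
right-hand side `u`. -/
def state {d : ℕ} (D : Set (EuclideanSpace ℝ (Fin d)))
    (a : EuclideanSpace ℝ (Fin d) → ℝ) (u : L2 D) : L2 D :=
  if h : ∃ y, IsWeakSolution D a u y then h.choose else 0

/-! ### The optimal control problem -/

/-- The admissible set: the controls with `umin ≤ u(x) ≤ umax` for almost every `x` in `D`. -/
def admissible {d : ℕ} (D : Set (EuclideanSpace ℝ (Fin d))) (umin umax : ℝ) : Set (L2 D) :=
  {u | ∀ᵐ x ∂(volume.restrict D), umin ≤ u x ∧ u x ≤ umax}

/-- The smooth part of the cost for one realization of the random input,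
`F(u, t) = ½ ‖y(u, t) - y_d‖² + (α/2) ‖u‖²`, where `a x t` is the diffusion coefficient at the
point `x` for the value `t` of the random input. -/
def smoothCost {d : ℕ} {Ξ : Type*} (D : Set (EuclideanSpace ℝ (Fin d)))
    (a : EuclideanSpace ℝ (Fin d) → Ξ → ℝ) (yd : L2 D) (α : ℝ) (u : L2 D) (t : Ξ) : ℝ :=
  1 / 2 * ‖state D (fun x => a x t) u - yd‖ ^ 2 + α / 2 * ‖u‖ ^ 2

/-- The expected smooth cost `f(u) = 𝔼[F(u, ξ)]`. -/
def expectedCost {d : ℕ} {Ω Ξ : Type*} [MeasurableSpace Ω] (P : Measure Ω) (ξ : Ω → Ξ)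
    (D : Set (EuclideanSpace ℝ (Fin d))) (a : EuclideanSpace ℝ (Fin d) → Ξ → ℝ) (yd : L2 D)
    (α : ℝ) (u : L2 D) : ℝ :=
  ∫ ω, smoothCost D a yd α u (ξ ω) ∂P

/-- The sparsity term `g(u) = β ‖u‖_{L¹(D)}`. -/
def l1Cost {d : ℕ} (D : Set (EuclideanSpace ℝ (Fin d))) (β : ℝ) (u : L2 D) : ℝ :=
  β * ∫ x in D, |u x|

/-- The Lagrangian `f(u) + g(z) - ⟨l, u - z⟩` of `min f(u) + g(z)` subject to `u = z`. -/
def lagrangian {H : Type*} [NormedAddCommGroup H] [InnerProductSpace ℝ H] (f g : H → ℝ)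
    (u z l : H) : ℝ :=
  f u + g z - ⟪l, u - z⟫_ℝ

/-- `(u', z', l')` is a saddle point of the Lagrangian over `u ∈ Uad`, `z ∈ H`, `l ∈ H`. The
inequality in `l` amounts to the constraint `u' = z'`. -/
def IsSaddlePoint {H : Type*} [NormedAddCommGroup H] [InnerProductSpace ℝ H] (f g : H → ℝ)
    (Uad : Set H) (u' z' l' : H) : Prop :=
  u' ∈ Uad ∧ (∀ l, lagrangian f g u' z' l ≤ lagrangian f g u' z' l') ∧
    ∀ u ∈ Uad, ∀ z, lagrangian f g u' z' l' ≤ lagrangian f g u z l'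

/-! ### The algorithm -/

/-- A run of the stochastic linearized ADMM for `min_{u ∈ Uad} 𝔼[F(u, ξ)] + g(u)` with step
parameters `ρ k`, `η k`, `θ k`, `μ`, with the `m k` random samples `X k i` at iteration `k`, and
started at `u₀ = v₀`, `z₀ = s₀`, `λ₀ = ψ₀`. All iterates are functions of the outcome `ω`. -/
structure IsADMMRun {H Ω Ξ : Type*} [NormedAddCommGroup H] [InnerProductSpace ℝ H]
    [CompleteSpace H] (F : H → Ξ → ℝ) (g : H → ℝ) (Uad : Set H)
    (m : ℕ → ℕ) (X : (k : ℕ) → Fin (m k) → Ω → Ξ) (μ : ℝ) (ρ η θ : ℕ → ℝ) (v₀ s₀ l₀ : H)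
    (u v z s lam psi : ℕ → Ω → H) : Prop where
  u_init : ∀ ω, u 0 ω = v₀
  v_init : ∀ ω, v 0 ω = v₀
  z_init : ∀ ω, z 0 ω = s₀
  s_init : ∀ ω, s 0 ω = s₀
  lam_init : ∀ ω, lam 0 ω = l₀
  psi_init : ∀ ω, psi 0 ω = l₀
  s_step : ∀ k ω, IsMinOn
    (fun y => g y + ⟪lam k ω, y⟫_ℝ + ρ k / 2 * ‖y - v k ω‖ ^ 2) univ (s (k + 1) ω)
  v_mem : ∀ k ω, v (k + 1) ω ∈ Uad
  v_step : ∀ k ω, IsMinOn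
    (fun y => ⟪(1 / (m k : ℝ)) • ∑ i, gradient (fun w => F w (X k i ω)) (v k ω) - lam k ω, y⟫_ℝ
      + ρ k / 2 * ‖y - s (k + 1) ω‖ ^ 2 + η k / 2 * ‖y - v k ω‖ ^ 2) Uad (v (k + 1) ω)
  psi_step : ∀ k ω, psi (k + 1) ω = psi k ω - (μ * ρ k) • (v (k + 1) ω - s (k + 1) ω)
  u_step : ∀ k ω, u (k + 1) ω = (1 - (θ k)⁻¹) • u k ω + (θ k)⁻¹ • v (k + 1) ω
  z_step : ∀ k ω, z (k + 1) ω = (1 - (θ k)⁻¹) • z k ω + (θ k)⁻¹ • s (k + 1) ω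
  lam_step : ∀ k ω, lam (k + 1) ω
    = psi (k + 1) ω - (μ * ρ k * θ k) • (u (k + 1) ω - z (k + 1) ω)

/-- The sequence with `θ₀ = 1` and `θ_{k+1}² = θ_k² + θ_{k+1}` (positive root). -/
def nesterovTheta : ℕ → ℝ
  | 0 => 1
  | k + 1 => (1 + √(1 + 4 * nesterovTheta k ^ 2)) / 2

theorem nesterovTheta_eq (k : ℕ) :
    nesterovTheta (k + 1) ^ 2 = nesterovTheta k ^ 2 + nesterovTheta (k + 1) := by
  have h := Real.sq_sqrt (show 0 ≤ 1 + 4 * nesterovTheta k ^ 2 by positivity)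
  simp only [nesterovTheta]
  nlinarith

/-! ### The constants -/

/-- `L = α + C_P⁴ / a_min²`. -/
def gradLip {d : ℕ} (D : Set (EuclideanSpace ℝ (Fin d))) (amin α : ℝ) : ℝ :=
  α + poincareConst D ^ 4 / amin ^ 2

/-- `κ = ⌈L (1 - μ) / (η (1 - μ) - ρ μ)⌉`. -/
def kappa (L μ ρ η : ℝ) : ℕ :=
  ⌈L * (1 - μ) / (η * (1 - μ) - ρ * μ)⌉₊

/-- `φ_t = (1 - μ) / (η (1 - μ) - μ ρ - t⁻¹ L (1 - μ))`. -/
def phi (L μ ρ η t : ℝ) : ℝ :=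
  (1 - μ) / (η * (1 - μ) - μ * ρ - t⁻¹ * L * (1 - μ))

/-- `B₁ = (C_P⁴ / a_min²) max(|u_min|, |u_max|) √|D| + (C_P² / a_min) ‖y_d‖`. -/
def constB1 {d : ℕ} (D : Set (EuclideanSpace ℝ (Fin d))) (amin umin umax : ℝ) (yd : L2 D) : ℝ :=
  poincareConst D ^ 4 / amin ^ 2 * max |umin| |umax| * √(volume.real D)
    + poincareConst D ^ 2 / amin * ‖yd‖

/-- `C₃ = 8 φ_{θ_{2κ}} B₁² / M + 2 |D| (u_max - u_min)² L θ_{2κ-1}² + 4 (‖λ₀‖² + c²) / (μ ρ)`. -/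
def constC3 {d : ℕ} (D : Set (EuclideanSpace ℝ (Fin d))) (amin umin umax : ℝ) (yd l₀ : L2 D)
    (α μ ρ η M c : ℝ) : ℝ :=
  8 * phi (gradLip D amin α) μ ρ η (nesterovTheta (2 * kappa (gradLip D amin α) μ ρ η))
      * constB1 D amin umin umax yd ^ 2 / M
    + 2 * volume.real D * (umax - umin) ^ 2 * gradLip D amin α
      * nesterovTheta (2 * kappa (gradLip D amin α) μ ρ η - 1) ^ 2
    + 4 * (‖l₀‖ ^ 2 + c ^ 2) / (μ * ρ)

/-- `C₄ = 2 (u_max - u_min) B₁ √(2 |D| / ((1 - e⁻²) M))`. -/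
def constC4 {d : ℕ} (D : Set (EuclideanSpace ℝ (Fin d))) (amin umin umax : ℝ) (yd : L2 D)
    (M : ℝ) : ℝ :=
  2 * (umax - umin) * constB1 D amin umin umax yd
    * √(2 * volume.real D / ((1 - Real.exp (-2)) * M))

/-- `C₅ = 2 φ₁ B₁² / M + ((η + ρ) / 2) ‖u₀ - u*‖² + (‖λ₀‖² + c²) / (μ ρ)`. -/
def constC5 {d : ℕ} (D : Set (EuclideanSpace ℝ (Fin d))) (amin umin umax : ℝ)
    (yd l₀ u₀ ustar : L2 D) (α μ ρ η M c : ℝ) : ℝ :=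
  2 * phi (gradLip D amin α) μ ρ η 1 * constB1 D amin umin umax yd ^ 2 / M
    + (η + ρ) / 2 * ‖u₀ - ustar‖ ^ 2 + (‖l₀‖ ^ 2 + c ^ 2) / (μ * ρ)

end

/-! The equation enters only through its solution operator `S t`, which is linear, symmetric,
bounded by `C = C_P²/amin` and measurable in `t` (`exists_stateOps`). The cost is then `½‖S t u -
yd‖² + (α/2)‖u‖²`. Its expectation satisfies the quadratic lower bound with constant `α` and the
upper bound with `L = α + C²`, and the random part of its gradient is bounded by `B₁` on the
admissible set. Everything else takes place in a separable Hilbert space.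

Deterministic part. With `T k` the sum of the weights `tau j` for `j < k`, `T k • (u k - z k)` is
the weighted sum of the residuals `v (j+1) - s (j+1)`. So `psi k` and `lam k` are `l₀` minus `μρ`
and `2μρ` times this sum, and the scheme is a linearized ADMM with dual step `2μ rho k` followed by
averaging. The optimality conditions of the two proximal steps give `step_gap_le`. Since `rho k = ρ
tau k`, the weighted sum of these estimates telescopes in the multiplier and, by convexity, bounds
`T K` times the Lagrangian gap of the averages (`gap_le`).

Noise. The error term involves `v (k+1)`, which depends on the current batch. It is replaced by the
supremum `noiseValue` over all admissible points, with part of the negative proximal term `-‖v (k+1)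
- v k‖²` kept inside. The result depends only on the past and the batch error, is Lipschitz in that
error, and has mean at most a multiple of the batch variance. Bounded differences
(`integral_exp_lipschitz_sum_le`), independence of batch and past, and a Chernoff bound give the
tail `measureReal_noiseSum_ge_le`.

Conclusion. The noise event does not involve the multiplier, so outside it the gap is bounded for
all `‖l‖ ≤ c` at once. Taking `l = 0` bounds the objective. Taking `l` of norm `c` opposite to `u K
- z K` bounds the constraint violation, because the saddle point property and `c ≥ 2‖lstar‖` allow
the objective to fall below the optimum by at most `(c/2)‖u K - z K‖`. The parameter choices give `T
K ≥ K²/4` in the strongly convex case and `T K = K` in the convex one. -/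

noncomputable section

set_option linter.unusedSectionVars false

/-! ### Proximal steps -/

section Prox

variable {H : Type*} [NormedAddCommGroup H] [InnerProductSpace ℝ H]

theorem nonneg_of_forall_add_mul_nonneg {A B : ℝ} (h : ∀ t ∈ Ioc (0 : ℝ) 1, 0 ≤ A + t * B) :
    0 ≤ A := by
  have hlim : Filter.Tendsto (fun t : ℝ => A + t * B) (nhdsWithin 0 (Ioi 0)) (nhds A) := by
    have : Continuous fun t : ℝ => A + t * B := by fun_prop
    simpa using (this.tendsto 0).mono_left nhdsWithin_le_nhds
  refine ge_of_tendsto hlim ?_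
  filter_upwards [Ioc_mem_nhdsGT (zero_lt_one' ℝ)] with t ht using h t ht

/-- The objective of a proximal step with two centers. -/
def proxObjective (h : H → ℝ) (l : H) (r₁ r₂ : ℝ) (c₁ c₂ y : H) : ℝ :=
  h y + ⟪l, y⟫_ℝ + r₁ / 2 * ‖y - c₁‖ ^ 2 + r₂ / 2 * ‖y - c₂‖ ^ 2

theorem proxObjective_variational {S : Set H} {h : H → ℝ} (hh : ConvexOn ℝ S h) {l c₁ c₂ x y : H}
    {r₁ r₂ : ℝ} (hx : x ∈ S) (hmin : IsMinOn (proxObjective h l r₁ r₂ c₁ c₂) S x) (hy : y ∈ S) :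
    0 ≤ h y - h x + ⟪l + r₁ • (x - c₁) + r₂ • (x - c₂), y - x⟫_ℝ := by
  -- Compare `x` with `(1 - t) • x + t • y` and divide by `t`: the quadratic remainder is `t` times
  -- this `B`, and disappears as `t → 0`.
  apply nonneg_of_forall_add_mul_nonneg (B := (r₁ + r₂) / 2 * ‖y - x‖ ^ 2)
  intro t ht
  have hmem : (1 - t) • x + t • y ∈ S :=
    hh.1 hx hy (by linarith [ht.2]) ht.1.le (by ring)
  have h1 := hh.2 hx hy (show 0 ≤ 1 - t by linarith [ht.2]) ht.1.le (by ring)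
  have h2 : proxObjective h l r₁ r₂ c₁ c₂ x ≤ proxObjective h l r₁ r₂ c₁ c₂ ((1 - t) • x + t • y) :=
    hmin hmem
  have hexp : ∀ c : H, ‖(1 - t) • x + t • y - c‖ ^ 2
      = ‖x - c‖ ^ 2 + 2 * t * ⟪x - c, y - x⟫_ℝ + t ^ 2 * ‖y - x‖ ^ 2 := by
    intro c
    have : (1 - t) • x + t • y - c = (x - c) + t • (y - x) := by
      module
    rw [this, norm_add_sq_real, norm_smul, real_inner_smul_right, mul_pow, Real.norm_eq_abs, sq_abs]
    ring
  have hl : ⟪l, (1 - t) • x + t • y⟫_ℝ = ⟪l, x⟫_ℝ + t * ⟪l, y - x⟫_ℝ := by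
    rw [inner_add_right, real_inner_smul_right, real_inner_smul_right, inner_sub_right]
    ring
  simp only [proxObjective, hexp, hl, smul_eq_mul] at h1 h2
  simp only [inner_add_left, real_inner_smul_left]
  have key : 0 ≤ t * (h y - h x + (⟪l, y - x⟫_ℝ + r₁ * ⟪x - c₁, y - x⟫_ℝ
      + r₂ * ⟪x - c₂, y - x⟫_ℝ) + t * ((r₁ + r₂) / 2 * ‖y - x‖ ^ 2)) := by
    nlinarith
  exact nonneg_of_mul_nonneg_right key ht.1

/-- Minimizers of proximal objectives depend in a Lipschitz way on the data. -/
theorem proxObjective_lipschitz {S : Set H} {h : H → ℝ} (hh : ConvexOn ℝ S h)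
    {l c₁ c₂ x l' c₁' c₂' x' : H} {r₁ r₂ : ℝ} (hx : x ∈ S) (hx' : x' ∈ S)
    (hmin : IsMinOn (proxObjective h l r₁ r₂ c₁ c₂) S x)
    (hmin' : IsMinOn (proxObjective h l' r₁ r₂ c₁' c₂') S x') :
    (r₁ + r₂) * ‖x - x'‖ ≤ ‖(r₁ • c₁ + r₂ • c₂ - l) - (r₁ • c₁' + r₂ • c₂' - l')‖ := by
  have h1 := proxObjective_variational hh hx hmin hx'
  have h2 := proxObjective_variational hh hx' hmin' hx
  have h3 : ⟪(r₁ • c₁ + r₂ • c₂ - l) - (r₁ • c₁' + r₂ • c₂' - l'), x - x'⟫_ℝ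
      = (r₁ + r₂) * ‖x - x'‖ ^ 2 - ⟪l + r₁ • (x - c₁) + r₂ • (x - c₂), x - x'⟫_ℝ
        + ⟪l' + r₁ • (x' - c₁') + r₂ • (x' - c₂'), x - x'⟫_ℝ := by
    rw [← real_inner_self_eq_norm_sq, ← real_inner_smul_left, ← inner_sub_left, ← inner_add_left]
    congr 1
    module
  -- Adding the two variational inequalities cancels the values of `h` and leaves strong
  -- monotonicity against the difference of the data; Cauchy–Schwarz finishes.
  have h4 := real_inner_le_norm ((r₁ • c₁ + r₂ • c₂ - l) - (r₁ • c₁' + r₂ • c₂' - l')) (x - x')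
  rw [← neg_sub x x', inner_neg_right] at h1
  rcases eq_or_ne (‖x - x'‖) 0 with h0 | h0
  · rw [h0, mul_zero]; exact norm_nonneg _
  · have hpos : 0 < ‖x - x'‖ := lt_of_le_of_ne (norm_nonneg _) (Ne.symm h0)
    refine le_of_mul_le_mul_right ?_ hpos
    nlinarith

/-- A function whose increments are controlled by those of a measurable one is measurable. -/
theorem measurable_of_norm_sub_le {Ω : Type*} {mΩ : MeasurableSpace Ω} {H : Type*}
    [NormedAddCommGroup H] [MeasurableSpace H] [BorelSpace H] {x e : Ω → H} {r : ℝ} (hr : 0 < r)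
    (he : Measurable e) (h : ∀ ω ω', r * ‖x ω - x ω'‖ ≤ ‖e ω - e ω'‖) : Measurable x := by
  refine measurable_of_isOpen fun U hU => ?_
  -- `x` is a Lipschitz function of `e`. The set on the right is a union of balls about values of
  -- `e`, hence open, and the estimate keeps `x` inside `U` over each of these balls.
  have : x ⁻¹' U = e ⁻¹' {y | ∃ ω, x ω ∈ U ∧ ∃ ε, 0 < ε ∧ Metric.ball (x ω) ε ⊆ U ∧
      y ∈ Metric.ball (e ω) (r * ε)} := by
    ext ω
    constructor
    · intro hω
      obtain ⟨ε, hε, hb⟩ := Metric.isOpen_iff.1 hU _ hω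
      exact ⟨ω, hω, ε, hε, hb, Metric.mem_ball_self (mul_pos hr hε)⟩
    · rintro ⟨ω', -, ε, -, hb, hy⟩
      apply hb
      rw [Metric.mem_ball, dist_eq_norm] at hy ⊢
      exact lt_of_mul_lt_mul_left ((h ω ω').trans_lt hy) hr.le
  rw [this]
  refine he (IsOpen.measurableSet ?_)
  refine Metric.isOpen_iff.2 ?_
  rintro y ⟨ω, hω, ε, hε, hb, hy⟩
  obtain ⟨δ, hδ, hδb⟩ := Metric.isOpen_iff.1 Metric.isOpen_ball _ hy
  exact ⟨δ, hδ, fun z hz => ⟨ω, hω, ε, hε, hb, hδb hz⟩⟩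

end Prox

/-! ### One step of the method -/

section Step

variable {H : Type*} [NormedAddCommGroup H] [InnerProductSpace ℝ H]

/-- As a function of `e` the left side is a concave quadratic for `μ < 1`, maximal at `e = (2μ -
1)/(2(1 - μ)) • x`; completing the square there gives a bound slightly better than the one stated.
-/
theorem norm_sq_combination_le {μ : ℝ} (hμ1 : μ < 1) (x e : H) :
    (μ - 1 / 2) * ‖x + e‖ ^ 2 - 1 / 2 * ‖e‖ ^ 2 ≤ μ / (2 * (1 - μ)) * ‖x‖ ^ 2 := by
  have h1 : 0 < 1 - μ := by linarith
  have h2 : 0 ≤ ‖(2 * (1 - μ)) • e - (2 * μ - 1) • x‖ ^ 2 := sq_nonneg _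
  rw [norm_sub_sq_real, norm_smul, norm_smul, real_inner_smul_left, real_inner_smul_right, mul_pow,
    mul_pow, Real.norm_eq_abs, Real.norm_eq_abs, sq_abs, sq_abs, real_inner_comm] at h2
  have h3 : μ / (2 * (1 - μ)) * ‖x‖ ^ 2 = μ * ‖x‖ ^ 2 / (2 * (1 - μ)) := by ring
  rw [norm_add_sq_real, h3, le_div_iff₀ (by linarith)]
  nlinarith [sq_nonneg ‖x‖]

/-- The estimate for one step, with `o`, `p`, `q` the differences of the iterates `v k`, `v (k+1)`,
`s (k+1)` to the solution. -/
theorem step_gap_le {L α μ ρ η fp fo fst gq gst : ℝ} {o p q G D l l' lam : H}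
    (hμ0 : 0 < μ) (hμ1 : μ < 1) (hρ : 0 < ρ)
    (hup : fp ≤ fo + ⟪D, p - o⟫_ℝ + L / 2 * ‖p - o‖ ^ 2)
    (hlow : fo + ⟪D, -o⟫_ℝ + α / 2 * ‖o‖ ^ 2 ≤ fst)
    (hV : 0 ≤ ⟪G - l + ρ • (p - q) + η • (p - o), -p⟫_ℝ)
    (hS : 0 ≤ gst - gq + ⟪l + ρ • (q - o), -q⟫_ℝ)
    (hl : l' = l - (2 * μ * ρ) • (p - q)) :
    fp + gq - fst - gst - ⟪lam, p - q⟫_ℝ ≤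
      1 / (4 * μ * ρ) * (‖l - lam‖ ^ 2 - ‖l' - lam‖ ^ 2)
      + (ρ + η) / 2 * (‖o‖ ^ 2 - ‖p‖ ^ 2) - α / 2 * ‖o‖ ^ 2
      + 1 / 2 * (L - η + μ * ρ / (1 - μ)) * ‖p - o‖ ^ 2 - ⟪G - D, p⟫_ℝ := by
  -- Polarizing the two penalty terms and adding `μρ‖p - q‖²` from the dual step leaves `ρ((μ - ½)‖p
  -- - q‖² - ½‖o - q‖²)`, where `p - q = (p - o) + (o - q)`. This is the source of `μρ/(1 - μ)`.
  have h1 := mul_le_mul_of_nonneg_left (norm_sq_combination_le hμ1 (p - o) (o - q)) hρ.le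
  rw [sub_add_sub_cancel] at h1
  have h2 : 1 / (4 * μ * ρ) * (‖l - lam‖ ^ 2 - ‖l' - lam‖ ^ 2)
      = ⟪l - lam, p - q⟫_ℝ - μ * ρ * ‖p - q‖ ^ 2 := by
    have : l' - lam = (l - lam) - (2 * μ * ρ) • (p - q) := by rw [hl]; module
    rw [this, norm_sub_sq_real (l - lam), norm_smul, real_inner_smul_right, mul_pow,
      Real.norm_eq_abs, sq_abs]
    field_simp
    ring
  have h3 : ρ * (μ / (2 * (1 - μ)) * ‖p - o‖ ^ 2)
      = 1 / 2 * (μ * ρ / (1 - μ)) * ‖p - o‖ ^ 2 := by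
    have : (1 - μ) ≠ 0 := by linarith
    field_simp
  rw [h2]
  rw [h3] at h1
  simp only [← real_inner_self_eq_norm_sq, inner_sub_left, inner_sub_right, inner_add_left,
    inner_neg_right, real_inner_smul_left, real_inner_comm o p, real_inner_comm q p,
    real_inner_comm q o] at *
  linarith

end Step

/-! ### Summing the steps -/

section Run

variable {H : Type*} [NormedAddCommGroup H] [InnerProductSpace ℝ H]

theorem IsSaddlePoint.eq {f g : H → ℝ} {Uad : Set H} {u' z' l' : H}
    (h : IsSaddlePoint f g Uad u' z' l') : u' = z' := by
  have h1 := h.2.1 (l' - (u' - z'))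
  simp only [lagrangian, inner_sub_left] at h1
  have h2 : ⟪u' - z', u' - z'⟫_ℝ ≤ 0 := by rw [inner_sub_left]; linarith
  exact sub_eq_zero.1 (real_inner_self_nonpos.1 h2)

theorem IsSaddlePoint.le_inner {f g : H → ℝ} {Uad : Set H} {u' z' l' u z : H}
    (h : IsSaddlePoint f g Uad u' z' l') (hu : u ∈ Uad) :
    f u' + g z' + ⟪l', u - z⟫_ℝ ≤ f u + g z := by
  have h1 := h.2.2 u hu z
  have h2 : ⟪l', u' - z'⟫_ℝ = 0 := by rw [h.eq, sub_self, inner_zero_right]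
  simp only [lagrangian, h2] at h1
  linarith

variable [CompleteSpace H] {Ω Ξ : Type*} {F : H → Ξ → ℝ} {g : H → ℝ} {Uad : Set H}
  {m : ℕ → ℕ} {X : (k : ℕ) → Fin (m k) → Ω → Ξ} {μ ρ α L : ℝ} {rho eta θ tau T : ℕ → ℝ}
  {v₀ s₀ l₀ : H} {u v z s lam psi : ℕ → Ω → H}

/-- The weights of the averages computed by the method: `T k` is the sum of the first `k` weights
`tau j`, and the penalty parameters are proportional to the weights. -/
structure StepWeights (ρ : ℝ) (rho θ tau T : ℕ → ℝ) : Prop where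
  zero : T 0 = 0
  succ : ∀ k, T (k + 1) = T k + tau k
  pos : ∀ k, 0 < tau k
  theta : ∀ k, θ k * tau k = T (k + 1)
  rho_eq : ∀ k, rho k = ρ * tau k

theorem StepWeights.nonneg (h : StepWeights ρ rho θ tau T) (k : ℕ) : 0 ≤ T k := by
  induction k with
  | zero => exact h.zero.ge
  | succ k ih => rw [h.succ]; exact add_nonneg ih (h.pos k).le

theorem StepWeights.succ_pos (h : StepWeights ρ rho θ tau T) (k : ℕ) : 0 < T (k + 1) := by
  rw [h.succ]; exact add_pos_of_nonneg_of_pos (h.nonneg k) (h.pos k)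

theorem StepWeights.inv_theta (h : StepWeights ρ rho θ tau T) (k : ℕ) :
    (θ k)⁻¹ = tau k / T (k + 1) := by
  have := (h.pos k).ne'
  rw [← h.theta, div_mul_cancel_right₀ this]

theorem StepWeights.one_sub_inv_theta (h : StepWeights ρ rho θ tau T) (k : ℕ) :
    1 - (θ k)⁻¹ = T k / T (k + 1) := by
  rw [h.inv_theta, eq_div_iff (h.succ_pos k).ne', sub_mul, div_mul_cancel₀ _ (h.succ_pos k).ne',
    h.succ]
  ring

/-- The batch gradient of a step. -/
def batchGradient (F : H → Ξ → ℝ) {n : ℕ} (b : Fin n → Ξ) (w : H) : H :=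
  (1 / (n : ℝ)) • ∑ i, gradient (fun y => F y (b i)) w

namespace IsADMMRun

/-- The weights `1 - (θ k)⁻¹` and `(θ k)⁻¹` are `T k / T (k+1)` and `tau k / T (k+1)`, so the
averages become plain weighted sums after multiplication by `T`. -/
theorem sub_succ (hr : IsADMMRun F g Uad m X μ rho eta θ v₀ s₀ l₀ u v z s lam psi)
    (hw : StepWeights ρ rho θ tau T) (k : ℕ) (ω : Ω) :
    T (k + 1) • (u (k + 1) ω - z (k + 1) ω)
      = T k • (u k ω - z k ω) + tau k • (v (k + 1) ω - s (k + 1) ω) := by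
  have h0 := (hw.succ_pos k).ne'
  rw [hr.u_step, hr.z_step, hw.one_sub_inv_theta, hw.inv_theta]
  have h1 : T (k + 1) * (T k / T (k + 1)) = T k := by field_simp
  have h2 : T (k + 1) * (tau k / T (k + 1)) = tau k := by field_simp
  simp only [smul_sub, smul_add, smul_smul, h1, h2]
  abel

theorem psi_eq (hr : IsADMMRun F g Uad m X μ rho eta θ v₀ s₀ l₀ u v z s lam psi)
    (hw : StepWeights ρ rho θ tau T) (k : ℕ) (ω : Ω) :
    psi k ω = l₀ - (μ * ρ) • T k • (u k ω - z k ω) := by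
  induction k with
  | zero => simp [hw.zero, hr.psi_init]
  | succ k ih =>
    rw [hr.psi_step, ih, hr.sub_succ hw, hw.rho_eq]
    module

theorem lam_eq (hr : IsADMMRun F g Uad m X μ rho eta θ v₀ s₀ l₀ u v z s lam psi)
    (hw : StepWeights ρ rho θ tau T) (k : ℕ) (ω : Ω) :
    lam k ω = l₀ - (2 * μ * ρ) • T k • (u k ω - z k ω) := by
  cases k with
  | zero => simp [hw.zero, hr.lam_init]
  | succ k =>
    have h : μ * rho k * θ k = μ * ρ * T (k + 1) := by rw [← hw.theta, hw.rho_eq]; ring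
    rw [hr.lam_step, hr.psi_eq hw, h]
    module

/-- Half of this step comes from `psi`, half from the extra term proportional to the averaged
residual, which equals the accumulated dual steps. Hence `lam` evolves like an ordinary ADMM
multiplier with twice the step, and its distances to a fixed multiplier telescope. -/
theorem lam_succ (hr : IsADMMRun F g Uad m X μ rho eta θ v₀ s₀ l₀ u v z s lam psi)
    (hw : StepWeights ρ rho θ tau T) (k : ℕ) (ω : Ω) :
    lam (k + 1) ω = lam k ω - (2 * μ * rho k) • (v (k + 1) ω - s (k + 1) ω) := by
  rw [hr.lam_eq hw, hr.lam_eq hw, hr.sub_succ hw, hw.rho_eq]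
  module

theorem v_mem_all (hr : IsADMMRun F g Uad m X μ rho eta θ v₀ s₀ l₀ u v z s lam psi)
    (hv₀ : v₀ ∈ Uad) (k : ℕ) (ω : Ω) : v k ω ∈ Uad := by
  cases k with
  | zero => rw [hr.v_init]; exact hv₀
  | succ k => exact hr.v_mem k ω

theorem u_mem_all (hr : IsADMMRun F g Uad m X μ rho eta θ v₀ s₀ l₀ u v z s lam psi)
    (hw : StepWeights ρ rho θ tau T) (hU : Convex ℝ Uad) (hv₀ : v₀ ∈ Uad) (k : ℕ) (ω : Ω) :
    u k ω ∈ Uad := by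
  induction k with
  | zero => rw [hr.u_init]; exact hv₀
  | succ k ih =>
    rw [hr.u_step]
    refine hU ih (hr.v_mem k ω) ?_ ?_ (by ring)
    · rw [hw.one_sub_inv_theta]; exact div_nonneg (hw.nonneg k) (hw.succ_pos k).le
    · rw [hw.inv_theta]; exact div_nonneg (hw.pos k).le (hw.succ_pos k).le

theorem s_isMinOn (hr : IsADMMRun F g Uad m X μ rho eta θ v₀ s₀ l₀ u v z s lam psi)
    (k : ℕ) (ω : Ω) :
    IsMinOn (proxObjective g (lam k ω) (rho k) 0 (v k ω) 0) univ (s (k + 1) ω) := by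
  have h := hr.s_step k ω
  have he : proxObjective g (lam k ω) (rho k) 0 (v k ω) 0
      = fun y => g y + ⟪lam k ω, y⟫_ℝ + rho k / 2 * ‖y - v k ω‖ ^ 2 := by
    funext y; simp [proxObjective]
  rwa [he]

theorem v_isMinOn (hr : IsADMMRun F g Uad m X μ rho eta θ v₀ s₀ l₀ u v z s lam psi)
    (k : ℕ) (ω : Ω) :
    IsMinOn (proxObjective (fun _ => 0) (batchGradient F (fun i => X k i ω) (v k ω) - lam k ω)
      (rho k) (eta k) (s (k + 1) ω) (v k ω)) Uad (v (k + 1) ω) := by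
  have h := hr.v_step k ω
  have he : proxObjective (fun _ => 0) (batchGradient F (fun i => X k i ω) (v k ω) - lam k ω)
      (rho k) (eta k) (s (k + 1) ω) (v k ω)
      = fun y => ⟪(1 / (m k : ℝ)) • ∑ i, gradient (fun w => F w (X k i ω)) (v k ω) - lam k ω, y⟫_ℝ
      + rho k / 2 * ‖y - s (k + 1) ω‖ ^ 2 + eta k / 2 * ‖y - v k ω‖ ^ 2 := by
    funext y; simp [proxObjective, batchGradient]
  rwa [he]

/-- The sum of the estimates for the single steps. -/
theorem gap_le (hr : IsADMMRun F g Uad m X μ rho eta θ v₀ s₀ l₀ u v z s lam psi)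
    (hw : StepWeights ρ rho θ tau T) (hμ0 : 0 < μ) (hμ1 : μ < 1) (hρ : 0 < ρ) (hv₀ : v₀ ∈ Uad)
    (hg : ConvexOn ℝ univ g) {f : H → ℝ} {D : H → H} (hf : ConvexOn ℝ Uad f)
    (hup : ∀ x ∈ Uad, ∀ y ∈ Uad, f y ≤ f x + ⟪D x, y - x⟫_ℝ + L / 2 * ‖y - x‖ ^ 2)
    (hlow : ∀ x ∈ Uad, ∀ y ∈ Uad, f x + ⟪D x, y - x⟫_ℝ + α / 2 * ‖y - x‖ ^ 2 ≤ f y)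
    {xst : H} (hxst : xst ∈ Uad) (l : H) (ω : Ω) (K : ℕ) :
    T K * (f (u K ω) + g (z K ω) - f xst - g xst - ⟪l, u K ω - z K ω⟫_ℝ)
      + 1 / (4 * μ * ρ) * ‖lam K ω - l‖ ^ 2 ≤
    1 / (4 * μ * ρ) * ‖l₀ - l‖ ^ 2 + ∑ k ∈ Finset.range K, tau k *
      ((rho k + eta k) / 2 * (‖v k ω - xst‖ ^ 2 - ‖v (k + 1) ω - xst‖ ^ 2)
        - α / 2 * ‖v k ω - xst‖ ^ 2
        + 1 / 2 * (L - eta k + μ * rho k / (1 - μ)) * ‖v (k + 1) ω - v k ω‖ ^ 2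
        - ⟪batchGradient F (fun i => X k i ω) (v k ω) - D (v k ω), v (k + 1) ω - xst⟫_ℝ) := by
  induction K with
  | zero => simp [hw.zero, hr.lam_init]
  | succ k ih =>
    rw [Finset.sum_range_succ]
    have hvk := hr.v_mem_all hv₀ k ω
    have hvk' := hr.v_mem k ω
    have hrho : 0 < rho k := by rw [hw.rho_eq]; exact mul_pos hρ (hw.pos k)
    have hconv0 : ConvexOn ℝ Uad (fun _ : H => (0 : ℝ)) := convexOn_const 0 hf.1
    have hV := proxObjective_variational hconv0 hvk' (hr.v_isMinOn k ω) hxst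
    have hS := proxObjective_variational hg (mem_univ _) (hr.s_isMinOn k ω) (mem_univ xst)
    have hstep := step_gap_le (L := L) (α := α) (η := eta k) (fp := f (v (k + 1) ω))
      (fo := f (v k ω)) (fst := f xst)
      (gq := g (s (k + 1) ω)) (gst := g xst) (o := v k ω - xst) (p := v (k + 1) ω - xst)
      (q := s (k + 1) ω - xst) (G := batchGradient F (fun i => X k i ω) (v k ω)) (D := D (v k ω))
      (l := lam k ω) (l' := lam (k + 1) ω) (lam := l) hμ0 hμ1 hrho
      (by simpa using hup _ hvk _ hvk')
      (by simpa [norm_sub_rev] using hlow _ hvk _ hxst)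
      (by simpa using hV) (by simpa using hS) (by simpa using hr.lam_succ hw k ω)
    simp only [sub_sub_sub_cancel_right] at hstep
    have hT := hw.succ_pos k
    have htau := hw.pos k
    have hc1 : 0 ≤ 1 - (θ k)⁻¹ := by
      rw [hw.one_sub_inv_theta]; exact div_nonneg (hw.nonneg k) hT.le
    have hc2 : 0 ≤ (θ k)⁻¹ := by
      rw [hw.inv_theta]; exact div_nonneg htau.le hT.le
    have hfu := hf.2 (hr.u_mem_all hw hf.1 hv₀ k ω) hvk' hc1 hc2 (by ring)
    have hgz := hg.2 (mem_univ (z k ω)) (mem_univ (s (k + 1) ω)) hc1 hc2 (by ring)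
    rw [← hr.u_step, hw.one_sub_inv_theta, hw.inv_theta, smul_eq_mul, smul_eq_mul] at hfu
    rw [← hr.z_step, hw.one_sub_inv_theta, hw.inv_theta, smul_eq_mul, smul_eq_mul] at hgz
    have hfu' := mul_le_mul_of_nonneg_left hfu hT.le
    have hgz' := mul_le_mul_of_nonneg_left hgz hT.le
    have e1 : ∀ a b : ℝ, T (k + 1) * (T k / T (k + 1) * a + tau k / T (k + 1) * b)
        = T k * a + tau k * b := by intro a b; field_simp
    rw [e1] at hfu' hgz'
    have hin : T (k + 1) * ⟪l, u (k + 1) ω - z (k + 1) ω⟫_ℝ = T k * ⟪l, u k ω - z k ω⟫_ℝ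
        + tau k * ⟪l, v (k + 1) ω - s (k + 1) ω⟫_ℝ := by
      rw [← real_inner_smul_right, hr.sub_succ hw, inner_add_right, real_inner_smul_right,
        real_inner_smul_right]
    have hstep' := mul_le_mul_of_nonneg_left hstep htau.le
    -- The proportionality `rho k = ρ * tau k` cancels the weight, so the multiplier terms telescope
    -- with a constant factor.
    have e2 : tau k * (1 / (4 * μ * rho k) * (‖lam k ω - l‖ ^ 2 - ‖lam (k + 1) ω - l‖ ^ 2))
        = 1 / (4 * μ * ρ) * ‖lam k ω - l‖ ^ 2 - 1 / (4 * μ * ρ) * ‖lam (k + 1) ω - l‖ ^ 2 := by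
      rw [hw.rho_eq]; field_simp
    have hTs := hw.succ k
    have e3 : T (k + 1) * (f xst + g xst) = T k * (f xst + g xst) + tau k * (f xst + g xst) := by
      rw [hTs]; ring
    linarith

end IsADMMRun

end Run

/-! ### Functions of a sum of bounded independent vectors -/

section Concentration

/-- Hoeffding's lemma in terms of the oscillation: the values of `f` lie in an interval of length
`c` starting at its infimum. -/
theorem integral_exp_mul_le_of_oscillation {Ξ : Type*} [MeasurableSpace Ξ] {ν : Measure Ξ}
    [IsProbabilityMeasure ν] {f : Ξ → ℝ} (hf : Measurable f) {c : ℝ} (hc : ∀ x y, f x - f y ≤ c)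
    (s : ℝ) :
    ∫ x, Real.exp (s * f x) ∂ν ≤ Real.exp (s * ∫ x, f x ∂ν + s ^ 2 * c ^ 2 / 8) := by
  obtain ⟨x₀⟩ : Nonempty Ξ := by
    by_contra h
    rw [not_nonempty_iff] at h
    have := measure_univ (μ := ν)
    rw [univ_eq_empty_iff.2 h, measure_empty] at this
    exact zero_ne_one this
  have hbdd : BddBelow (range f) := ⟨f x₀ - c, by rintro _ ⟨y, rfl⟩; linarith [hc x₀ y]⟩
  have : Nonempty Ξ := ⟨x₀⟩
  have hmem : ∀ x, f x ∈ Icc (⨅ y, f y) ((⨅ y, f y) + c) := fun x =>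
    ⟨ciInf_le hbdd x, by
      have : f x - c ≤ ⨅ y, f y := le_ciInf fun y => by linarith [hc x y]
      linarith⟩
  have hsub := (hasSubgaussianMGF_of_mem_Icc (μ := ν) hf.aemeasurable
    (Filter.Eventually.of_forall hmem)).mgf_le s
  have hint : ∫ x, Real.exp (s * f x) ∂ν
      = Real.exp (s * ∫ x, f x ∂ν) * mgf (fun x => f x - ∫ y, f y ∂ν) ν s := by
    rw [mgf, ← integral_const_mul]
    congr 1
    funext x
    rw [← Real.exp_add]
    ring_nf
  rw [hint, Real.exp_add]
  refine mul_le_mul_of_nonneg_left (hsub.trans ?_) (Real.exp_nonneg _)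
  apply Real.exp_le_exp.2
  simp only [add_sub_cancel_left, NNReal.coe_pow, NNReal.coe_div, coe_nnnorm, Real.norm_eq_abs,
    NNReal.coe_ofNat, div_pow, sq_abs]
  linarith

theorem bounded_on_balls_of_lipschitz {H : Type*} [NormedAddCommGroup H] {Φ : H → ℝ} {R : ℝ}
    (hΦ : ∀ x y, |Φ x - Φ y| ≤ R * ‖x - y‖) (r : ℝ) : ∃ M, ∀ y, ‖y‖ ≤ r → |Φ y| ≤ M := by
  refine ⟨|Φ 0| + |R| * r, fun y hy => ?_⟩
  have h1 := hΦ y 0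
  rw [sub_zero] at h1
  have h2 : |Φ y| ≤ |Φ y - Φ 0| + |Φ 0| := by simpa using abs_add_le (Φ y - Φ 0) (Φ 0)
  have h3 : R * ‖y‖ ≤ |R| * r :=
    mul_le_mul (le_abs_self _) hy (norm_nonneg _) (abs_nonneg _)
  linarith

theorem continuous_of_lipschitz {H : Type*} [NormedAddCommGroup H] {Φ : H → ℝ} {R : ℝ} (hR : 0 ≤ R)
    (hΦ : ∀ x y, |Φ x - Φ y| ≤ R * ‖x - y‖) : Continuous Φ :=
  (LipschitzWith.of_dist_le_mul (K := ⟨R, hR⟩) fun x y => by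
    rw [Real.dist_eq, dist_eq_norm]; exact hΦ x y).continuous

variable {Ξ : Type*} [MeasurableSpace Ξ] {ν : Measure Ξ} [IsProbabilityMeasure ν]

theorem integral_pi_fin_succ {n : ℕ} {h : (Fin (n + 1) → Ξ) → ℝ}
    (hi : Integrable h (Measure.pi fun _ => ν)) :
    ∫ b, h b ∂(Measure.pi fun _ => ν)
      = ∫ b, ∫ x, h (Fin.cons x b) ∂ν ∂(Measure.pi fun _ : Fin n => ν) := by
  have hp := (measurePreserving_piFinSuccAbove (fun _ : Fin (n + 1) => ν) 0).symm
  have h1 := hp.integral_comp' h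
  have h2 : Integrable (fun p => h ((MeasurableEquiv.piFinSuccAbove (fun _ => Ξ) 0).symm p))
      (ν.prod (Measure.pi fun _ : Fin n => ν)) :=
    (hp.integrable_comp_emb (MeasurableEquiv.measurableEmbedding _)).2 hi
  rw [← h1, integral_prod_symm _ h2]
  simp [MeasurableEquiv.piFinSuccAbove, Fin.insertNthEquiv]

variable {H : Type*} [NormedAddCommGroup H] [MeasurableSpace H] [BorelSpace H]
  [SecondCountableTopology H]

/-- The sum of bounded vectors stays in a ball, so boundedness of `ψ` on balls suffices. This also
covers the exponentials and quadratics used below. -/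
theorem integrable_comp_sum {Y : Ξ → H} (hY : Measurable Y) {C : ℝ} (hC : ∀ x, ‖Y x‖ ≤ C)
    {ψ : H → ℝ} (hψ : Continuous ψ) (hb : ∀ r, ∃ M, ∀ y, ‖y‖ ≤ r → |ψ y| ≤ M) (n : ℕ) (w : H) :
    Integrable (fun b : Fin n → Ξ => ψ (w + ∑ i, Y (b i))) (Measure.pi fun _ => ν) := by
  obtain ⟨M, hM⟩ := hb (‖w‖ + n * C)
  refine Integrable.of_bound (C := M) ?_ (Filter.Eventually.of_forall fun b => hM _ ?_)
  · exact (hψ.measurable.comp (by fun_prop)).aestronglyMeasurable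
  · refine (norm_add_le _ _).trans (add_le_add_right ((norm_sum_le _ _).trans ?_) _)
    refine (Finset.sum_le_sum fun i _ => hC (b i)).trans ?_
    simp

/-- A bounded differences inequality: a Lipschitz function of a sum of independent bounded vectors
has sub-Gaussian fluctuations. -/
theorem integral_exp_lipschitz_sum_le {Y : Ξ → H} (hY : Measurable Y) {C b₀ : ℝ}
    (hC : ∀ x, ‖Y x‖ ≤ C) (hosc : ∀ x y, ‖Y x - Y y‖ ≤ b₀) {R : ℝ} (hR : 0 ≤ R) (s : ℝ) (n : ℕ) :
    ∀ {Φ : H → ℝ}, (∀ x y, |Φ x - Φ y| ≤ R * ‖x - y‖) → ∀ w : H,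
    ∫ b, Real.exp (s * Φ (w + ∑ i, Y (b i))) ∂(Measure.pi fun _ : Fin n => ν) ≤
      Real.exp (s * ∫ b, Φ (w + ∑ i, Y (b i)) ∂(Measure.pi fun _ : Fin n => ν)
        + n * (s ^ 2 * (R * b₀) ^ 2 / 8)) := by
  induction n with
  | zero =>
    intro Φ hΦ w
    simp
  | succ n ih =>
    intro Φ hΦ w
    have hcont := continuous_of_lipschitz hR hΦ
    have hbb := bounded_on_balls_of_lipschitz hΦ
    have hintx : ∀ y : H, Integrable (fun x => Φ (y + Y x)) ν := by
      intro y
      obtain ⟨M, hM⟩ := hbb (‖y‖ + C)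
      refine Integrable.of_bound (C := M) ?_ (Filter.Eventually.of_forall fun b => hM _ ?_)
      · exact (hcont.measurable.comp (by fun_prop)).aestronglyMeasurable
      · exact (norm_add_le _ _).trans (add_le_add_right (hC b) _)
    -- Integrating out one sample gives a function with the same Lipschitz constant, so the
    -- induction must allow `Φ` to vary. The freezing of the other samples costs one factor from
    -- Hoeffding's lemma.
    set Φ₁ : H → ℝ := fun y => ∫ x, Φ (y + Y x) ∂ν with hΦ₁
    have hΦ₁L : ∀ x y, |Φ₁ x - Φ₁ y| ≤ R * ‖x - y‖ := by
      intro x y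
      simp only [hΦ₁]
      rw [← integral_sub (hintx x) (hintx y)]
      have := norm_integral_le_of_norm_le_const (μ := ν) (C := R * ‖x - y‖)
        (f := fun t => Φ (x + Y t) - Φ (y + Y t)) (Filter.Eventually.of_forall fun t => by
          rw [Real.norm_eq_abs]
          simpa using hΦ (x + Y t) (y + Y t))
      simpa using this
    have hcons : ∀ (x : Ξ) (b : Fin n → Ξ),
        w + ∑ i, Y ((Fin.cons x b : Fin (n + 1) → Ξ) i) = (w + ∑ i, Y (b i)) + Y x := by
      intro x b
      rw [Fin.sum_univ_succ]
      simp only [Fin.cons_zero, Fin.cons_succ]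
      abel
    have hexpbb : ∀ {Φ' : H → ℝ}, (∀ x y, |Φ' x - Φ' y| ≤ R * ‖x - y‖) → ∀ a r : ℝ,
        ∃ M, ∀ y, ‖y‖ ≤ r → |a * Real.exp (s * Φ' y)| ≤ M := by
      intro Φ' hΦ' a r
      obtain ⟨M, hM⟩ := bounded_on_balls_of_lipschitz hΦ' r
      refine ⟨|a| * Real.exp (|s| * M), fun y hy => ?_⟩
      rw [abs_mul, Real.abs_exp]
      refine mul_le_mul_of_nonneg_left (Real.exp_le_exp.2 ?_) (abs_nonneg _)
      refine (le_abs_self _).trans ?_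
      rw [abs_mul]
      exact mul_le_mul_of_nonneg_left (hM y hy) (abs_nonneg _)
    have hint1 := integrable_comp_sum (ν := ν) hY hC (ψ := fun y => Real.exp (s * Φ y))
      (by fun_prop) (fun r => by simpa using hexpbb hΦ 1 r) (n + 1) w
    have hint2 := integrable_comp_sum (ν := ν) hY hC hcont hbb (n + 1) w
    rw [integral_pi_fin_succ hint1, integral_pi_fin_succ hint2]
    simp only [hcons]
    have hinner : ∀ y : H, ∫ x, Real.exp (s * Φ (y + Y x)) ∂ν
        ≤ Real.exp (s ^ 2 * (R * b₀) ^ 2 / 8) * Real.exp (s * Φ₁ y) := by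
      intro y
      rw [← Real.exp_add, add_comm]
      refine integral_exp_mul_le_of_oscillation (hcont.measurable.comp (by fun_prop)) ?_ s
      intro x x'
      refine (le_abs_self _).trans ((hΦ _ _).trans ?_)
      rw [add_sub_add_left_eq_sub]
      exact mul_le_mul_of_nonneg_left (hosc _ _) hR
    have hint3 := integrable_comp_sum (ν := ν) hY hC
      (ψ := fun y => Real.exp (s ^ 2 * (R * b₀) ^ 2 / 8) * Real.exp (s * Φ₁ y))
      (by have := continuous_of_lipschitz hR hΦ₁L; fun_prop) (fun r => hexpbb hΦ₁L _ r) n w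
    have hmono := integral_mono_of_nonneg (μ := Measure.pi fun _ : Fin n => ν)
      (Filter.Eventually.of_forall fun b => integral_nonneg fun x => Real.exp_nonneg _)
      hint3 (Filter.Eventually.of_forall fun b => hinner (w + ∑ i, Y (b i)))
    refine hmono.trans ?_
    rw [integral_const_mul]
    refine (mul_le_mul_of_nonneg_left (ih hΦ₁L w) (Real.exp_nonneg _)).trans ?_
    rw [← Real.exp_add]
    apply Real.exp_le_exp.2
    push_cast
    linarith

/-- First and second moments of a sum of independent centered vectors. -/
theorem integral_inner_add_norm_sq_sum_le [InnerProductSpace ℝ H] [CompleteSpace H]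
    {Y : Ξ → H} (hY : Measurable Y) {C : ℝ}
    (hC : ∀ x, ‖Y x‖ ≤ C) (h0 : ∫ x, Y x ∂ν = 0) {c : ℝ} (hc : 0 ≤ c) (y : H) (n : ℕ) (w : H) :
    ∫ b, (⟪w + ∑ i, Y (b i), y⟫_ℝ + c * ‖w + ∑ i, Y (b i)‖ ^ 2) ∂(Measure.pi fun _ : Fin n => ν)
      ≤ ⟪w, y⟫_ℝ + c * ‖w‖ ^ 2 + n * (c * C ^ 2) := by
  induction n with
  | zero => simp
  | succ n ih =>
    have hbb : ∀ a r : ℝ, ∃ M, ∀ x : H, ‖x‖ ≤ r → |⟪x, y⟫_ℝ + c * ‖x‖ ^ 2 + a| ≤ M := by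
      intro a r
      refine ⟨r * ‖y‖ + c * r ^ 2 + |a|, fun x hx => ?_⟩
      have h1 := abs_real_inner_le_norm x y
      have h2 := mul_le_mul_of_nonneg_right hx (norm_nonneg y)
      have h3 : c * ‖x‖ ^ 2 ≤ c * r ^ 2 := by gcongr
      have h4 : |c * ‖x‖ ^ 2| = c * ‖x‖ ^ 2 := abs_of_nonneg (by positivity)
      have h5 := abs_add_three (⟪x, y⟫_ℝ) (c * ‖x‖ ^ 2) a
      linarith
    have hint1 := integrable_comp_sum (ν := ν) hY hC (ψ := fun x => ⟪x, y⟫_ℝ + c * ‖x‖ ^ 2)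
      (by fun_prop) (fun r => by simpa using hbb 0 r)
    have hint2 := integrable_comp_sum (ν := ν) hY hC
      (ψ := fun x => ⟪x, y⟫_ℝ + c * ‖x‖ ^ 2 + c * C ^ 2)
      (by fun_prop) (fun r => hbb _ r) n w
    have hcons : ∀ (x : Ξ) (b : Fin n → Ξ),
        w + ∑ i, Y ((Fin.cons x b : Fin (n + 1) → Ξ) i) = (w + ∑ i, Y (b i)) + Y x := by
      intro x b
      rw [Fin.sum_univ_succ]
      simp only [Fin.cons_zero, Fin.cons_succ]
      abel
    rw [integral_pi_fin_succ (hint1 (n + 1) w)]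
    simp only [hcons]
    have hYint : Integrable Y ν :=
      Integrable.of_bound hY.aestronglyMeasurable C (Filter.Eventually.of_forall hC)
    have hinner : ∀ x₀ : H, ∫ x, (⟪x₀ + Y x, y⟫_ℝ + c * ‖x₀ + Y x‖ ^ 2) ∂ν
        ≤ ⟪x₀, y⟫_ℝ + c * ‖x₀‖ ^ 2 + c * C ^ 2 := by
      intro x₀
      -- Centering removes every term linear in the new sample, so only its squared norm contributes
      -- to the mean.
      have hlin : ∀ e : H, ∫ x, ⟪e, Y x⟫_ℝ ∂ν = 0 := by
        intro e
        rw [integral_inner hYint, h0, inner_zero_right]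
      have hle : ∀ x, ⟪x₀ + Y x, y⟫_ℝ + c * ‖x₀ + Y x‖ ^ 2
          ≤ (⟪x₀, y⟫_ℝ + c * ‖x₀‖ ^ 2 + c * C ^ 2) + ⟪y + (2 * c) • x₀, Y x⟫_ℝ := by
        intro x
        have : ‖Y x‖ ^ 2 ≤ C ^ 2 := by gcongr; exact hC x
        have := mul_le_mul_of_nonneg_left this hc
        rw [norm_add_sq_real, inner_add_left, inner_add_left, real_inner_smul_left,
          real_inner_comm y (Y x)]
        linarith
      have hi2 : Integrable (fun x => (⟪x₀, y⟫_ℝ + c * ‖x₀‖ ^ 2 + c * C ^ 2)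
          + ⟪y + (2 * c) • x₀, Y x⟫_ℝ) ν := (integrable_const _).add (hYint.const_inner _)
      have hi1 : Integrable (fun x => ⟪x₀ + Y x, y⟫_ℝ + c * ‖x₀ + Y x‖ ^ 2) ν := by
        obtain ⟨M, hM⟩ := hbb 0 (‖x₀‖ + C)
        refine Integrable.of_bound (C := M) ?_ (Filter.Eventually.of_forall fun b => ?_)
        · exact Measurable.aestronglyMeasurable (by fun_prop)
        · simpa using hM _ ((norm_add_le _ _).trans (add_le_add_right (hC b) _))
      refine (integral_mono hi1 hi2 hle).trans ?_
      rw [integral_add (integrable_const _) (hYint.const_inner _), hlin]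
      simp
    have hint3 : Integrable (fun b : Fin n → Ξ => ∫ x, (⟪w + ∑ i, Y (b i) + Y x, y⟫_ℝ
        + c * ‖w + ∑ i, Y (b i) + Y x‖ ^ 2) ∂ν) (Measure.pi fun _ => ν) := by
      have hp := (measurePreserving_piFinSuccAbove (fun _ : Fin (n + 1) => ν) 0).symm
      have h2 := (hp.integrable_comp_emb (MeasurableEquiv.measurableEmbedding _)).2
        (hint1 (n + 1) w)
      have h3 := h2.integral_prod_right
      simpa [Function.comp_def, MeasurableEquiv.piFinSuccAbove, Fin.insertNthEquiv, hcons] using h3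
    refine (integral_mono hint3 hint2 fun b => hinner _).trans ?_
    rw [integral_add (hint1 n w) (integrable_const _)]
    simp only [integral_const, probReal_univ, smul_eq_mul, one_mul]
    push_cast
    linarith

end Concentration

/-! ### The noise of one step -/

section Noise

variable {H : Type*} [NormedAddCommGroup H] [InnerProductSpace ℝ H]

/-- The largest contribution of a gradient error `e` to the estimate of one step from `v`, when the
next iterate ranges over `S`. -/
def noiseValue (S : Set H) (xst : H) (q : ℝ) (v e : H) : ℝ :=
  ⨆ x : S, (⟪e, xst - x⟫_ℝ - q / 2 * ‖(x : H) - v‖ ^ 2)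

variable {S : Set H} {xst : H} {q R : ℝ}

theorem noiseValue_term_le (hR : ∀ x ∈ S, ‖xst - x‖ ≤ R) (hq : 0 ≤ q) (v e : H) (x : S) :
    ⟪e, xst - x⟫_ℝ - q / 2 * ‖(x : H) - v‖ ^ 2 ≤ R * ‖e‖ := by
  have h1 := real_inner_le_norm e (xst - x)
  have h2 := mul_le_mul_of_nonneg_left (hR x x.2) (norm_nonneg e)
  have h3 : 0 ≤ q / 2 * ‖(x : H) - v‖ ^ 2 := by positivity
  linarith

theorem bddAbove_noiseValue (hR : ∀ x ∈ S, ‖xst - x‖ ≤ R) (hq : 0 ≤ q) (v e : H) :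
    BddAbove (range fun x : S => ⟪e, xst - x⟫_ℝ - q / 2 * ‖(x : H) - v‖ ^ 2) :=
  ⟨R * ‖e‖, by rintro _ ⟨x, rfl⟩; exact noiseValue_term_le hR hq v e x⟩

theorem le_noiseValue (hR : ∀ x ∈ S, ‖xst - x‖ ≤ R) (hq : 0 ≤ q) (v e : H) {x : H} (hx : x ∈ S) :
    ⟪e, xst - x⟫_ℝ - q / 2 * ‖x - v‖ ^ 2 ≤ noiseValue S xst q v e :=
  le_ciSup (bddAbove_noiseValue hR hq v e) ⟨x, hx⟩

theorem noiseValue_le (hne : S.Nonempty) (hR : ∀ x ∈ S, ‖xst - x‖ ≤ R) (hq : 0 ≤ q) (v e : H) :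
    noiseValue S xst q v e ≤ R * ‖e‖ :=
  have : Nonempty S := hne.to_subtype
  ciSup_le fun x => noiseValue_term_le hR hq v e x

/-- Each function in the supremum is affine in `e` with slope of norm at most `R`. This is the
Lipschitz property needed for bounded differences. -/
theorem abs_noiseValue_sub_le (hne : S.Nonempty) (hR : ∀ x ∈ S, ‖xst - x‖ ≤ R) (hq : 0 ≤ q)
    (v e e' : H) : |noiseValue S xst q v e - noiseValue S xst q v e'| ≤ R * ‖e - e'‖ := by
  have : Nonempty S := hne.to_subtype
  have key : ∀ e e' : H, noiseValue S xst q v e ≤ noiseValue S xst q v e' + R * ‖e - e'‖ := by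
    intro e e'
    refine ciSup_le fun x => ?_
    have h1 := le_noiseValue hR hq v e' x.2
    have h2 := real_inner_le_norm (e - e') (xst - x)
    have h3 := mul_le_mul_of_nonneg_left (hR x x.2) (norm_nonneg (e - e'))
    rw [inner_sub_left] at h2
    linarith
  rw [abs_sub_le_iff]
  constructor
  · linarith [key e e']
  · have := key e' e
    rw [norm_sub_rev] at this
    linarith

/-- Young's inequality: the kept term `q/2‖x - v‖²` absorbs the dependence on the maximizer, leaving
a term linear in `e`, of mean zero for fixed `v`, and a second moment. Without it the mean would be
of the order of `‖e‖` and not `‖e‖²`. -/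
theorem noiseValue_le_inner_add (hne : S.Nonempty) (hq : 0 < q) (v e : H) :
    noiseValue S xst q v e ≤ ⟪e, xst - v⟫_ℝ + 1 / (2 * q) * ‖e‖ ^ 2 := by
  have : Nonempty S := hne.to_subtype
  refine ciSup_le fun x => ?_
  have h1 : (0 : ℝ) ≤ ‖e + q • ((x : H) - v)‖ ^ 2 := sq_nonneg _
  rw [norm_add_sq_real, real_inner_smul_right, norm_smul, mul_pow, Real.norm_eq_abs, sq_abs] at h1
  have h2 : ⟪e, xst - x⟫_ℝ = ⟪e, xst - v⟫_ℝ - ⟪e, (x : H) - v⟫_ℝ := by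
    rw [← inner_sub_right]; congr 1; abel
  have h3 : 0 ≤ 1 / (2 * q) * (‖e‖ ^ 2 + 2 * (q * ⟪e, (x : H) - v⟫_ℝ)
      + q ^ 2 * ‖(x : H) - v‖ ^ 2) := by positivity
  have h4 : 1 / (2 * q) * (‖e‖ ^ 2 + 2 * (q * ⟪e, (x : H) - v⟫_ℝ) + q ^ 2 * ‖(x : H) - v‖ ^ 2)
      = 1 / (2 * q) * ‖e‖ ^ 2 + ⟪e, (x : H) - v⟫_ℝ + q / 2 * ‖(x : H) - v‖ ^ 2 := by
    field_simp
  linarith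

/-- A supremum of continuous functions is lower semicontinuous, which settles measurability although
the index set may be uncountable. -/
theorem measurable_noiseValue [MeasurableSpace H] [BorelSpace H] [SecondCountableTopology H]
    (hR : ∀ x ∈ S, ‖xst - x‖ ≤ R) (hq : 0 ≤ q) :
    Measurable fun p : H × H => noiseValue S xst q p.1 p.2 := by
  refine LowerSemicontinuous.measurable ?_
  refine lowerSemicontinuous_ciSup (fun p => bddAbove_noiseValue hR hq p.1 p.2) fun x => ?_
  exact Continuous.lowerSemicontinuous (by fun_prop)

attribute [irreducible] noiseValue

end Noise

/-! ### The accumulated noise -/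

section Accumulated

variable {H : Type*} [NormedAddCommGroup H] [InnerProductSpace ℝ H] [CompleteSpace H]
  [MeasurableSpace H] [BorelSpace H] [SecondCountableTopology H]
  {Ω Ξ : Type*} [MeasurableSpace Ξ]
  {m : ℕ → ℕ} {X : (k : ℕ) → Fin (m k) → Ω → Ξ}

/-- The `σ`-algebra generated by the samples drawn before iteration `k`. -/
abbrev pastSigma (X : (k : ℕ) → Fin (m k) → Ω → Ξ) (k : ℕ) : MeasurableSpace Ω :=
  ⨆ p ∈ {p : (k : ℕ) × Fin (m k) | p.1 < k}, MeasurableSpace.comap (X p.1 p.2) inferInstance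

theorem pastSigma_mono {j k : ℕ} (h : j ≤ k) : pastSigma X j ≤ pastSigma X k :=
  biSup_mono fun _ hp => lt_of_lt_of_le hp h

theorem measurable_sample_pastSigma (k : ℕ) (i : Fin (m k)) :
    Measurable[pastSigma X (k + 1)] (X k i) := by
  rw [measurable_iff_comap_le]
  exact le_iSup₂_of_le (f := fun (p : (k : ℕ) × Fin (m k))
    (_ : p ∈ {p : (k : ℕ) × Fin (m k) | p.1 < k + 1}) =>
      MeasurableSpace.comap (X p.1 p.2) inferInstance) ⟨k, i⟩ (Nat.lt_succ_self k) le_rfl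

/-- The mean of a random gradient. -/
def meanGradient (ν : Measure Ξ) (J : H → Ξ → H) (v : H) : H := ∫ t, J v t ∂ν

/-- The deviation of the batch average from the mean. -/
def batchError (ν : Measure Ξ) (J : H → Ξ → H) {n : ℕ} (v : H) (b : Fin n → Ξ) : H :=
  ∑ i, (1 / (n : ℝ)) • (J v (b i) - meanGradient ν J v)

variable {ν : Measure Ξ} [IsProbabilityMeasure ν] {J : H → Ξ → H}

theorem measurable_meanGradient (hJ : Measurable (Function.uncurry J)) :
    Measurable (meanGradient ν J) :=
  (hJ.stronglyMeasurable.integral_prod_right (ν := ν)).measurable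

theorem measurable_batchError (hJ : Measurable (Function.uncurry J)) (n : ℕ) :
    Measurable fun p : H × (Fin n → Ξ) => batchError ν J p.1 p.2 := by
  have h1 := measurable_meanGradient (ν := ν) hJ
  unfold batchError
  refine Finset.measurable_fun_sum _ fun i _ => ?_
  have h2 : Measurable fun p : H × (Fin n → Ξ) => J p.1 (p.2 i) :=
    hJ.comp (measurable_fst.prodMk ((measurable_pi_apply i).comp measurable_snd))
  exact (h2.sub (h1.comp measurable_fst)).const_smul _

variable {B N R : ℝ} {S : Set H} {xst : H}

theorem norm_meanGradient_le {v : H} (hB : ∀ t, ‖J v t‖ ≤ B) : ‖meanGradient ν J v‖ ≤ B := by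
  simpa [meanGradient] using norm_integral_le_of_norm_le_const (μ := ν) (Filter.Eventually.of_forall hB)

theorem norm_batchError_le {v : H} (hB : ∀ t, ‖J v t‖ ≤ B) {n : ℕ} (hn : 0 < n) (b : Fin n → Ξ) :
    ‖batchError ν J v b‖ ≤ 2 * B := by
  have hn' : (0 : ℝ) < n := by exact_mod_cast hn
  refine (norm_sum_le _ _).trans ((Finset.sum_le_sum (g := fun _ => 1 / (n : ℝ) * (2 * B))
    fun i _ => ?_).trans_eq ?_)
  · rw [norm_smul, Real.norm_of_nonneg (by positivity)]
    refine mul_le_mul_of_nonneg_left ?_ (by positivity)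
    refine (norm_sub_le _ _).trans ?_
    linarith [hB (b i), norm_meanGradient_le (ν := ν) hB]
  · simp; field_simp

theorem batchError_def {n : ℕ} (v : H) (b : Fin n → Ξ) :
    batchError ν J v b = ∑ i, (1 / (n : ℝ)) • (J v (b i) - meanGradient ν J v) := rfl

theorem batchError_eq {n : ℕ} (hn : 0 < n) (v : H) (b : Fin n → Ξ) :
    batchError ν J v b = (1 / (n : ℝ)) • ∑ i, J v (b i) - meanGradient ν J v := by
  have hn' : (n : ℝ) ≠ 0 := by exact_mod_cast hn.ne'
  rw [batchError, ← Finset.smul_sum, Finset.sum_sub_distrib, smul_sub]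
  congr 1
  simp only [Finset.sum_const, Finset.card_univ, Fintype.card_fin, ← Nat.cast_smul_eq_nsmul ℝ,
    smul_smul]
  rw [one_div_mul_cancel hn', one_smul]

theorem integral_sub_meanGradient {v : H} (hJ : Integrable (J v) ν) :
    ∫ t, (J v t - meanGradient ν J v) ∂ν = 0 := by
  rw [integral_sub hJ (integrable_const _)]
  simp [meanGradient]

attribute [irreducible] batchError meanGradient

/-- The exponential moments of the noise of one step. -/
theorem lintegral_exp_noiseValue_le (hJ : Measurable (Function.uncurry J)) {v : H}
    (hB : ∀ t, ‖J v t‖ ≤ B) (hne : S.Nonempty) (hR : ∀ x ∈ S, ‖xst - x‖ ≤ R) {q : ℝ} (hq : 0 < q)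
    {n : ℕ} (hn : 0 < n) {s : ℝ} (hs : 0 ≤ s) :
    ∫⁻ b, ENNReal.ofReal (Real.exp (s * noiseValue S xst q v (batchError ν J v b)))
      ∂(Measure.pi fun _ : Fin n => ν) ≤
    ENNReal.ofReal (Real.exp (s * (2 * B ^ 2 / (q * n)) + s ^ 2 * (B ^ 2 * R ^ 2 / n) / 2)) := by
  have hn' : (0 : ℝ) < n := by exact_mod_cast hn
  have hJv : Measurable (J v) := hJ.comp (measurable_const.prodMk measurable_id)
  set Y : Ξ → H := fun t => (1 / (n : ℝ)) • (J v t - meanGradient ν J v) with hYdef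
  have hY : Measurable Y := (hJv.sub_const _).const_smul _
  have hR0 : 0 ≤ R := by
    obtain ⟨x, hx⟩ := hne
    exact (norm_nonneg _).trans (hR x hx)
  -- Changing one sample moves the batch error by at most `2B/n`, so the noise value moves by
  -- `2BR/n`; summing `n` terms `(2BR/n)²/8` gives the variance proxy `B²R²/n`, up to the factor
  -- `s²/2`.
  have hosc : ∀ x y, ‖Y x - Y y‖ ≤ 2 * B / n := by
    intro x y
    simp only [hYdef, ← smul_sub, sub_sub_sub_cancel_right]
    rw [norm_smul, Real.norm_of_nonneg (by positivity), one_div, inv_mul_eq_div]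
    refine div_le_div_of_nonneg_right ?_ hn'.le
    linarith [norm_sub_le (J v x) (J v y), hB x, hB y]
  have hC : ∀ x, ‖Y x‖ ≤ 2 * B / n := by
    intro x
    simp only [hYdef]
    rw [norm_smul, Real.norm_of_nonneg (by positivity), one_div, inv_mul_eq_div]
    refine div_le_div_of_nonneg_right ?_ hn'.le
    linarith [norm_sub_le (J v x) (meanGradient ν J v), hB x, norm_meanGradient_le (ν := ν) hB]
  have hJint : Integrable (J v) ν :=
    Integrable.of_bound hJv.aestronglyMeasurable B (Filter.Eventually.of_forall hB)
  have h0 : ∫ x, Y x ∂ν = 0 := by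
    simp only [hYdef]
    rw [integral_smul, integral_sub_meanGradient hJint, smul_zero]
  have hL := fun x y => abs_noiseValue_sub_le (S := S) (xst := xst) hne hR hq.le v x y
  have hcont := continuous_of_lipschitz hR0 hL
  have hbb := bounded_on_balls_of_lipschitz hL
  have hexp := integral_exp_lipschitz_sum_le (ν := ν) hY hC hosc hR0 s n hL 0
  -- With `c = 1/(2q)` and each centered summand bounded by `2B/n`, the mean is at most `n ·
  -- (2B/n)²/(2q) = 2B²/(qn)`.
  have hmean := integral_inner_add_norm_sq_sum_le (ν := ν) hY hC h0
    (c := 1 / (2 * q)) (by positivity) (xst - v) n 0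
  simp only [zero_add] at hexp hmean
  have hint := integrable_comp_sum (ν := ν) hY hC hcont hbb n 0
  have hint2 := integrable_comp_sum (ν := ν) hY hC
    (ψ := fun x => ⟪x, xst - v⟫_ℝ + 1 / (2 * q) * ‖x‖ ^ 2) (by fun_prop) (fun r => by
      refine ⟨r * ‖xst - v‖ + 1 / (2 * q) * r ^ 2, fun x hx => ?_⟩
      have h1 := abs_real_inner_le_norm x (xst - v)
      have h2 := mul_le_mul_of_nonneg_right hx (norm_nonneg (xst - v))
      have h3 : 1 / (2 * q) * ‖x‖ ^ 2 ≤ 1 / (2 * q) * r ^ 2 := by gcongr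
      have h4 : |1 / (2 * q) * ‖x‖ ^ 2| = 1 / (2 * q) * ‖x‖ ^ 2 := abs_of_nonneg (by positivity)
      have h5 := abs_add_le (⟪x, xst - v⟫_ℝ) (1 / (2 * q) * ‖x‖ ^ 2)
      linarith) n 0
  have hinte := integrable_comp_sum (ν := ν) hY hC
    (ψ := fun x => Real.exp (s * noiseValue S xst q v x)) (by fun_prop) (fun r => by
      obtain ⟨M, hM⟩ := hbb r
      refine ⟨Real.exp (s * M), fun x hx => ?_⟩
      rw [Real.abs_exp]
      exact Real.exp_le_exp.2 (mul_le_mul_of_nonneg_left ((le_abs_self _).trans (hM x hx)) hs)) n 0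
  simp only [zero_add] at hint hint2 hinte
  have hle := (integral_mono hint hint2 fun b =>
    noiseValue_le_inner_add (S := S) (xst := xst) hne hq v (∑ i, Y (b i))).trans hmean
  simp only [batchError_def]
  rw [← ofReal_integral_eq_lintegral_ofReal hinte
    (Filter.Eventually.of_forall fun b => Real.exp_nonneg _)]
  refine ENNReal.ofReal_le_ofReal (hexp.trans (Real.exp_le_exp.2 ?_))
  refine add_le_add (mul_le_mul_of_nonneg_left (hle.trans_eq ?_) hs) (le_of_eq ?_)
  · simp
    field_simp
  · field_simp
    ring

/-- The noise accumulated along the iterates `v`. -/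
def noiseSum (ν : Measure Ξ) (J : H → Ξ → H) (S : Set H) (xst : H) (tau q : ℕ → ℝ)
    (X : (k : ℕ) → Fin (m k) → Ω → Ξ) (v : ℕ → Ω → H) (K : ℕ) (ω : Ω) : ℝ :=
  ∑ k ∈ Finset.range K,
    tau k * noiseValue S xst (q k) (v k ω) (batchError ν J (v k ω) fun i => X k i ω)

variable {tau q : ℕ → ℝ} {v : ℕ → Ω → H}

theorem measurable_noiseValue_batch (hJ : Measurable (Function.uncurry J))
    (hR : ∀ x ∈ S, ‖xst - x‖ ≤ R) {q : ℝ} (hq : 0 ≤ q) (n : ℕ) :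
    Measurable fun p : H × (Fin n → Ξ) => noiseValue S xst q p.1 (batchError ν J p.1 p.2) :=
  Measurable.comp (g := fun p : H × H => noiseValue S xst q p.1 p.2)
    (f := fun p : H × (Fin n → Ξ) => (p.1, batchError ν J p.1 p.2))
    (measurable_noiseValue hR hq) (measurable_fst.prodMk (measurable_batchError hJ n))

theorem measurable_noiseSum (hJ : Measurable (Function.uncurry J)) (hR : ∀ x ∈ S, ‖xst - x‖ ≤ R)
    (hq : ∀ k, 0 < q k) {K : ℕ} [mΩ' : MeasurableSpace Ω] (hv : ∀ k < K, Measurable (v k))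
    (hX : ∀ k < K, ∀ i, Measurable (X k i)) :
    Measurable (noiseSum ν J S xst tau q X v K) := by
  refine Finset.measurable_fun_sum _ fun k hk => ?_
  have hkK : k < K := Finset.mem_range.1 hk
  refine Measurable.const_mul ?_ _
  exact Measurable.comp
    (g := fun p : H × (Fin (m k) → Ξ) => noiseValue S xst (q k) p.1 (batchError ν J p.1 p.2))
    (f := fun ω => (v k ω, fun i => X k i ω))
    (measurable_noiseValue_batch hJ hR (hq k).le (m k))
    ((hv k hkK).prodMk (measurable_pi_iff.2 fun i => hX k hkK i))

theorem measurable_noiseSum_pastSigma (hJ : Measurable (Function.uncurry J))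
    (hR : ∀ x ∈ S, ‖xst - x‖ ≤ R) (hq : ∀ k, 0 < q k)
    (hv : ∀ k, Measurable[pastSigma X k] (v k)) (K : ℕ) :
    Measurable[pastSigma X K] (noiseSum ν J S xst tau q X v K) :=
  measurable_noiseSum (mΩ' := pastSigma X K) hJ hR hq
    (fun k hk => (hv k).mono (pastSigma_mono hk.le) le_rfl)
    (fun k hk i => (measurable_sample_pastSigma k i).mono (pastSigma_mono hk) le_rfl)

variable [mΩ : MeasurableSpace Ω] {P : Measure Ω} [IsProbabilityMeasure P]

theorem pastSigma_le (hX : ∀ k i, Measurable (X k i)) (k : ℕ) : pastSigma X k ≤ mΩ :=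
  iSup₂_le fun p _ => (hX p.1 p.2).comap_le

/-- The past and the batch are generated by samples with disjoint index sets. -/
theorem indepFun_past_batch (hX : ∀ k i, Measurable (X k i))
    (hind : iIndepFun (fun p : (k : ℕ) × Fin (m k) => X p.1 p.2) P) {E : Type*} [MeasurableSpace E]
    {k : ℕ} {Y : Ω → E} (hY : Measurable[pastSigma X k] Y) :
    IndepFun Y (fun ω i => X k i ω) P := by
  have h1 : Indep (pastSigma X k) (⨆ p ∈ {p : (k : ℕ) × Fin (m k) | p.1 = k},
      MeasurableSpace.comap (X p.1 p.2) inferInstance) P := by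
    refine indep_iSup_of_disjoint
      (m := fun p : (k : ℕ) × Fin (m k) => MeasurableSpace.comap (X p.1 p.2) inferInstance)
      (fun p => (hX p.1 p.2).comap_le) hind ?_
    rw [Set.disjoint_left]
    intro p hp hp'
    exact absurd hp' (ne_of_lt hp)
  refine indep_of_indep_of_le h1 hY.comap_le ?_
  rw [MeasurableSpace.pi, MeasurableSpace.comap_iSup]
  refine iSup_le fun i => ?_
  rw [MeasurableSpace.comap_comp]
  exact le_iSup₂_of_le (f := fun (p : (k : ℕ) × Fin (m k))
    (_ : p ∈ {p : (k : ℕ) × Fin (m k) | p.1 = k}) =>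
      MeasurableSpace.comap (X p.1 p.2) inferInstance) ⟨k, i⟩ rfl le_rfl

theorem map_batch {ν : Measure Ξ} (hX : ∀ k i, Measurable (X k i))
    (hind : iIndepFun (fun p : (k : ℕ) × Fin (m k) => X p.1 p.2) P)
    (hν : ∀ k i, P.map (X k i) = ν) (k : ℕ) :
    P.map (fun ω i => X k i ω) = Measure.pi fun _ : Fin (m k) => ν := by
  have h1 : iIndepFun (fun i => X k i) P :=
    hind.precomp (g := fun i : Fin (m k) => (⟨k, i⟩ : (k : ℕ) × Fin (m k)))
      (fun i j h => by simpa using h)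
  rw [(iIndepFun_iff_map_fun_eq_pi_map fun i => (hX k i).aemeasurable).1 h1]
  simp only [hν]

/-- The iterated conditioning argument for exponential moments of a sum: each factor is bounded
uniformly in the past, so the bounds multiply. -/
theorem lintegral_exp_noiseSum_le (hX : ∀ k i, Measurable (X k i))
    (hind : iIndepFun (fun p : (k : ℕ) × Fin (m k) => X p.1 p.2) P)
    (hν : ∀ k i, P.map (X k i) = ν) (hm : ∀ k, 0 < m k)
    (hJ : Measurable (Function.uncurry J)) (hB : ∀ v, ‖v‖ ≤ N → ∀ t, ‖J v t‖ ≤ B)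
    (hne : S.Nonempty) (hR : ∀ x ∈ S, ‖xst - x‖ ≤ R) (hq : ∀ k, 0 < q k) (htau : ∀ k, 0 ≤ tau k)
    (hv : ∀ k, Measurable[pastSigma X k] (v k)) (hvN : ∀ k ω, ‖v k ω‖ ≤ N) {s : ℝ} (hs : 0 ≤ s)
    (K : ℕ) :
    ∫⁻ ω, ENNReal.ofReal (Real.exp (s * noiseSum ν J S xst tau q X v K ω)) ∂P ≤
    ENNReal.ofReal (Real.exp (s * (∑ k ∈ Finset.range K, tau k * (2 * B ^ 2 / (q k * m k)))
      + s ^ 2 * (∑ k ∈ Finset.range K, tau k ^ 2 * (B ^ 2 * R ^ 2 / m k)) / 2)) := by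
  induction K with
  | zero => simp [noiseSum]
  | succ k ih =>
    -- All that matters of the past is the current iterate and the noise so far. Their joint law
    -- with the new batch is a product, and integrating over the batch first reduces to the one-step
    -- bound with parameter `s * tau k`.
    set A : Ω → H × ℝ := fun ω => (v k ω, noiseSum ν J S xst tau q X v k ω) with hA
    have hAm' : Measurable[pastSigma X k] A := (hv k).prodMk (measurable_noiseSum_pastSigma hJ hR hq hv k)
    have hAm : Measurable A := hAm'.mono (pastSigma_le hX k) le_rfl
    have hbm : Measurable fun ω i => X k i ω := measurable_pi_iff.2 fun i => hX k i
    have hmap := (indepFun_iff_map_prod_eq_prod_map_map hAm.aemeasurable hbm.aemeasurable).1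
      (indepFun_past_batch hX hind hAm')
    rw [map_batch hX hind hν] at hmap
    set φ : (H × ℝ) × (Fin (m k) → Ξ) → ENNReal := fun p =>
      ENNReal.ofReal (Real.exp (s * p.1.2)) * ENNReal.ofReal (Real.exp ((s * tau k) *
        noiseValue S xst (q k) p.1.1 (batchError ν J p.1.1 p.2))) with hφ
    have hnm : Measurable fun p : (H × ℝ) × (Fin (m k) → Ξ) =>
        noiseValue S xst (q k) p.1.1 (batchError ν J p.1.1 p.2) :=
      Measurable.comp
        (g := fun p : H × (Fin (m k) → Ξ) => noiseValue S xst (q k) p.1 (batchError ν J p.1 p.2))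
        (f := fun p : (H × ℝ) × (Fin (m k) → Ξ) => (p.1.1, p.2))
        (measurable_noiseValue_batch hJ hR (hq k).le (m k))
        ((measurable_fst.comp measurable_fst).prodMk measurable_snd)
    have hφm : Measurable φ := by
      have h1 : Measurable fun p : (H × ℝ) × (Fin (m k) → Ξ) =>
          ENNReal.ofReal (Real.exp (s * p.1.2)) := by fun_prop
      exact h1.mul (Real.measurable_exp.comp (hnm.const_mul _)).ennreal_ofReal
    have heq : ∀ ω, ENNReal.ofReal (Real.exp (s * noiseSum ν J S xst tau q X v (k + 1) ω))
        = φ (A ω, fun i => X k i ω) := by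
      intro ω
      simp only [hφ, hA, noiseSum, Finset.sum_range_succ]
      rw [← ENNReal.ofReal_mul (Real.exp_nonneg _), ← Real.exp_add]
      ring_nf
    simp only [heq]
    rw [← lintegral_map (g := fun ω => (A ω, fun i => X k i ω)) hφm (hAm.prodMk hbm), hmap,
      lintegral_prod _ hφm.aemeasurable]
    set c : ENNReal := ENNReal.ofReal (Real.exp ((s * tau k) * (2 * B ^ 2 / (q k * m k))
      + (s * tau k) ^ 2 * (B ^ 2 * R ^ 2 / m k) / 2)) with hc
    have hae : ∀ᵐ x ∂(P.map A), ‖x.1‖ ≤ N := by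
      rw [ae_map_iff hAm.aemeasurable (measurableSet_le (by fun_prop) (by fun_prop))]
      exact Filter.Eventually.of_forall fun ω => hvN k ω
    have hle : ∫⁻ x, ∫⁻ b, φ (x, b) ∂(Measure.pi fun _ => ν) ∂(P.map A)
        ≤ ∫⁻ x, ENNReal.ofReal (Real.exp (s * x.2)) * c ∂(P.map A) := by
      refine lintegral_mono_ae ?_
      filter_upwards [hae] with x hx
      simp only [hφ]
      rw [lintegral_const_mul' _ _ ENNReal.ofReal_ne_top]
      gcongr
      exact lintegral_exp_noiseValue_le hJ (hB _ hx) hne hR (hq k) (hm k)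
        (mul_nonneg hs (htau k))
    refine hle.trans ?_
    rw [lintegral_mul_const _ (by fun_prop), lintegral_map (by fun_prop) hAm]
    refine (mul_le_mul' ih le_rfl).trans_eq ?_
    rw [hc, ← ENNReal.ofReal_mul (Real.exp_nonneg _), ← Real.exp_add, Finset.sum_range_succ,
      Finset.sum_range_succ]
    congr 2
    ring

/-- The tail of the accumulated noise. -/
theorem measureReal_noiseSum_ge_le (hX : ∀ k i, Measurable (X k i))
    (hind : iIndepFun (fun p : (k : ℕ) × Fin (m k) => X p.1 p.2) P)
    (hν : ∀ k i, P.map (X k i) = ν) (hm : ∀ k, 0 < m k)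
    (hJ : Measurable (Function.uncurry J)) (hB : ∀ v, ‖v‖ ≤ N → ∀ t, ‖J v t‖ ≤ B)
    (hne : S.Nonempty) (hR : ∀ x ∈ S, ‖xst - x‖ ≤ R) (hq : ∀ k, 0 < q k) (htau : ∀ k, 0 ≤ tau k)
    (hv : ∀ k, Measurable[pastSigma X k] (v k)) (hvN : ∀ k ω, ‖v k ω‖ ≤ N) (K : ℕ) {E V t : ℝ}
    (hE : ∑ k ∈ Finset.range K, tau k * (2 * B ^ 2 / (q k * m k)) ≤ E)
    (hV : ∑ k ∈ Finset.range K, tau k ^ 2 * (B ^ 2 * R ^ 2 / m k) ≤ V) (hV0 : 0 < V) (ht : 0 ≤ t) :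
    P.real {ω | E + t ≤ noiseSum ν J S xst tau q X v K ω} ≤ Real.exp (-(t ^ 2 / (2 * V))) := by
  -- The minimizer of the Chernoff exponent `-s t + s² V / 2`.
  set s : ℝ := t / V with hsdef
  have hs : 0 ≤ s := div_nonneg ht hV0.le
  have h1 := lintegral_exp_noiseSum_le hX hind hν hm hJ hB hne hR hq htau hv hvN hs K
  have hmeas : Measurable (noiseSum ν J S xst tau q X v K) :=
    (measurable_noiseSum_pastSigma hJ hR hq hv K).mono (pastSigma_le hX K) le_rfl
  have h2 := meas_ge_le_lintegral_div (μ := P)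
    (f := fun ω => ENNReal.ofReal (Real.exp (s * noiseSum ν J S xst tau q X v K ω)))
    (by fun_prop) (ε := ENNReal.ofReal (Real.exp (s * (E + t))))
    (by simp [Real.exp_pos]) ENNReal.ofReal_ne_top
  have hsub : {ω | E + t ≤ noiseSum ν J S xst tau q X v K ω} ⊆
      {ω | ENNReal.ofReal (Real.exp (s * (E + t)))
        ≤ ENNReal.ofReal (Real.exp (s * noiseSum ν J S xst tau q X v K ω))} := fun ω hω =>
    ENNReal.ofReal_le_ofReal (Real.exp_le_exp.2 (mul_le_mul_of_nonneg_left hω hs))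
  have h3 := (measure_mono hsub).trans (h2.trans (ENNReal.div_le_div_right h1 _))
  rw [← ENNReal.ofReal_div_of_pos (Real.exp_pos _), ← Real.exp_sub] at h3
  rw [Measure.real]
  refine (ENNReal.toReal_mono ENNReal.ofReal_ne_top h3).trans ?_
  rw [ENNReal.toReal_ofReal (Real.exp_nonneg _)]
  apply Real.exp_le_exp.2
  have h4 := mul_le_mul_of_nonneg_left hE hs
  have h5 := mul_le_mul_of_nonneg_left hV (sq_nonneg s)
  have h6 : s * t - s ^ 2 * V / 2 = t ^ 2 / (2 * V) := by
    rw [hsdef]; field_simp; ring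
  linarith

end Accumulated

/-! ### Random quadratic tracking functionals -/

section Tracking

variable {H : Type*} [NormedAddCommGroup H] [InnerProductSpace ℝ H] [CompleteSpace H] {Ξ : Type*}

/-- The functional `½ ‖S u - y_d‖² + (α/2) ‖u‖²` with a random operator `S`. -/
def trackingCost (S : Ξ → H →L[ℝ] H) (yd : H) (α : ℝ) (u : H) (t : Ξ) : ℝ :=
  1 / 2 * ‖S t u - yd‖ ^ 2 + α / 2 * ‖u‖ ^ 2

/-- The gradient of the tracking term for a symmetric operator. -/
def trackingGradient (S : Ξ → H →L[ℝ] H) (yd : H) (u : H) (t : Ξ) : H := S t (S t u - yd)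

variable {S : Ξ → H →L[ℝ] H} {yd : H} {α C : ℝ}

/-- The functional is quadratic, so the expansion is exact. Bounding `‖S t (y - x)‖²` by `C²‖y -
x‖²` from above and by `0` from below yields the smoothness and the strong convexity of the
expectation. -/
theorem trackingCost_expansion (hS : ∀ t x y, ⟪S t x, y⟫_ℝ = ⟪x, S t y⟫_ℝ) (x y : H) (t : Ξ) :
    trackingCost S yd α y t = trackingCost S yd α x t
      + ⟪trackingGradient S yd x t + α • x, y - x⟫_ℝ
      + 1 / 2 * ‖S t (y - x)‖ ^ 2 + α / 2 * ‖y - x‖ ^ 2 := by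
  have h1 : S t y - yd = (S t x - yd) + S t (y - x) := by rw [map_sub]; abel
  have h2 : ‖y‖ ^ 2 = ‖x‖ ^ 2 + 2 * ⟪x, y - x⟫_ℝ + ‖y - x‖ ^ 2 := by
    rw [← norm_add_sq_real, add_sub_cancel]
  rw [trackingCost, trackingCost, trackingGradient, h1, norm_add_sq_real, inner_add_left, hS,
    real_inner_smul_left, h2]
  ring

theorem gradient_trackingCost (hS : ∀ t x y, ⟪S t x, y⟫_ℝ = ⟪x, S t y⟫_ℝ) (u : H) (t : Ξ) :
    gradient (fun w => trackingCost S yd α w t) u = trackingGradient S yd u t + α • u := by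
  apply HasGradientAt.gradient
  rw [hasGradientAt_iff_hasFDerivAt]
  have h1 : HasFDerivAt (fun w => S t w - yd) (S t) u := (S t).hasFDerivAt.sub_const yd
  have h2 := (h1.norm_sq.const_mul (1 / 2)).add ((hasFDerivAt_id u).norm_sq.const_mul (α / 2))
  refine h2.congr_fderiv ?_
  ext y
  simp [trackingGradient, hS]
  ring

theorem norm_trackingGradient_le (hC : ∀ t x, ‖S t x‖ ≤ C * ‖x‖) (hC0 : 0 ≤ C) {N : ℝ} {v : H}
    (hv : ‖v‖ ≤ N) (t : Ξ) : ‖trackingGradient S yd v t‖ ≤ C ^ 2 * N + C * ‖yd‖ := by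
  have h1 := hC t (S t v - yd)
  have h2 : ‖S t v - yd‖ ≤ C * N + ‖yd‖ :=
    (norm_sub_le _ _).trans (add_le_add_left ((hC t v).trans (mul_le_mul_of_nonneg_left hv hC0)) _)
  have h3 := mul_le_mul_of_nonneg_left h2 hC0
  rw [trackingGradient]
  linarith

variable [MeasurableSpace Ξ] [MeasurableSpace H] [BorelSpace H] [SecondCountableTopology H]

theorem measurable_trackingGradient (hm : ∀ u, Measurable fun t => S t u) :
    Measurable (Function.uncurry (trackingGradient S yd)) := by
  have h1 : Measurable (Function.uncurry fun (u : H) (t : Ξ) => S t u) :=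
    measurable_uncurry_of_continuous_of_measurable (fun t => (S t).continuous) hm
  have h2 : Measurable fun p : H × Ξ => (S p.2 p.1 - yd, p.2) :=
    (h1.sub_const yd).prodMk measurable_snd
  exact h1.comp h2

variable {ν : Measure Ξ} [IsProbabilityMeasure ν]

theorem integrable_trackingCost (hC : ∀ t x, ‖S t x‖ ≤ C * ‖x‖)
    (hm : ∀ u, Measurable fun t => S t u) (u : H) :
    Integrable (fun t => trackingCost S yd α u t) ν := by
  refine Integrable.of_bound (C := 1 / 2 * (C * ‖u‖ + ‖yd‖) ^ 2 + |α / 2 * ‖u‖ ^ 2|) ?_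
    (Filter.Eventually.of_forall fun t => ?_)
  · have := hm u
    unfold trackingCost
    exact Measurable.aestronglyMeasurable (by fun_prop)
  · have h1 : ‖S t u - yd‖ ≤ C * ‖u‖ + ‖yd‖ :=
      (norm_sub_le _ _).trans (add_le_add_left (hC t u) _)
    have h2 : 1 / 2 * ‖S t u - yd‖ ^ 2 ≤ 1 / 2 * (C * ‖u‖ + ‖yd‖) ^ 2 := by gcongr
    refine (abs_add_le _ _).trans ?_
    rw [abs_of_nonneg (by positivity : (0 : ℝ) ≤ 1 / 2 * ‖S t u - yd‖ ^ 2)]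
    linarith

theorem integrable_trackingGradient (hC : ∀ t x, ‖S t x‖ ≤ C * ‖x‖) (hC0 : 0 ≤ C)
    (hm : ∀ u, Measurable fun t => S t u) (u : H) :
    Integrable (fun t => trackingGradient S yd u t) ν :=
  Integrable.of_bound
    ((measurable_trackingGradient hm).comp
      (measurable_const.prodMk measurable_id)).aestronglyMeasurable
    _ (Filter.Eventually.of_forall fun t => norm_trackingGradient_le hC hC0 le_rfl t)

/-- The gradient of the expected cost. -/
def expectedGradient (ν : Measure Ξ) (S : Ξ → H →L[ℝ] H) (yd : H) (α : ℝ) (u : H) : H :=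
  meanGradient ν (trackingGradient S yd) u + α • u

theorem inner_expectedGradient (hC : ∀ t x, ‖S t x‖ ≤ C * ‖x‖) (hC0 : 0 ≤ C)
    (hm : ∀ u, Measurable fun t => S t u) (u y : H) :
    ⟪expectedGradient ν S yd α u, y⟫_ℝ
      = ∫ t, ⟪trackingGradient S yd u t + α • u, y⟫_ℝ ∂ν := by
  have hi := integrable_trackingGradient (yd := yd) (ν := ν) hC hC0 hm u
  have h0 := integral_sub_meanGradient (ν := ν) (J := trackingGradient S yd) (v := u) hi
  rw [integral_sub hi (integrable_const _)] at h0
  simp only [integral_const, probReal_univ, one_smul] at h0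
  have h1 : ∀ t, ⟪trackingGradient S yd u t + α • u, y⟫_ℝ
      = ⟪y, trackingGradient S yd u t + α • u⟫_ℝ := fun t => real_inner_comm _ _
  simp only [h1]
  rw [integral_inner (f := fun t => trackingGradient S yd u t + α • u)
    (hi.add (integrable_const _)), integral_add hi (integrable_const _), sub_eq_zero.1 h0,
    real_inner_comm]
  simp [expectedGradient]

theorem integrable_inner_trackingGradient (hC : ∀ t x, ‖S t x‖ ≤ C * ‖x‖) (hC0 : 0 ≤ C)
    (hm : ∀ u, Measurable fun t => S t u) (u y : H) :
    Integrable (fun t => ⟪trackingGradient S yd u t + α • u, y⟫_ℝ) ν :=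
  ((integrable_trackingGradient hC hC0 hm u).add (integrable_const (α • u))).inner_const y

theorem expectedCost_le (hS : ∀ t x y, ⟪S t x, y⟫_ℝ = ⟪x, S t y⟫_ℝ)
    (hC : ∀ t x, ‖S t x‖ ≤ C * ‖x‖) (hC0 : 0 ≤ C) (hm : ∀ u, Measurable fun t => S t u) (x y : H) :
    ∫ t, trackingCost S yd α y t ∂ν ≤ ∫ t, trackingCost S yd α x t ∂ν
      + ⟪expectedGradient ν S yd α x, y - x⟫_ℝ + (α + C ^ 2) / 2 * ‖y - x‖ ^ 2 := by
  have i1 := integrable_trackingCost (yd := yd) (α := α) (ν := ν) hC hm x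
  have i2 := integrable_inner_trackingGradient (yd := yd) (α := α) (ν := ν) hC hC0 hm x (y - x)
  have i3 : Integrable (fun t => trackingCost S yd α x t
      + ⟪trackingGradient S yd x t + α • x, y - x⟫_ℝ) ν := i1.add i2
  rw [inner_expectedGradient hC hC0 hm, ← integral_add i1 i2]
  have h2 : ∫ t, (trackingCost S yd α x t + ⟪trackingGradient S yd x t + α • x, y - x⟫_ℝ
      + (α + C ^ 2) / 2 * ‖y - x‖ ^ 2) ∂ν = ∫ t, (trackingCost S yd α x t
      + ⟪trackingGradient S yd x t + α • x, y - x⟫_ℝ) ∂ν + (α + C ^ 2) / 2 * ‖y - x‖ ^ 2 := by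
    rw [integral_add i3 (integrable_const _)]
    simp
  rw [← h2]
  refine integral_mono (integrable_trackingCost hC hm y) (i3.add (integrable_const _))
    fun t => ?_
  have h3 : ‖S t (y - x)‖ ^ 2 ≤ (C * ‖y - x‖) ^ 2 := by gcongr; exact hC t _
  simp only [trackingCost_expansion hS x y t, mul_pow] at h3 ⊢
  linarith

theorem le_expectedCost (hS : ∀ t x y, ⟪S t x, y⟫_ℝ = ⟪x, S t y⟫_ℝ)
    (hC : ∀ t x, ‖S t x‖ ≤ C * ‖x‖) (hC0 : 0 ≤ C) (hm : ∀ u, Measurable fun t => S t u) (x y : H) :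
    ∫ t, trackingCost S yd α x t ∂ν + ⟪expectedGradient ν S yd α x, y - x⟫_ℝ
      + α / 2 * ‖y - x‖ ^ 2 ≤ ∫ t, trackingCost S yd α y t ∂ν := by
  have i1 := integrable_trackingCost (yd := yd) (α := α) (ν := ν) hC hm x
  have i2 := integrable_inner_trackingGradient (yd := yd) (α := α) (ν := ν) hC hC0 hm x (y - x)
  have i3 : Integrable (fun t => trackingCost S yd α x t
      + ⟪trackingGradient S yd x t + α • x, y - x⟫_ℝ) ν := i1.add i2
  rw [inner_expectedGradient hC hC0 hm, ← integral_add i1 i2]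
  have h2 : ∫ t, (trackingCost S yd α x t + ⟪trackingGradient S yd x t + α • x, y - x⟫_ℝ
      + α / 2 * ‖y - x‖ ^ 2) ∂ν = ∫ t, (trackingCost S yd α x t
      + ⟪trackingGradient S yd x t + α • x, y - x⟫_ℝ) ∂ν + α / 2 * ‖y - x‖ ^ 2 := by
    rw [integral_add i3 (integrable_const _)]
    simp
  rw [← h2]
  refine integral_mono (i3.add (integrable_const _)) (integrable_trackingCost hC hm y)
    fun t => ?_
  have h3 : 0 ≤ ‖S t (y - x)‖ ^ 2 := by positivity
  simp only [trackingCost_expansion hS x y t]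
  linarith

/-- The term `α • v` is deterministic and cancels, which is why the noise bound does not contain
`α`. -/
theorem batchGradient_sub_expectedGradient (hS : ∀ t x y, ⟪S t x, y⟫_ℝ = ⟪x, S t y⟫_ℝ) {n : ℕ}
    (hn : 0 < n) (b : Fin n → Ξ) (v : H) :
    batchGradient (trackingCost S yd α) b v - expectedGradient ν S yd α v
      = batchError ν (trackingGradient S yd) v b := by
  have hn' : (n : ℝ) ≠ 0 := by exact_mod_cast hn.ne'
  rw [batchError_eq hn, batchGradient, expectedGradient]
  simp only [gradient_trackingCost hS, Finset.sum_add_distrib, Finset.sum_const, Finset.card_univ,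
    Fintype.card_fin, ← Nat.cast_smul_eq_nsmul ℝ, smul_add, smul_smul]
  rw [← mul_assoc, one_div_mul_cancel hn', one_mul]
  abel

theorem measurable_batchGradient (hS : ∀ t x y, ⟪S t x, y⟫_ℝ = ⟪x, S t y⟫_ℝ)
    (hm : ∀ u, Measurable fun t => S t u) (n : ℕ) :
    Measurable fun p : H × (Fin n → Ξ) => batchGradient (trackingCost S yd α) p.2 p.1 := by
  simp only [batchGradient, gradient_trackingCost hS]
  refine Measurable.const_smul (Finset.measurable_fun_sum _ fun i _ => ?_) _
  have h1 : Measurable fun p : H × (Fin n → Ξ) => trackingGradient S yd p.1 (p.2 i) :=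
    (measurable_trackingGradient hm).comp
      (measurable_fst.prodMk ((measurable_pi_apply i).comp measurable_snd))
  exact h1.add (measurable_fst.const_smul α)

end Tracking

/-- Average the two tangent inequalities taken at the convex combination; the linear terms cancel.
-/
theorem convexOn_of_gradient_inequality {H : Type*} [NormedAddCommGroup H] [InnerProductSpace ℝ H]
    {S : Set H} (hS : Convex ℝ S) {f : H → ℝ} {D : H → H}
    (h : ∀ x ∈ S, ∀ y ∈ S, f x + ⟪D x, y - x⟫_ℝ ≤ f y) : ConvexOn ℝ S f := by
  refine ⟨hS, fun x hx y hy a b ha hb hab => ?_⟩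
  have hz := hS hx hy ha hb hab
  have h1 := mul_le_mul_of_nonneg_left (h _ hz x hx) ha
  have h2 := mul_le_mul_of_nonneg_left (h _ hz y hy) hb
  set z := a • x + b • y with hzdef
  have h3 : a * ⟪D z, x - z⟫_ℝ + b * ⟪D z, y - z⟫_ℝ = 0 := by
    rw [← real_inner_smul_right, ← real_inner_smul_right, ← inner_add_right]
    have : a • (x - z) + b • (y - z) = 0 := by
      rw [smul_sub, smul_sub, sub_add_sub_comm, ← add_smul, hab, one_smul, ← hzdef, sub_self]
    rw [this, inner_zero_right]
  have h4 : a * f z + b * f z = f z := by rw [← add_mul, hab, one_mul]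
  rw [smul_eq_mul, smul_eq_mul]
  linarith

/-! ### Measurability of the iterates and the estimate with noise -/

section RunNoise

variable {H : Type*} [NormedAddCommGroup H] [InnerProductSpace ℝ H] [CompleteSpace H]
  [MeasurableSpace H] [BorelSpace H] [SecondCountableTopology H]
  {Ω Ξ : Type*} [MeasurableSpace Ξ] {F : H → Ξ → ℝ} {g : H → ℝ} {Uad : Set H}
  {m : ℕ → ℕ} {X : (k : ℕ) → Fin (m k) → Ω → Ξ} {μ ρ α L : ℝ} {rho eta θ tau T q : ℕ → ℝ}
  {v₀ s₀ l₀ : H} {u v z s lam psi : ℕ → Ω → H}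

namespace IsADMMRun

/-- Both new iterates are minimizers, so no formula for them is available; they are measurable
because they depend in a Lipschitz way on measurable data. -/
theorem measurable_succ [mΩ' : MeasurableSpace Ω]
    (hr : IsADMMRun F g Uad m X μ rho eta θ v₀ s₀ l₀ u v z s lam psi)
    (hw : StepWeights ρ rho θ tau T) (hρ : 0 < ρ) (heta : ∀ k, 0 < eta k)
    (hU : Convex ℝ Uad) (hg : ConvexOn ℝ univ g)
    (hG : ∀ n, Measurable fun p : H × (Fin n → Ξ) => batchGradient F p.2 p.1) {k : ℕ}
    (hv : Measurable (v k)) (hl : Measurable (lam k)) (hX : ∀ i, Measurable (X k i)) :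
    Measurable (v (k + 1)) ∧ Measurable (lam (k + 1)) := by
  have hrho : 0 < rho k := by rw [hw.rho_eq]; exact mul_pos hρ (hw.pos k)
  have hs : Measurable (s (k + 1)) := by
    refine measurable_of_norm_sub_le (r := rho k) hrho
      ((hv.const_smul (rho k)).sub hl) fun ω ω' => ?_
    have := proxObjective_lipschitz hg (mem_univ _) (mem_univ _)
      (hr.s_isMinOn k ω) (hr.s_isMinOn k ω')
    simpa using this
  have hGm : Measurable fun ω => batchGradient F (fun i => X k i ω) (v k ω) :=
    Measurable.comp (g := fun p : H × (Fin (m k) → Ξ) => batchGradient F p.2 p.1)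
      (f := fun ω => (v k ω, fun i => X k i ω)) (hG (m k)) (hv.prodMk (measurable_pi_iff.2 hX))
  have hv' : Measurable (v (k + 1)) := by
    refine measurable_of_norm_sub_le (r := rho k + eta k) (add_pos hrho (heta k))
      (((hs.const_smul (rho k)).add (hv.const_smul (eta k))).sub (hGm.sub hl)) fun ω ω' => ?_
    exact proxObjective_lipschitz (convexOn_const 0 hU) (hr.v_mem k ω) (hr.v_mem k ω')
      (hr.v_isMinOn k ω) (hr.v_isMinOn k ω')
  refine ⟨hv', ?_⟩
  have : lam (k + 1) = fun ω => lam k ω - (2 * μ * rho k) • (v (k + 1) ω - s (k + 1) ω) :=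
    funext fun ω => hr.lam_succ hw k ω
  rw [this]
  exact hl.sub ((hv'.sub hs).const_smul _)

theorem measurable_pastSigma (hr : IsADMMRun F g Uad m X μ rho eta θ v₀ s₀ l₀ u v z s lam psi)
    (hw : StepWeights ρ rho θ tau T) (hρ : 0 < ρ) (heta : ∀ k, 0 < eta k)
    (hU : Convex ℝ Uad) (hg : ConvexOn ℝ univ g)
    (hG : ∀ n, Measurable fun p : H × (Fin n → Ξ) => batchGradient F p.2 p.1) (k : ℕ) :
    Measurable[pastSigma X k] (v k) ∧ Measurable[pastSigma X k] (lam k) := by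
  induction k with
  | zero =>
    have h1 : v 0 = fun _ => v₀ := funext hr.v_init
    have h2 : lam 0 = fun _ => l₀ := funext hr.lam_init
    rw [h1, h2]
    exact ⟨measurable_const, measurable_const⟩
  | succ k ih =>
    exact measurable_succ (mΩ' := pastSigma X (k + 1)) hr hw hρ heta hU hg hG
      (ih.1.mono (pastSigma_mono k.le_succ) le_rfl) (ih.2.mono (pastSigma_mono k.le_succ) le_rfl)
      (fun i => measurable_sample_pastSigma k i)

/-- The estimate of the Lagrangian gap in terms of the accumulated noise. -/
theorem gap_le_noise (hr : IsADMMRun F g Uad m X μ rho eta θ v₀ s₀ l₀ u v z s lam psi)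
    (hw : StepWeights ρ rho θ tau T) (hμ0 : 0 < μ) (hμ1 : μ < 1) (hρ : 0 < ρ) (hv₀ : v₀ ∈ Uad)
    (hg : ConvexOn ℝ univ g) {f : H → ℝ} {D : H → H} (hf : ConvexOn ℝ Uad f)
    (hup : ∀ x ∈ Uad, ∀ y ∈ Uad, f y ≤ f x + ⟪D x, y - x⟫_ℝ + L / 2 * ‖y - x‖ ^ 2)
    (hlow : ∀ x ∈ Uad, ∀ y ∈ Uad, f x + ⟪D x, y - x⟫_ℝ + α / 2 * ‖y - x‖ ^ 2 ≤ f y)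
    {xst : H} (hxst : xst ∈ Uad) {ν : Measure Ξ} {J : H → Ξ → H}
    (hJ : ∀ k (b : Fin (m k) → Ξ) x, batchGradient F b x - D x = batchError ν J x b)
    {R : ℝ} (hR : ∀ x ∈ Uad, ∀ y ∈ Uad, ‖x - y‖ ≤ R) (hq : ∀ k, 0 < q k) {rest : ℕ → ℝ}
    (hcoef : ∀ k, ∀ d, 0 ≤ d → d ≤ R → 1 / 2 * (L - eta k + μ * rho k / (1 - μ)) * d ^ 2
      ≤ -(q k / 2 * d ^ 2) + rest k) {A E : ℝ} {K : ℕ}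
    (hA : ∀ x : ℕ → ℝ, (∀ k, 0 ≤ x k) → x 0 = ‖v₀ - xst‖ ^ 2 → ∑ k ∈ Finset.range K, tau k *
      ((rho k + eta k) / 2 * (x k - x (k + 1)) - α / 2 * x k + rest k) ≤ A)
    {ω : Ω} (hE : noiseSum ν J Uad xst tau q X v K ω ≤ E) (l : H) :
    T K * (f (u K ω) + g (z K ω) - f xst - g xst - ⟪l, u K ω - z K ω⟫_ℝ)
      ≤ 1 / (4 * μ * ρ) * ‖l₀ - l‖ ^ 2 + A + E := by
  have h1 := hr.gap_le hw hμ0 hμ1 hρ hv₀ hg hf hup hlow hxst l ω K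
  have h2 := hA (fun k => ‖v k ω - xst‖ ^ 2) (fun k => sq_nonneg _) (by rw [hr.v_init])
  have h3 : 0 ≤ 1 / (4 * μ * ρ) * ‖lam K ω - l‖ ^ 2 := by positivity
  refine (le_add_of_nonneg_right h3).trans (h1.trans ?_)
  have h4 : ∑ k ∈ Finset.range K, tau k *
      ((rho k + eta k) / 2 * (‖v k ω - xst‖ ^ 2 - ‖v (k + 1) ω - xst‖ ^ 2)
        - α / 2 * ‖v k ω - xst‖ ^ 2
        + 1 / 2 * (L - eta k + μ * rho k / (1 - μ)) * ‖v (k + 1) ω - v k ω‖ ^ 2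
        - ⟪batchGradient F (fun i => X k i ω) (v k ω) - D (v k ω), v (k + 1) ω - xst⟫_ℝ)
      ≤ ∑ k ∈ Finset.range K, tau k *
      ((rho k + eta k) / 2 * (‖v k ω - xst‖ ^ 2 - ‖v (k + 1) ω - xst‖ ^ 2)
        - α / 2 * ‖v k ω - xst‖ ^ 2 + rest k) + noiseSum ν J Uad xst tau q X v K ω := by
    rw [noiseSum, ← Finset.sum_add_distrib]
    refine Finset.sum_le_sum fun k _ => ?_
    rw [← mul_add]
    refine mul_le_mul_of_nonneg_left ?_ (hw.pos k).le
    rw [hJ k]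
    have h5 := hcoef k _ (norm_nonneg (v (k + 1) ω - v k ω))
      (hR _ (hr.v_mem k ω) _ (hr.v_mem_all hv₀ k ω))
    -- The actual next iterate is one competitor in the supremum. The term `q/2‖v (k+1) - v k‖²`
    -- this costs is supplied by `hcoef`.
    have h6 := le_noiseValue (S := Uad) (q := q k) (fun x hx => hR xst hxst x hx) (hq k).le
      (v k ω) (batchError ν J (v k ω) fun i => X k i ω) (hr.v_mem k ω)
    rw [← neg_sub (v (k + 1) ω) xst, inner_neg_right] at h6
    linarith
  linarith

end IsADMMRun

/-- A bound of the Lagrangian gap over a ball of multipliers bounds the suboptimality and the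
violation of the constraint. -/
theorem IsSaddlePoint.bounds_of_gap {f : H → ℝ} {u' z' l' x y : H}
    (h : IsSaddlePoint f g Uad u' z' l') {c Γ : ℝ} (hc0 : 0 < c) (hc : 2 * ‖l'‖ ≤ c) (hx : x ∈ Uad)
    (hgap : ∀ l, ‖l‖ ≤ c → f x + g y - f u' - g z' - ⟪l, x - y⟫_ℝ < Γ) :
    f x + g y - f u' - g z' < Γ ∧ ‖x - y‖ < 2 * Γ / c := by
  constructor
  · simpa using hgap 0 (by simpa using hc0.le)
  -- The multiplier of norm `c` that turns the inner product into `c‖x - y‖`. If `x = y`, division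
  -- by zero makes it `0` and the formulas below persist.
  · have h1 := hgap (-(c / ‖x - y‖) • (x - y)) (by
      rw [neg_smul, norm_neg, norm_smul, Real.norm_of_nonneg (by positivity)]
      rcases eq_or_ne (‖x - y‖) 0 with h0 | h0
      · simp [h0, hc0.le]
      · rw [div_mul_cancel₀ _ h0])
    rw [real_inner_smul_left, real_inner_self_eq_norm_sq] at h1
    have h2 : -(c / ‖x - y‖) * ‖x - y‖ ^ 2 = -(c * ‖x - y‖) := by
      rcases eq_or_ne (‖x - y‖) 0 with h0 | h0
      · simp [h0]
      · field_simp
    rw [h2] at h1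
    have h3 := h.le_inner (z := y) hx
    have h4 := abs_le.1 (abs_real_inner_le_norm l' (x - y))
    have h5 := mul_le_mul_of_nonneg_right hc (norm_nonneg (x - y))
    rw [lt_div_iff₀ hc0]
    linarith [h4.1]

end RunNoise

/-! ### Tail bounds for the method -/

section Tail

variable {H : Type*} [NormedAddCommGroup H] [InnerProductSpace ℝ H] [CompleteSpace H]
  [MeasurableSpace H] [BorelSpace H] [SecondCountableTopology H]
  {Ω Ξ : Type*} [mΩ : MeasurableSpace Ω] [MeasurableSpace Ξ] {P : Measure Ω} [IsProbabilityMeasure P]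
  {ν : Measure Ξ} [IsProbabilityMeasure ν] {m : ℕ → ℕ} {X : (k : ℕ) → Fin (m k) → Ω → Ξ}

/-- The degenerate case, for instance `umin = umax`, where the variance proxy is zero and the
Chernoff bound does not apply. -/
theorem noiseSum_nonpos {J : H → Ξ → H} {S : Set H} {xst : H} {tau q : ℕ → ℝ} {v : ℕ → Ω → H}
    {B N R : ℝ} (hm : ∀ k, 0 < m k) (hB : ∀ v, ‖v‖ ≤ N → ∀ t, ‖J v t‖ ≤ B) (hne : S.Nonempty)
    (hR : ∀ x ∈ S, ‖xst - x‖ ≤ R) (hq : ∀ k, 0 < q k) (htau : ∀ k, 0 ≤ tau k)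
    (hvN : ∀ k ω, ‖v k ω‖ ≤ N) (hBR : B * R = 0) (K : ℕ) (ω : Ω) :
    noiseSum ν J S xst tau q X v K ω ≤ 0 := by
  have hR0 : 0 ≤ R := by
    obtain ⟨x, hx⟩ := hne
    exact (norm_nonneg _).trans (hR x hx)
  refine Finset.sum_nonpos fun k _ => mul_nonpos_of_nonneg_of_nonpos (htau k) ?_
  refine (noiseValue_le hne hR (hq k).le _ _).trans ?_
  refine (mul_le_mul_of_nonneg_left (norm_batchError_le (hB _ (hvN k ω)) (hm k) _) hR0).trans ?_
  linarith

variable {S : Ξ → H →L[ℝ] H} {yd : H} {g : H → ℝ} {Uad : Set H} {μ ρ α C : ℝ}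
  {rho eta θ tau T q : ℕ → ℝ} {v₀ s₀ l₀ : H} {u v z s lam psi : ℕ → Ω → H} {ust zst lst : H}

/-- The exponent is at least `4δ² log K · Tn²/(W K²) ≥ δ² log K`, three times what is claimed. -/
theorem exp_neg_le_one_div_rpow {B R M W Tn c₄ δ : ℝ} {K : ℕ} (hK : 1 ≤ K) (hBR : 0 < B * R)
    (hM : 0 < M) (hW : 0 < W) (hWT : W * (K : ℝ) ^ 2 ≤ 4 * Tn ^ 2)
    (hc₄ : 8 * (B * R) ^ 2 / M ≤ c₄ ^ 2) :
    Real.exp (-((Tn * (δ * c₄ * √(Real.log K) / K)) ^ 2 / (2 * ((B * R) ^ 2 * W / M))))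
      ≤ (1 / (K : ℝ)) ^ (δ ^ 2 / 3) := by
  have hK0 : (0 : ℝ) < K := by exact_mod_cast hK
  have hlog : 0 ≤ Real.log K := Real.log_nonneg (by exact_mod_cast hK)
  rw [Real.rpow_def_of_pos (by positivity), one_div, Real.log_inv]
  apply Real.exp_le_exp.2
  rw [neg_mul, neg_le_neg_iff, le_div_iff₀ (by positivity)]
  have h1 : (Tn * (δ * c₄ * √(Real.log K) / K)) ^ 2
      = δ ^ 2 * Real.log K * (Tn ^ 2 * c₄ ^ 2 / (K : ℝ) ^ 2) := by
    rw [mul_pow, div_pow, mul_pow, mul_pow, Real.sq_sqrt hlog]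
    ring
  have h2 : 2 / 3 * ((B * R) ^ 2 * W / M) ≤ Tn ^ 2 * c₄ ^ 2 / (K : ℝ) ^ 2 := by
    rw [le_div_iff₀ (by positivity)]
    have h3 := mul_le_mul_of_nonneg_left hc₄ (sq_nonneg Tn)
    have h4 := mul_le_mul_of_nonneg_left hWT (show 0 ≤ (B * R) ^ 2 / M by positivity)
    have h5 : 0 ≤ (B * R) ^ 2 / M * Tn ^ 2 := by positivity
    have h6 : Tn ^ 2 * (8 * (B * R) ^ 2 / M) = 8 * ((B * R) ^ 2 / M * Tn ^ 2) := by ring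
    have h7 : 2 / 3 * ((B * R) ^ 2 * W / M) * (K : ℝ) ^ 2
        = 2 / 3 * ((B * R) ^ 2 / M * (W * (K : ℝ) ^ 2)) := by ring
    rw [h7]
    linarith
  rw [h1]
  have h8 := mul_le_mul_of_nonneg_left h2 (show 0 ≤ δ ^ 2 * Real.log K by positivity)
  linarith

theorem sum_range_one_div_le {M : ℝ} (hsum : HasSum (fun k => 1 / (m k : ℝ)) (1 / M)) (K : ℕ) :
    ∑ k ∈ Finset.range K, 1 / (m k : ℝ) ≤ 1 / M :=
  sum_le_hasSum _ (fun k _ => by positivity) hsum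

/-- The tail bounds for the method with general weights. -/
theorem IsADMMRun.tail
    (hr : IsADMMRun (trackingCost S yd α) g Uad m X μ rho eta θ v₀ s₀ l₀ u v z s lam psi)
    (hw : StepWeights ρ rho θ tau T) (heta : ∀ k, 0 < eta k)
    (hμ0 : 0 < μ) (hμ1 : μ < 1) (hρ : 0 < ρ) (hα : 0 ≤ α)
    (hS : ∀ t x y, ⟪S t x, y⟫_ℝ = ⟪x, S t y⟫_ℝ) (hC : ∀ t x, ‖S t x‖ ≤ C * ‖x‖) (hC0 : 0 ≤ C)
    (hmeas : ∀ x, Measurable fun t => S t x)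
    (hU : Convex ℝ Uad) (hv₀ : v₀ ∈ Uad) (hg : ConvexOn ℝ univ g)
    (hstar : IsSaddlePoint (fun x => ∫ t, trackingCost S yd α x t ∂ν) g Uad ust zst lst)
    {R N : ℝ} (hR : ∀ x ∈ Uad, ∀ y ∈ Uad, ‖x - y‖ ≤ R) (hN : ∀ x ∈ Uad, ‖x‖ ≤ N)
    (hX : ∀ k i, Measurable (X k i))
    (hind : iIndepFun (fun p : (k : ℕ) × Fin (m k) => X p.1 p.2) P)
    (hν : ∀ k i, P.map (X k i) = ν) (hm : ∀ k, 0 < m k) {M : ℝ} (hM : 0 < M)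
    (hsum : HasSum (fun k => 1 / (m k : ℝ)) (1 / M))
    {c : ℝ} (hc0 : 0 < c) (hc : 2 * ‖lst‖ ≤ c)
    {rest : ℕ → ℝ} {φ : ℝ} (hφ : 0 < φ) (hq : ∀ k, tau k = φ * q k)
    (hcoef : ∀ k, ∀ d, 0 ≤ d → d ≤ R →
      1 / 2 * (α + C ^ 2 - eta k + μ * rho k / (1 - μ)) * d ^ 2 ≤ -(q k / 2 * d ^ 2) + rest k)
    {A B W Γ c₄ δ : ℝ} {K : ℕ} (hK : 1 ≤ K) (hδ : 0 < δ) (hB : B = C ^ 2 * N + C * ‖yd‖)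
    (hc₄0 : 0 ≤ c₄) (hc₄ : 8 * (B * R) ^ 2 / M ≤ c₄ ^ 2)
    (hA : ∀ x : ℕ → ℝ, (∀ k, 0 ≤ x k) → x 0 = ‖v₀ - ust‖ ^ 2 → ∑ k ∈ Finset.range K, tau k *
      ((rho k + eta k) / 2 * (x k - x (k + 1)) - α / 2 * x k + rest k) ≤ A)
    (hW : ∀ k < K, tau k ^ 2 ≤ W) (hWT : W * (K : ℝ) ^ 2 ≤ 4 * T K ^ 2)
    (hΓ : A + 2 * φ * B ^ 2 / M + (‖l₀‖ ^ 2 + c ^ 2) / (μ * ρ) ≤ T K * Γ) :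
    1 - (1 / (K : ℝ)) ^ (δ ^ 2 / 3) ≤ P.real {ω |
      ∫ t, trackingCost S yd α (u K ω) t ∂ν + g (z K ω) - ∫ t, trackingCost S yd α ust t ∂ν - g zst
        < Γ + δ * c₄ * √(Real.log K) / K} ∧
    1 - (1 / (K : ℝ)) ^ (δ ^ 2 / 3) ≤ P.real {ω |
      ‖u K ω - z K ω‖ < 2 * (Γ + δ * c₄ * √(Real.log K) / K) / c} := by
  set J : H → Ξ → H := trackingGradient S yd with hJdef
  have hqpos : ∀ k, 0 < q k := fun k => by
    have h := hw.pos k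
    rw [hq] at h
    exact pos_of_mul_pos_right h hφ.le
  have htau : ∀ k, 0 ≤ tau k := fun k => (hw.pos k).le
  have hne : Uad.Nonempty := ⟨v₀, hv₀⟩
  have hR' : ∀ x ∈ Uad, ‖ust - x‖ ≤ R := fun x hx => hR _ hstar.1 x hx
  have hR0 : 0 ≤ R := (norm_nonneg _).trans (hR _ hv₀ _ hv₀)
  have hN0 : 0 ≤ N := (norm_nonneg _).trans (hN _ hv₀)
  have hB0 : 0 ≤ B := by rw [hB]; positivity
  have hBJ : ∀ x, ‖x‖ ≤ N → ∀ t, ‖J x t‖ ≤ B := fun x hx t => by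
    rw [hB]; exact norm_trackingGradient_le hC hC0 hx t
  have hvN : ∀ k ω, ‖v k ω‖ ≤ N := fun k ω => hN _ (hr.v_mem_all hv₀ k ω)
  have hvm := fun k => (hr.measurable_pastSigma hw hρ heta hU hg
    (measurable_batchGradient hS hmeas) k).1
  have hJm : Measurable (Function.uncurry J) := measurable_trackingGradient hmeas
  have hK0 : (0 : ℝ) < K := by exact_mod_cast hK
  have hTK : 0 < T K := by
    obtain ⟨j, rfl⟩ : ∃ j, K = j + 1 := ⟨K - 1, by omega⟩
    exact hw.succ_pos j
  set E : ℝ := 2 * φ * B ^ 2 / M with hEdef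
  set t : ℝ := T K * (δ * c₄ * √(Real.log K) / K) with htdef
  have ht : 0 ≤ t := by positivity
  have hconv : ConvexOn ℝ Uad fun x => ∫ t, trackingCost S yd α x t ∂ν :=
    convexOn_of_gradient_inequality hU (D := expectedGradient ν S yd α) fun x _ y _ => by
      have h1 := le_expectedCost (yd := yd) (α := α) (ν := ν) hS hC hC0 hmeas x y
      have h2 : 0 ≤ α / 2 * ‖y - x‖ ^ 2 := by positivity
      linarith
  -- The threshold on the noise is independent of `l`, so one event serves all multipliers and both
  -- conclusions.
  have good : ∀ ω, noiseSum ν J Uad ust tau q X v K ω ≤ E + t →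
      (∫ t, trackingCost S yd α (u K ω) t ∂ν + g (z K ω) - ∫ t, trackingCost S yd α ust t ∂ν
        - g zst < Γ + δ * c₄ * √(Real.log K) / K) ∧
      ‖u K ω - z K ω‖ < 2 * (Γ + δ * c₄ * √(Real.log K) / K) / c := by
    intro ω hω
    refine hstar.bounds_of_gap hc0 hc (hr.u_mem_all hw hU hv₀ K ω) fun l hl => ?_
    have h1 := hr.gap_le_noise hw hμ0 hμ1 hρ hv₀ hg hconv
      (L := α + C ^ 2) (α := α) (D := expectedGradient ν S yd α)
      (fun x _ y _ => expectedCost_le hS hC hC0 hmeas x y)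
      (fun x _ y _ => le_expectedCost hS hC hC0 hmeas x y)
      hstar.1 (J := J) (ν := ν)
      (fun k b x => batchGradient_sub_expectedGradient hS (hm k) b x) hR hqpos hcoef hA hω l
    rw [← hstar.eq]
    -- The strict inequality in the result comes from here: the left side is at most half the right
    -- side, which is positive because `c > 0`.
    have h2 : 1 / (4 * μ * ρ) * ‖l₀ - l‖ ^ 2 < (‖l₀‖ ^ 2 + c ^ 2) / (μ * ρ) := by
      have h3 : ‖l₀ - l‖ ^ 2 ≤ (‖l₀‖ + c) ^ 2 := by
        gcongr
        exact (norm_sub_le _ _).trans (add_le_add_right hl _)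
      have h4 : ‖l₀ - l‖ ^ 2 < 4 * (‖l₀‖ ^ 2 + c ^ 2) := by
        nlinarith [sq_nonneg (‖l₀‖ - c), sq_nonneg ‖l₀‖, pow_pos hc0 2]
      rw [one_div_mul_eq_div, div_lt_div_iff₀ (by positivity) (by positivity)]
      have h5 : 0 < μ * ρ := mul_pos hμ0 hρ
      nlinarith
    refine lt_of_mul_lt_mul_left ?_ hTK.le
    rw [mul_add, ← htdef]
    linarith
  have hlow : 1 - (1 / (K : ℝ)) ^ (δ ^ 2 / 3)
      ≤ P.real {ω | noiseSum ν J Uad ust tau q X v K ω ≤ E + t} := by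
    rcases eq_or_ne (B * R) 0 with hBR | hBR
    · have huniv : {ω | noiseSum ν J Uad ust tau q X v K ω ≤ E + t} = univ := by
        refine eq_univ_of_forall fun ω => ?_
        refine (noiseSum_nonpos hm hBJ hne hR' hqpos htau hvN hBR K ω).trans ?_
        positivity
      rw [huniv, probReal_univ]
      have : (0 : ℝ) ≤ (1 / (K : ℝ)) ^ (δ ^ 2 / 3) := by positivity
      linarith
    · have hBR0 : 0 < B * R := lt_of_le_of_ne (mul_nonneg hB0 hR0) (Ne.symm hBR)
      have hW0 : 0 < W := (pow_pos (hw.pos 0) 2).trans_le (hW 0 (by omega))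
      have hm0 : ∀ k, (0 : ℝ) < m k := fun k => by exact_mod_cast hm k
      have hsumK := sum_range_one_div_le hsum K
      have hE1 : ∑ k ∈ Finset.range K, tau k * (2 * B ^ 2 / (q k * m k)) ≤ E := by
        have h1 : ∀ k ∈ Finset.range K, tau k * (2 * B ^ 2 / (q k * m k))
            -- The ratio `tau k / q k` is the constant `φ`, so the means add up with the series `∑ 1
            -- / m k`.
            = 2 * φ * B ^ 2 * (1 / (m k : ℝ)) := fun k _ => by
          have := hqpos k
          have := hm0 k
          rw [hq]
          field_simp
        rw [Finset.sum_congr rfl h1, ← Finset.mul_sum, hEdef, div_eq_mul_one_div]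
        exact mul_le_mul_of_nonneg_left hsumK (by positivity)
      have hV1 : ∑ k ∈ Finset.range K, tau k ^ 2 * (B ^ 2 * R ^ 2 / m k)
          ≤ (B * R) ^ 2 * W / M := by
        have h1 : ∀ k ∈ Finset.range K, tau k ^ 2 * (B ^ 2 * R ^ 2 / m k)
            ≤ (B * R) ^ 2 * W * (1 / (m k : ℝ)) := fun k hk => by
          have h2 := hW k (Finset.mem_range.1 hk)
          have h3 := mul_le_mul_of_nonneg_right h2
            (show 0 ≤ B ^ 2 * R ^ 2 / (m k : ℝ) by positivity)
          refine h3.trans_eq ?_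
          ring
        refine (Finset.sum_le_sum h1).trans ?_
        rw [← Finset.mul_sum, div_eq_mul_one_div _ M]
        exact mul_le_mul_of_nonneg_left hsumK (by positivity)
      have htail := measureReal_noiseSum_ge_le (P := P) hX hind hν hm hJm hBJ hne hR' hqpos htau
        hvm hvN K hE1 hV1 (by positivity) ht
      have hexp := exp_neg_le_one_div_rpow (δ := δ) hK hBR0 hM hW0 hWT hc₄
      have hmeasS : MeasurableSet {ω | E + t ≤ noiseSum ν J Uad ust tau q X v K ω} :=
        measurableSet_le measurable_const
          ((measurable_noiseSum_pastSigma hJm hR' hqpos hvm K).mono (pastSigma_le hX K) le_rfl)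
      have hcompl := probReal_compl_eq_one_sub (μ := P) hmeasS
      have hsub : {ω | E + t ≤ noiseSum ν J Uad ust tau q X v K ω}ᶜ
          ⊆ {ω | noiseSum ν J Uad ust tau q X v K ω ≤ E + t} := fun ω hω =>
        le_of_lt (not_le.1 (show ¬ E + t ≤ noiseSum ν J Uad ust tau q X v K ω from hω))
      have hmono := measureReal_mono (μ := P) hsub
      linarith [htail.trans hexp]
  -- Monotonicity of the measure suffices; the two final events need not be shown measurable.
  exact ⟨hlow.trans (measureReal_mono fun ω hω => (good ω hω).1),
    hlow.trans (measureReal_mono fun ω hω => (good ω hω).2)⟩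

end Tail

/-! ### The two choices of the parameters -/

section Weights

theorem stepWeights_const (ρ : ℝ) :
    StepWeights ρ (fun _ => ρ) (fun k => (k : ℝ) + 1) (fun _ => 1) (fun k => k) where
  zero := by simp
  succ k := by push_cast; ring
  pos _ := one_pos
  theta k := by push_cast; ring
  rho_eq _ := by ring

theorem nesterovTheta_pos (k : ℕ) : 0 < nesterovTheta k := by
  cases k with
  | zero => simp [nesterovTheta]
  | succ k => simp only [nesterovTheta]; positivity

/-- The recursion increases `θ` by at least `1/2`, because `√(1 + 4θ²) ≥ 2θ`. -/
theorem nesterovTheta_ge (k : ℕ) : ((k : ℝ) + 2) / 2 ≤ nesterovTheta k := by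
  induction k with
  | zero => simp [nesterovTheta]
  | succ k ih =>
    have h1 := nesterovTheta_pos k
    have h2 : 2 * nesterovTheta k ≤ √(1 + 4 * nesterovTheta k ^ 2) := by
      apply Real.le_sqrt_of_sq_le
      nlinarith
    simp only [nesterovTheta]
    push_cast
    linarith

theorem nesterovTheta_mono : Monotone nesterovTheta := by
  refine monotone_nat_of_le_succ fun k => ?_
  have h1 := nesterovTheta_eq k
  have h2 := nesterovTheta_pos k
  have h3 := nesterovTheta_pos (k + 1)
  by_contra h
  push Not at h
  nlinarith

theorem sum_nesterovTheta (k : ℕ) :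
    ∑ j ∈ Finset.range (k + 1), nesterovTheta j = nesterovTheta k ^ 2 := by
  induction k with
  | zero => simp [nesterovTheta]
  | succ k ih => rw [Finset.sum_range_succ, ih, nesterovTheta_eq]

theorem stepWeights_nesterov (ρ : ℝ) :
    StepWeights ρ (fun k => ρ * nesterovTheta k) nesterovTheta nesterovTheta
      (fun k => ∑ j ∈ Finset.range k, nesterovTheta j) where
  zero := by simp
  succ k := Finset.sum_range_succ _ _
  pos := nesterovTheta_pos
  theta k := by rw [sum_nesterovTheta, sq]
  rho_eq _ := rfl

/-- Since `θ_{k+1}² - θ_{k+1} = θ_k²`, the strong convexity term `α θ_k x_k / 2` pays for the growth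
of the weights `θ_k²` as long as `σ ≤ α`. At `k = 0` it removes even the initial distance, since
`θ₀² = θ₀`. -/
theorem telescope_nesterov_le {σ α : ℝ} (hσα : σ ≤ α) {x : ℕ → ℝ} (hx : ∀ k, 0 ≤ x k)
    (K : ℕ) :
    ∑ k ∈ Finset.range K, nesterovTheta k *
      (σ * nesterovTheta k / 2 * (x k - x (k + 1)) - α / 2 * x k)
      ≤ -(σ / 2 * (∑ j ∈ Finset.range K, nesterovTheta j) * x K) := by
  induction K with
  | zero => simp
  | succ K ih =>
    have h1 : nesterovTheta K ^ 2 = ∑ j ∈ Finset.range K, nesterovTheta j + nesterovTheta K := by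
      rw [← sum_nesterovTheta, Finset.sum_range_succ]
    rw [Finset.sum_range_succ, sum_nesterovTheta]
    have h2 : 0 ≤ (α - σ) * (nesterovTheta K * x K) :=
      mul_nonneg (by linarith) (mul_nonneg (nesterovTheta_pos K).le (hx K))
    have h3 : σ / 2 * nesterovTheta K ^ 2 * x K = σ / 2 * (∑ j ∈ Finset.range K, nesterovTheta j
      + nesterovTheta K) * x K := by rw [h1]
    linarith

theorem sum_range_ite_le {f : ℕ → ℝ} (hf : ∀ k, 0 ≤ f k) (n K : ℕ) :
    ∑ k ∈ Finset.range K, (if k < n then f k else 0) ≤ ∑ k ∈ Finset.range n, f k := by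
  rw [← Finset.sum_filter]
  refine Finset.sum_le_sum_of_subset_of_nonneg ?_ fun k _ _ => hf k
  intro k hk
  exact Finset.mem_range.2 (Finset.mem_filter.1 hk).2

end Weights

/-! ### The Poincaré inequality -/

section Poincare

/-- Integrate `φ²` by parts against the coordinate `p x = ⟪v, x⟫`, whose derivative along `v` is
`1`; on `D` it is bounded by `r`, and Young's inequality absorbs half of `∫ φ²`. -/
theorem integral_sq_le_integral_fderiv_sq {E : Type*} [NormedAddCommGroup E] [InnerProductSpace ℝ E]
    [FiniteDimensional ℝ E] [MeasurableSpace E] [BorelSpace E] {D : Set E} {v : E} (hvn : ‖v‖ = 1)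
    {r : ℝ} (hD : D ⊆ Metric.closedBall 0 r) {φ : E → ℝ}
    (hφ : ContDiff ℝ ((⊤ : ℕ∞) : WithTop ℕ∞) φ) (hc : HasCompactSupport φ) (hs : tsupport φ ⊆ D) :
    ∫ x, φ x ^ 2 ≤ 4 * r ^ 2 * ∫ x, ‖fderiv ℝ φ x‖ ^ 2 := by
  have hpv : ⟪v, v⟫_ℝ = 1 := by rw [real_inner_self_eq_norm_sq, hvn, one_pow]
  obtain ⟨p, hp⟩ : ∃ p : E →L[ℝ] ℝ, ∀ x, p x = ⟪v, x⟫_ℝ := ⟨innerSL ℝ v, fun x => rfl⟩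
  have hdiff : Differentiable ℝ φ := hφ.differentiable (by simp)
  have hcφ : Continuous φ := hφ.continuous
  have hcf : Continuous fun x => fderiv ℝ φ x := hφ.continuous_fderiv (by simp)
  have hcs' : HasCompactSupport fun x => fderiv ℝ φ x := hc.fderiv ℝ
  have hf : ∀ x, fderiv ℝ (fun y => φ y ^ 2) x v = 2 * φ x * fderiv ℝ φ x v := by
    intro x
    have h := ((hdiff x).hasFDerivAt.pow 2).fderiv
    rw [h]
    simp
  have hg : ∀ x, fderiv ℝ (fun y => p y) x v = 1 := by
    intro x
    rw [p.hasFDerivAt.fderiv, hp, hpv]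
  have hi1 : Integrable fun x => φ x ^ 2 :=
    Continuous.integrable_of_hasCompactSupport (by fun_prop)
      (hc.mono fun x hx h => hx (by simp [h]))
  have hi2 : Integrable fun x => ‖fderiv ℝ φ x‖ ^ 2 :=
    Continuous.integrable_of_hasCompactSupport (by fun_prop)
      (hcs'.mono fun x hx h => hx (by simp [h]))
  have hi3 : Integrable fun x => φ x ^ 2 * p x :=
    Continuous.integrable_of_hasCompactSupport (by fun_prop)
      (hc.mono fun x hx h => hx (by simp [h]))
  have hi4 : Integrable fun x => 2 * φ x * fderiv ℝ φ x v * p x :=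
    Continuous.integrable_of_hasCompactSupport (by fun_prop)
      (hc.mono fun x hx h => hx (by simp [h]))
  have key := integral_mul_fderiv_eq_neg_fderiv_mul_of_integrable
    (μ := (volume : Measure E))
    (f := fun y => φ y ^ 2) (g := fun y => p y) (v := v) (by simpa only [hf] using hi4)
    (by simpa only [hg, mul_one] using hi1) hi3 (fun x _ => (hdiff x).pow 2)
    (fun x _ => p.differentiableAt)
  simp only [hf, hg, mul_one] at key
  rw [← integral_neg] at key
  have hle : ∫ x, -(2 * φ x * fderiv ℝ φ x v * p x)
      ≤ ∫ x, (1 / 2 * φ x ^ 2 + 2 * r ^ 2 * ‖fderiv ℝ φ x‖ ^ 2) := by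
    refine integral_mono hi4.neg ((hi1.const_mul _).add (hi2.const_mul _)) fun x => ?_
    by_cases hx : φ x = 0
    · simp only [hx]
      have : 0 ≤ 2 * r ^ 2 * ‖fderiv ℝ φ x‖ ^ 2 := by positivity
      simpa using this
    · have hxD : x ∈ D := hs (subset_tsupport φ hx)
      have h1 : |p x| ≤ r := by
        have h2 : ‖x‖ ≤ r := by simpa using hD hxD
        have h3 := abs_real_inner_le_norm v x
        rw [hvn, one_mul, ← hp] at h3
        exact h3.trans h2
      have h4 : |fderiv ℝ φ x v| ≤ ‖fderiv ℝ φ x‖ := by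
        have := (fderiv ℝ φ x).le_opNorm v
        rwa [hvn, mul_one] at this
      have h5 : |fderiv ℝ φ x v * p x| ≤ ‖fderiv ℝ φ x‖ * r := by
        rw [abs_mul]; exact mul_le_mul h4 h1 (abs_nonneg _) (norm_nonneg _)
      have h6 : (fderiv ℝ φ x v * p x) ^ 2 ≤ (‖fderiv ℝ φ x‖ * r) ^ 2 := by
        rw [← sq_abs]; gcongr
      show -(2 * φ x * fderiv ℝ φ x v * p x) ≤ 1 / 2 * φ x ^ 2 + 2 * r ^ 2 * ‖fderiv ℝ φ x‖ ^ 2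
      nlinarith [sq_nonneg (φ x + 2 * (fderiv ℝ φ x v * p x))]
  rw [← key, integral_add (hi1.const_mul _) (hi2.const_mul _), integral_const_mul,
    integral_const_mul] at hle
  linarith

variable {d : ℕ} {D : Set (EuclideanSpace ℝ (Fin d))}

theorem norm_gradient_eq {F : Type*} [NormedAddCommGroup F] [InnerProductSpace ℝ F] [CompleteSpace F]
    (φ : F → ℝ) (x : F) : ‖gradient φ x‖ = ‖fderiv ℝ φ x‖ := by
  rw [gradient, LinearIsometryEquiv.norm_map]

theorem norm_sq_eq_integral {α F : Type*} [MeasurableSpace α] {ν : Measure α} [NormedAddCommGroup F]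
    [InnerProductSpace ℝ F] (f : Lp F 2 ν) : ‖f‖ ^ 2 = ∫ x, ‖f x‖ ^ 2 ∂ν := by
  rw [← real_inner_self_eq_norm_sq, L2.inner_def]
  simp only [real_inner_self_eq_norm_sq]

theorem norm_fst_le_of_mem_testPairs (e : Fin d) {r : ℝ} (hr : 0 ≤ r) (hD : D ⊆ Metric.closedBall 0 r)
    {w : WithLp 2 (L2 D × L2Vec D)}
    (hw : w ∈ testPairs D) : ‖w.fst‖ ≤ 2 * r * ‖w.snd‖ := by
  obtain ⟨φ, hφ, hc, hs, h1, h2⟩ := hw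
  have hz : ∀ x, x ∉ D → φ x = 0 := fun x hx => by
    by_contra h
    exact hx (hs (subset_tsupport φ h))
  have hz' : ∀ x, x ∉ D → fderiv ℝ φ x = 0 := fun x hx => by
    by_contra h
    exact hx (hs (support_fderiv_subset ℝ h))
  have e1 : ‖w.fst‖ ^ 2 = ∫ x, φ x ^ 2 := by
    rw [norm_sq_eq_integral, ← setIntegral_eq_integral_of_forall_compl_eq_zero
      (s := D) (f := fun x => φ x ^ 2) (fun x hx => by rw [hz x hx]; simp)]
    refine integral_congr_ae ?_
    filter_upwards [h1] with x hx
    rw [hx, Real.norm_eq_abs, sq_abs]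
  have e2 : ‖w.snd‖ ^ 2 = ∫ x, ‖fderiv ℝ φ x‖ ^ 2 := by
    rw [norm_sq_eq_integral, ← setIntegral_eq_integral_of_forall_compl_eq_zero
      (s := D) (f := fun x => ‖fderiv ℝ φ x‖ ^ 2) (fun x hx => by rw [hz' x hx]; simp)]
    refine integral_congr_ae ?_
    filter_upwards [h2] with x hx
    rw [hx, norm_gradient_eq]
  have h := integral_sq_le_integral_fderiv_sq (v := EuclideanSpace.single e 1) (by simp) hD hφ hc hs
  rw [← e1, ← e2] at h
  refine abs_le_of_sq_le_sq' ?_ (by positivity) |>.2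
  linarith

theorem gradient_add' {F : Type*} [NormedAddCommGroup F] [InnerProductSpace ℝ F] [CompleteSpace F]
    {φ ψ : F → ℝ} (hφ : Differentiable ℝ φ) (hψ : Differentiable ℝ ψ) (x : F) :
    gradient (fun y => φ y + ψ y) x = gradient φ x + gradient ψ x := by
  rw [gradient, gradient, gradient, ← map_add]
  congr 1
  exact ((hφ x).hasFDerivAt.add (hψ x).hasFDerivAt).fderiv

theorem gradient_const_mul' {F : Type*} [NormedAddCommGroup F] [InnerProductSpace ℝ F]
    [CompleteSpace F] {φ : F → ℝ} (hφ : Differentiable ℝ φ) (c : ℝ) (x : F) :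
    gradient (fun y => c * φ y) x = c • gradient φ x := by
  apply HasGradientAt.gradient
  rw [hasGradientAt_iff_hasFDerivAt]
  refine ((hφ x).hasFDerivAt.const_mul c).congr_fderiv ?_
  ext y
  simp [gradient]

/-- The test pairs form a linear subspace. -/
def testSubmodule (D : Set (EuclideanSpace ℝ (Fin d))) :
    Submodule ℝ (WithLp 2 (L2 D × L2Vec D)) where
  carrier := testPairs D
  add_mem' := by
    rintro w w' ⟨φ, hφ, hc, hs, h1, h2⟩ ⟨φ', hφ', hc', hs', h1', h2'⟩
    refine ⟨fun y => φ y + φ' y, hφ.add hφ', hc.add hc',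
      (tsupport_add φ φ').trans (union_subset hs hs'), ?_, ?_⟩
    · filter_upwards [h1, h1', Lp.coeFn_add w.fst w'.fst] with x e1 e2 e3
      rw [WithLp.add_fst, e3, Pi.add_apply, e1, e2]
    · filter_upwards [h2, h2', Lp.coeFn_add w.snd w'.snd] with x e1 e2 e3
      rw [WithLp.add_snd, e3, Pi.add_apply, e1, e2,
        gradient_add' (hφ.differentiable (by simp)) (hφ'.differentiable (by simp))]
  zero_mem' := by
    refine ⟨fun _ => 0, contDiff_const, HasCompactSupport.zero, by simp [tsupport], ?_, ?_⟩
    · filter_upwards [Lp.coeFn_zero ℝ 2 (volume.restrict D)] with x e1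
      rw [WithLp.zero_fst, e1, Pi.zero_apply]
    · filter_upwards [Lp.coeFn_zero (EuclideanSpace ℝ (Fin d)) 2 (volume.restrict D)] with x e1
      rw [WithLp.zero_snd, e1, Pi.zero_apply]
      simp [gradient]
  smul_mem' := by
    rintro c w ⟨φ, hφ, hc, hs, h1, h2⟩
    refine ⟨fun y => c * φ y, contDiff_const.mul hφ, HasCompactSupport.mul_left hc,
      (closure_mono ?_).trans hs, ?_, ?_⟩
    · intro x hx h
      exact hx (by simp [h])
    · filter_upwards [h1, Lp.coeFn_smul c w.fst] with x e1 e3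
      rw [WithLp.smul_fst, e3, Pi.smul_apply, e1, smul_eq_mul]
    · filter_upwards [h2, Lp.coeFn_smul c w.snd] with x e1 e3
      rw [WithLp.smul_snd, e3, Pi.smul_apply, e1,
        gradient_const_mul' (hφ.differentiable (by simp))]

theorem norm_fst_le_of_mem_H10 (e : Fin d) {r : ℝ} (hr : 0 ≤ r) (hD : D ⊆ Metric.closedBall 0 r)
    {w : WithLp 2 (L2 D × L2Vec D)} (hw : w ∈ H10 D) :
    ‖w.fst‖ ≤ 2 * r * ‖w.snd‖ := by
  have hclosed : IsClosed {w : WithLp 2 (L2 D × L2Vec D) | ‖w.fst‖ ≤ 2 * r * ‖w.snd‖} :=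
    isClosed_le (by fun_prop) (by fun_prop)
  refine closure_minimal ?_ hclosed hw
  intro x hx
  -- The test pairs already form a subspace, so the span adds nothing and only the closure remains.
  have hle : Submodule.span ℝ (testPairs D) ≤ testSubmodule D := Submodule.span_le.2 le_rfl
  exact norm_fst_le_of_mem_testPairs e hr hD (hle hx)

theorem poincareConst_nonneg : 0 ≤ poincareConst D :=
  Real.sInf_nonneg fun _ h => h.1

/-- The Poincaré inequality with the optimal constant. -/
theorem norm_fst_le_poincareConst (hd : 1 ≤ d) (hDb : Bornology.IsBounded D)
    {w : WithLp 2 (L2 D × L2Vec D)} (hw : w ∈ H10 D) : ‖w.fst‖ ≤ poincareConst D * ‖w.snd‖ := by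
  obtain ⟨r, hr0, hr⟩ := hDb.subset_closedBall_lt 0 0
  -- Some finite constant must be admissible for the infimum to be meaningful. Positive dimension
  -- supplies the coordinate direction `⟨0, hd⟩`.
  have hne : 2 * r ∈ {C : ℝ | 0 ≤ C ∧ ∀ w ∈ H10 D, ‖w.fst‖ ≤ C * ‖w.snd‖} :=
    ⟨by positivity, fun w hw => norm_fst_le_of_mem_H10 ⟨0, hd⟩ hr0.le hr hw⟩
  rcases eq_or_ne ‖w.snd‖ 0 with h0 | h0
  · have := hne.2 w hw
    rw [h0, mul_zero] at this ⊢
    exact this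
  · have hpos : 0 < ‖w.snd‖ := lt_of_le_of_ne (norm_nonneg _) (Ne.symm h0)
    rw [← div_le_iff₀ hpos]
    exact le_csInf ⟨_, hne⟩ fun C hC => (div_le_iff₀ hpos).2 (hC.2 w hw)

end Poincare

/-! ### The solution operator of the elliptic equation -/

section Elliptic

variable {d : ℕ} {D : Set (EuclideanSpace ℝ (Fin d))}

/-- A bounded measurable coefficient on `D`, bounded below by a positive constant. -/
structure IsEllipticCoeff (D : Set (EuclideanSpace ℝ (Fin d))) (amin amax : ℝ)
    (a : EuclideanSpace ℝ (Fin d) → ℝ) : Prop where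
  measurable : Measurable a
  pos : 0 < amin
  bounds : ∀ᵐ x ∂(volume.restrict D), amin ≤ a x ∧ a x ≤ amax

variable {amin amax : ℝ} {a : EuclideanSpace ℝ (Fin d) → ℝ}

namespace IsEllipticCoeff

theorem memLp_smul (ha : IsEllipticCoeff D amin amax a) (p : L2Vec D) :
    MemLp (fun x => a x • p x) 2 (volume.restrict D) := by
  refine MemLp.of_le_mul (c := amax) (Lp.memLp p)
    (ha.measurable.aestronglyMeasurable.smul (Lp.aestronglyMeasurable p)) ?_
  filter_upwards [ha.bounds] with x hx
  rw [norm_smul, Real.norm_of_nonneg (ha.pos.le.trans hx.1)]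
  exact mul_le_mul_of_nonneg_right hx.2 (norm_nonneg _)

/-- Multiplication of vector fields by the coefficient. -/
def mulOp (ha : IsEllipticCoeff D amin amax a) : L2Vec D →L[ℝ] L2Vec D :=
  LinearMap.mkContinuous
    { toFun := fun p => (ha.memLp_smul p).toLp _
      map_add' := fun p q => by
        ext1
        filter_upwards [(ha.memLp_smul (p + q)).coeFn_toLp, (ha.memLp_smul p).coeFn_toLp,
          (ha.memLp_smul q).coeFn_toLp, Lp.coeFn_add p q,
          Lp.coeFn_add ((ha.memLp_smul p).toLp _) ((ha.memLp_smul q).toLp _)] with x h1 h2 h3 h4 h5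
        rw [h1, h5, Pi.add_apply, h2, h3, h4, Pi.add_apply, smul_add]
      map_smul' := fun c p => by
        ext1
        filter_upwards [(ha.memLp_smul (c • p)).coeFn_toLp, (ha.memLp_smul p).coeFn_toLp,
          Lp.coeFn_smul c p, Lp.coeFn_smul c ((ha.memLp_smul p).toLp _)] with x h1 h2 h3 h4
        rw [h1, RingHom.id_apply, h4, Pi.smul_apply, h2, h3, Pi.smul_apply, smul_comm] }
    amax fun p => by
      refine Lp.norm_le_mul_norm_of_ae_le_mul ?_
      filter_upwards [(ha.memLp_smul p).coeFn_toLp, ha.bounds] with x h1 hx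
      change ‖((ha.memLp_smul p).toLp _ : L2Vec D) x‖ ≤ _
      rw [h1, norm_smul, Real.norm_of_nonneg (ha.pos.le.trans hx.1)]
      exact mul_le_mul_of_nonneg_right hx.2 (norm_nonneg _)

theorem inner_mulOp (ha : IsEllipticCoeff D amin amax a) (p q : L2Vec D) :
    ⟪ha.mulOp p, q⟫_ℝ = ∫ x in D, a x * ⟪p x, q x⟫_ℝ := by
  rw [L2.inner_def]
  refine integral_congr_ae ?_
  filter_upwards [(ha.memLp_smul p).coeFn_toLp] with x h1
  change ⟪((ha.memLp_smul p).toLp _ : L2Vec D) x, q x⟫_ℝ = _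
  rw [h1, real_inner_smul_left]

theorem inner_mulOp_comm (ha : IsEllipticCoeff D amin amax a) (p q : L2Vec D) :
    ⟪ha.mulOp p, q⟫_ℝ = ⟪ha.mulOp q, p⟫_ℝ := by
  rw [inner_mulOp, inner_mulOp]
  simp only [real_inner_comm]

theorem le_inner_mulOp (ha : IsEllipticCoeff D amin amax a) (p : L2Vec D) :
    amin * ‖p‖ ^ 2 ≤ ⟪ha.mulOp p, p⟫_ℝ := by
  rw [← real_inner_self_eq_norm_sq, ← real_inner_smul_left, ← sub_nonneg, ← inner_sub_left,
    L2.inner_def]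
  refine integral_nonneg_of_ae ?_
  filter_upwards [(ha.memLp_smul p).coeFn_toLp, ha.bounds, Lp.coeFn_smul amin p,
    Lp.coeFn_sub (ha.mulOp p) (amin • p)] with x h1 h2 h3 h4
  have h5 : (ha.mulOp p : L2Vec D) x = a x • p x := h1
  rw [h4, Pi.sub_apply, h3, h5, Pi.smul_apply, ← sub_smul, real_inner_smul_left,
    real_inner_self_eq_norm_sq]
  have : 0 ≤ a x - amin := by linarith [h2.1]
  exact mul_nonneg this (sq_nonneg _)

end IsEllipticCoeff

theorem integral_mul_eq_inner (u v : L2 D) : ∫ x in D, u x * v x = ⟪u, v⟫_ℝ := by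
  rw [L2.inner_def]
  simp [mul_comm]

instance : CompleteSpace (H10 D) :=
  (Submodule.isClosed_topologicalClosure _).completeSpace_coe

/-- The value of an element of `H¹₀(D)`, as a continuous linear map. -/
def valueMap (D : Set (EuclideanSpace ℝ (Fin d))) : H10 D →L[ℝ] L2 D :=
  (WithLp.fstL 2 ℝ (L2 D) (L2Vec D)).comp (H10 D).subtypeL

/-- The gradient of an element of `H¹₀(D)`, as a continuous linear map. -/
def gradMap (D : Set (EuclideanSpace ℝ (Fin d))) : H10 D →L[ℝ] L2Vec D :=
  (WithLp.sndL 2 ℝ (L2 D) (L2Vec D)).comp (H10 D).subtypeL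

/-- The weak form of the elliptic operator. -/
def IsEllipticCoeff.weakForm (ha : IsEllipticCoeff D amin amax a) : H10 D →L[ℝ] H10 D →L[ℝ] ℝ :=
  (innerSL ℝ).bilinearComp (ha.mulOp.comp (gradMap D)) (gradMap D)

theorem IsEllipticCoeff.weakForm_apply (ha : IsEllipticCoeff D amin amax a) (w v : H10 D) :
    ha.weakForm w v = ⟪ha.mulOp (gradMap D w), gradMap D v⟫_ℝ := rfl

theorem norm_sq_H10 (w : H10 D) : ‖w‖ ^ 2 = ‖valueMap D w‖ ^ 2 + ‖gradMap D w‖ ^ 2 := by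
  exact WithLp.prod_norm_sq_eq_of_L2 (w : WithLp 2 (L2 D × L2Vec D))

/-- By the Poincaré inequality the gradient controls the full norm of `H10 D`, as Lax–Milgram
requires. -/
theorem IsEllipticCoeff.isCoercive (ha : IsEllipticCoeff D amin amax a) {C : ℝ}
    (hP : ∀ w : H10 D, ‖valueMap D w‖ ≤ C * ‖gradMap D w‖) : IsCoercive ha.weakForm := by
  refine ⟨amin / (C ^ 2 + 1), div_pos ha.pos (by positivity), fun w => ?_⟩
  have h1 := ha.le_inner_mulOp (gradMap D w)
  have h2 : ‖valueMap D w‖ ^ 2 ≤ (C * ‖gradMap D w‖) ^ 2 := by gcongr; exact hP w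
  have h3 : ‖w‖ ^ 2 ≤ (C ^ 2 + 1) * ‖gradMap D w‖ ^ 2 := by rw [norm_sq_H10]; nlinarith
  rw [ha.weakForm_apply]
  refine le_trans ?_ h1
  rw [mul_assoc, ← sq, div_mul_eq_mul_div, div_le_iff₀ (by positivity)]
  have := mul_le_mul_of_nonneg_left h3 ha.pos.le
  linarith

/-- The solution operator of the weak equation. -/
theorem IsEllipticCoeff.exists_solution (ha : IsEllipticCoeff D amin amax a) {C : ℝ}
    (hP : ∀ w : H10 D, ‖valueMap D w‖ ≤ C * ‖gradMap D w‖) :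
    ∃ W : L2 D →L[ℝ] H10 D, ∀ u v, ha.weakForm (W u) v = ⟪u, valueMap D v⟫_ℝ := by
  have hc := ha.isCoercive hP
  refine ⟨(hc.continuousLinearEquivOfBilin.symm : H10 D →L[ℝ] H10 D).comp
    (ContinuousLinearMap.adjoint (valueMap D)), fun u v => ?_⟩
  rw [← hc.continuousLinearEquivOfBilin_apply]
  simp [ContinuousLinearMap.adjoint_inner_left]

theorem isWeakSolution_iff (ha : IsEllipticCoeff D amin amax a) (u y : L2 D) :
    IsWeakSolution D a u y ↔
      ∃ w : H10 D, valueMap D w = y ∧ ∀ v, ha.weakForm w v = ⟪u, valueMap D v⟫_ℝ := by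
  constructor
  · rintro ⟨w, hw, rfl, h⟩
    refine ⟨⟨w, hw⟩, rfl, fun v => ?_⟩
    rw [ha.weakForm_apply, ha.inner_mulOp, ← integral_mul_eq_inner]
    exact h v v.2
  · rintro ⟨w, rfl, h⟩
    refine ⟨w, w.2, rfl, fun v hv => ?_⟩
    have := h ⟨v, hv⟩
    rwa [ha.weakForm_apply, ha.inner_mulOp, ← integral_mul_eq_inner] at this

theorem weakSolution_unique (ha : IsEllipticCoeff D amin amax a) {C : ℝ}
    (hP : ∀ w : H10 D, ‖valueMap D w‖ ≤ C * ‖gradMap D w‖) {u : L2 D} {w w' : H10 D}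
    (h : ∀ v, ha.weakForm w v = ⟪u, valueMap D v⟫_ℝ)
    (h' : ∀ v, ha.weakForm w' v = ⟪u, valueMap D v⟫_ℝ) : valueMap D w = valueMap D w' := by
  have h1 : ha.weakForm (w - w') (w - w') = 0 := by
    simp only [map_sub, sub_apply, h, h']
    ring
  have h2 := ha.le_inner_mulOp (gradMap D (w - w'))
  rw [← ha.weakForm_apply, h1] at h2
  have h3 : ‖gradMap D (w - w')‖ ^ 2 ≤ 0 := nonpos_of_mul_nonpos_right h2 ha.pos
  have h4 : ‖gradMap D (w - w')‖ = 0 := by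
    have := sq_nonneg ‖gradMap D (w - w')‖
    exact pow_eq_zero_iff (two_ne_zero) |>.1 (le_antisymm h3 this)
  have h5 := hP (w - w')
  rw [h4, mul_zero] at h5
  have h6 := norm_le_zero_iff.1 h5
  rwa [map_sub, sub_eq_zero] at h6

/-- `state` is defined by choice; uniqueness makes the choice irrelevant and turns it into a linear
operator. -/
theorem state_eq (ha : IsEllipticCoeff D amin amax a) {C : ℝ}
    (hP : ∀ w : H10 D, ‖valueMap D w‖ ≤ C * ‖gradMap D w‖) {u : L2 D} {w : H10 D}
    (h : ∀ v, ha.weakForm w v = ⟪u, valueMap D v⟫_ℝ) : state D a u = valueMap D w := by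
  have hex : ∃ y, IsWeakSolution D a u y := ⟨_, (isWeakSolution_iff ha u _).2 ⟨w, rfl, h⟩⟩
  rw [state, dif_pos hex]
  obtain ⟨w', hw', h'⟩ := (isWeakSolution_iff ha u _).1 hex.choose_spec
  rw [← hw']
  exact weakSolution_unique ha hP h' h

/-- The properties of the solution operator that depend on a single realization. -/
theorem IsEllipticCoeff.exists_stateOp (ha : IsEllipticCoeff D amin amax a) {C : ℝ} (hC : 0 ≤ C)
    (hP : ∀ w : H10 D, ‖valueMap D w‖ ≤ C * ‖gradMap D w‖) :
    ∃ S : L2 D →L[ℝ] L2 D, (∀ u, S u = state D a u) ∧ (∀ u v, ⟪S u, v⟫_ℝ = ⟪u, S v⟫_ℝ) ∧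
      (∀ u, ‖S u‖ ≤ C ^ 2 / amin * ‖u‖) ∧
      ∀ u, (∀ w : H10 D, 2 * ⟪u, valueMap D w⟫_ℝ - ha.weakForm w w ≤ ⟪S u, u⟫_ℝ) ∧
        ∃ w : H10 D, 2 * ⟪u, valueMap D w⟫_ℝ - ha.weakForm w w = ⟪S u, u⟫_ℝ := by
  obtain ⟨W, hW⟩ := ha.exists_solution hP
  have hcomm : ∀ w v, ha.weakForm w v = ha.weakForm v w := fun w v => ha.inner_mulOp_comm _ _
  refine ⟨(valueMap D).comp W, fun u => (state_eq ha hP (hW u)).symm, fun u v => ?_, fun u => ?_,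
    fun u => ⟨fun w => ?_, W u, ?_⟩⟩
  · simp only [ContinuousLinearMap.comp_apply]
    rw [real_inner_comm, ← hW v, hcomm, hW]
  · simp only [ContinuousLinearMap.comp_apply]
    -- Testing the equation with its own solution gives `amin‖∇y‖² ≤ ⟪u, y⟫ ≤ C‖u‖‖∇y‖`; a second
    -- use of Poincaré gives `C²/amin`.
    have h1 := ha.le_inner_mulOp (gradMap D (W u))
    rw [← ha.weakForm_apply, hW] at h1
    have h2 := real_inner_le_norm u (valueMap D (W u))
    have h3 := hP (W u)
    have h4 : ‖gradMap D (W u)‖ ≤ C * ‖u‖ / amin := by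
      rw [le_div_iff₀ ha.pos]
      rcases eq_or_ne ‖gradMap D (W u)‖ 0 with h0 | h0
      · rw [h0, zero_mul]; positivity
      · have hpos : 0 < ‖gradMap D (W u)‖ := lt_of_le_of_ne (norm_nonneg _) (Ne.symm h0)
        refine le_of_mul_le_mul_right ?_ hpos
        have h5 := mul_le_mul_of_nonneg_left h3 (norm_nonneg u)
        nlinarith
    refine h3.trans ((mul_le_mul_of_nonneg_left h4 hC).trans_eq ?_)
    ring
  · simp only [ContinuousLinearMap.comp_apply]
    -- Dirichlet's principle: the energy `2⟪u, w⟫ - a(w, w)` falls short of `⟪S u, u⟫` by `a(W u -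
    -- w, W u - w) ≥ 0`.
    have h1 := ha.le_inner_mulOp (gradMap D (W u - w))
    have h2 : 0 ≤ ha.weakForm (W u - w) (W u - w) :=
      le_trans (mul_nonneg ha.pos.le (sq_nonneg _)) h1
    simp only [map_sub, sub_apply, hW] at h2
    rw [hcomm w (W u), hW] at h2
    linarith [real_inner_comm u (valueMap D (W u))]
  · simp only [ContinuousLinearMap.comp_apply]
    rw [hW, real_inner_comm]
    ring

end Elliptic

/-! ### Measurability of the solution operator -/

section Measurability

/-- A weakly measurable function with values in a separable Hilbert space is measurable. -/
theorem measurable_of_inner {Ξ H : Type*} [MeasurableSpace Ξ] [NormedAddCommGroup H]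
    [InnerProductSpace ℝ H] [MeasurableSpace H] [BorelSpace H] [SecondCountableTopology H]
    {f : Ξ → H} (h : ∀ v, Measurable fun t => ⟪f t, v⟫_ℝ) : Measurable f := by
  have hball : ∀ (c : H) (r : ℝ), 0 ≤ r → MeasurableSet (f ⁻¹' Metric.closedBall c r) := by
    intro c r hr
    -- The norm of `f t - c` is tested by inner products, and a countable dense set of test vectors
    -- suffices.
    have heq : f ⁻¹' Metric.closedBall c r
        = ⋂ n, {t | ⟪f t, TopologicalSpace.denseSeq H n⟫_ℝ - ⟪c, TopologicalSpace.denseSeq H n⟫_ℝ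
          ≤ r * ‖TopologicalSpace.denseSeq H n‖} := by
      ext t
      simp only [mem_preimage, Metric.mem_closedBall, dist_eq_norm, mem_iInter, mem_ofPred_eq,
        ← inner_sub_left]
      constructor
      · intro ht n
        exact (real_inner_le_norm _ _).trans (mul_le_mul_of_nonneg_right ht (norm_nonneg _))
      · intro ht
        have hcl : IsClosed {v : H | ⟪f t - c, v⟫_ℝ ≤ r * ‖v‖} :=
          isClosed_le (by fun_prop) (by fun_prop)
        have h1 : f t - c ∈ {v : H | ⟪f t - c, v⟫_ℝ ≤ r * ‖v‖} :=
          closure_minimal (by rintro _ ⟨n, rfl⟩; exact ht n) hcl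
            (TopologicalSpace.denseRange_denseSeq H (f t - c))
        rw [mem_ofPred_eq, real_inner_self_eq_norm_sq] at h1
        rcases eq_or_ne ‖f t - c‖ 0 with h0 | h0
        · rwa [h0]
        · have hpos : 0 < ‖f t - c‖ := lt_of_le_of_ne (norm_nonneg _) (Ne.symm h0)
          refine le_of_mul_le_mul_right ?_ hpos
          linarith
    rw [heq]
    exact MeasurableSet.iInter fun n =>
      measurableSet_le ((h _).sub_const _) measurable_const
  refine measurable_of_isOpen fun U hU => ?_
  have heq : f ⁻¹' U = ⋃ (p : ℕ × ℕ) (_ : Metric.closedBall (TopologicalSpace.denseSeq H p.1)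
      (1 / ((p.2 : ℝ) + 1)) ⊆ U), f ⁻¹' Metric.closedBall (TopologicalSpace.denseSeq H p.1)
      (1 / ((p.2 : ℝ) + 1)) := by
    ext t
    simp only [mem_preimage, mem_iUnion, exists_prop]
    constructor
    · intro ht
      obtain ⟨ε, hε, hb⟩ := Metric.isOpen_iff.1 hU _ ht
      obtain ⟨k, hk⟩ := exists_nat_one_div_lt (half_pos hε)
      obtain ⟨n, hn⟩ := (TopologicalSpace.denseRange_denseSeq H).exists_dist_lt (f t)
        (Nat.one_div_pos_of_nat (α := ℝ) (n := k))
      refine ⟨(n, k), fun y hy => hb ?_, hn.le⟩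
      rw [Metric.mem_closedBall] at hy
      rw [Metric.mem_ball]
      have h1 := dist_triangle y (TopologicalSpace.denseSeq H n) (f t)
      rw [dist_comm] at hn
      linarith
    · rintro ⟨p, hp, ht⟩
      exact hp ht
  rw [heq]
  exact MeasurableSet.iUnion fun p => MeasurableSet.iUnion fun _ => hball _ _ (by positivity)

/-- An attained supremum of a family of measurable functions that depends continuously on a
parameter in a separable space is measurable. -/
theorem measurable_of_attained_sup {Ξ V : Type*} [MeasurableSpace Ξ] [TopologicalSpace V]
    [TopologicalSpace.SeparableSpace V] [Nonempty V] {Q : Ξ → V → ℝ} {φ : Ξ → ℝ}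
    (hcont : ∀ t, Continuous (Q t)) (hmeas : ∀ w, Measurable fun t => Q t w)
    (hle : ∀ t w, Q t w ≤ φ t) (hmax : ∀ t, ∃ w, Q t w = φ t) : Measurable φ := by
  refine measurable_of_Ioi fun r => ?_
  have heq : φ ⁻¹' Ioi r = ⋃ n, {t | r < Q t (TopologicalSpace.denseSeq V n)} := by
    ext t
    simp only [mem_preimage, mem_Ioi, mem_iUnion, mem_ofPred_eq]
    constructor
    · intro ht
      obtain ⟨w, hw⟩ := hmax t
      have hopen : IsOpen {w | r < Q t w} := isOpen_lt continuous_const (hcont t)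
      obtain ⟨n, hn⟩ := (TopologicalSpace.denseRange_denseSeq V).exists_mem_open hopen
        ⟨w, by rw [mem_ofPred_eq, hw]; exact ht⟩
      exact ⟨n, hn⟩
    · rintro ⟨n, hn⟩
      exact hn.trans_le (hle t _)
  rw [heq]
  exact MeasurableSet.iUnion fun n => measurableSet_lt measurable_const (hmeas _)

variable {d : ℕ} {D : Set (EuclideanSpace ℝ (Fin d))} {amin amax : ℝ} {Ξ : Type*}
  [MeasurableSpace Ξ] {A : EuclideanSpace ℝ (Fin d) → Ξ → ℝ}

instance : SecondCountableTopology (L2 D) :=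
  have : Fact ((2 : ENNReal) ≠ ⊤) := ⟨by simp⟩
  inferInstance

instance : SecondCountableTopology (L2Vec D) :=
  have : Fact ((2 : ENNReal) ≠ ⊤) := ⟨by simp⟩
  inferInstance

instance : TopologicalSpace.SeparableSpace (H10 D) :=
  have : SecondCountableTopology (H10 D) :=
    TopologicalSpace.Subtype.secondCountableTopology (H10 D : Set (WithLp 2 (L2 D × L2Vec D)))
  TopologicalSpace.SecondCountableTopology.to_separableSpace

theorem measurable_weakForm [SFinite (volume.restrict D)] (hA : Measurable (Function.uncurry A))
    (ha : ∀ t, IsEllipticCoeff D amin amax fun x => A x t) (w : H10 D) :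
    Measurable fun t => (ha t).weakForm w w := by
  simp only [IsEllipticCoeff.weakForm_apply, IsEllipticCoeff.inner_mulOp]
  have hw := (Lp.stronglyMeasurable (gradMap D w)).measurable
  have h1 : Measurable (Function.uncurry fun (t : Ξ) (x : EuclideanSpace ℝ (Fin d)) =>
      A x t * ⟪gradMap D w x, gradMap D w x⟫_ℝ) := by
    have h2 : Measurable fun p : Ξ × EuclideanSpace ℝ (Fin d) => A p.2 p.1 :=
      hA.comp (measurable_snd.prodMk measurable_fst)
    have h3 : Measurable fun p : Ξ × EuclideanSpace ℝ (Fin d) => gradMap D w p.2 :=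
      hw.comp measurable_snd
    exact h2.mul (h3.inner h3)
  exact h1.stronglyMeasurable.integral_prod_right.measurable

/-- Measurability in `t` does not follow from Lax–Milgram. By Dirichlet's principle `⟪S t u, u⟫` is
an attained supremum of energies that are continuous in `w` and measurable in `t`; symmetry and
polarization give `⟪S t u, v⟫`, and weak measurability implies measurability. -/
theorem exists_stateOps [MeasurableSpace (L2 D)] [BorelSpace (L2 D)]
    (hA : Measurable (Function.uncurry A))
    (ha : ∀ t, IsEllipticCoeff D amin amax fun x => A x t) {C : ℝ} (hC : 0 ≤ C)
    (hP : ∀ w : H10 D, ‖valueMap D w‖ ≤ C * ‖gradMap D w‖) :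
    ∃ S : Ξ → L2 D →L[ℝ] L2 D, (∀ t u, S t u = state D (fun x => A x t) u) ∧
      (∀ t u v, ⟪S t u, v⟫_ℝ = ⟪u, S t v⟫_ℝ) ∧ (∀ t u, ‖S t u‖ ≤ C ^ 2 / amin * ‖u‖) ∧
      ∀ u, Measurable fun t => S t u := by
  choose S hS1 hS2 hS3 hS4 using fun t => (ha t).exists_stateOp hC hP
  refine ⟨S, hS1, hS2, hS3, fun u => ?_⟩
  have hdiag : ∀ u, Measurable fun t => ⟪S t u, u⟫_ℝ := fun u =>
    measurable_of_attained_sup (V := H10 D)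
      (Q := fun t w => 2 * ⟪u, valueMap D w⟫_ℝ - (ha t).weakForm w w) (fun t => by fun_prop)
      (fun w => (measurable_weakForm hA ha w).const_sub _) (fun t => (hS4 t u).1)
      fun t => (hS4 t u).2
  refine measurable_of_inner fun v => ?_
  have hpol : ∀ t, ⟪S t u, v⟫_ℝ
      = 1 / 4 * (⟪S t (u + v), u + v⟫_ℝ - ⟪S t (u - v), u - v⟫_ℝ) := by
    intro t
    simp only [map_add, map_sub, inner_add_left, inner_add_right, inner_sub_left, inner_sub_right]
    rw [hS2 t v u, real_inner_comm (S t u) v]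
    ring
  simp only [hpol]
  exact ((hdiag _).sub (hdiag _)).const_mul _

end Measurability

/-! ### The tail bound in the two parameter regimes, in Hilbert space. -/

section Cases

variable {L μ ρ η : ℝ}

theorem phi_eq (hμ1 : μ < 1) (t : ℝ) :
    phi L μ ρ η t = (η - μ * ρ / (1 - μ) - L / t)⁻¹ := by
  have h : (1 - μ) ≠ 0 := by linarith
  have h2 : η * (1 - μ) - μ * ρ - t⁻¹ * L * (1 - μ)
      = (1 - μ) * (η - μ * ρ / (1 - μ) - L / t) := by
    field_simp
  rw [phi, h2, div_mul_eq_div_div, div_self h, one_div]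

/-- The choice of `κ` is made for this: `θ_{2κ} ≥ κ + 1` exceeds `L(1 - μ)/(η(1 - μ) - ρμ)`, so the
denominator of `φ` is positive. -/
theorem phi_kappa_pos (hμ1 : μ < 1) (hη : ρ * μ < η * (1 - μ)) :
    0 < phi L μ ρ η (nesterovTheta (2 * kappa L μ ρ η)) := by
  have h1 : 0 < 1 - μ := by linarith
  have h2 : 0 < η * (1 - μ) - ρ * μ := by linarith
  have h3 : L * (1 - μ) / (η * (1 - μ) - ρ * μ) ≤ kappa L μ ρ η := Nat.le_ceil _
  have h4 := nesterovTheta_ge (2 * kappa L μ ρ η)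
  push_cast at h4
  have h5 := nesterovTheta_pos (2 * kappa L μ ρ η)
  set t := nesterovTheta (2 * kappa L μ ρ η)
  have h6 : L * (1 - μ) / (η * (1 - μ) - ρ * μ) < t := by linarith
  rw [div_lt_iff₀ h2] at h6
  rw [phi]
  refine div_pos h1 ?_
  have h7 : t⁻¹ * L * (1 - μ) < η * (1 - μ) - ρ * μ := by
    rw [mul_assoc, inv_mul_lt_iff₀ h5]
    exact h6
  linarith

theorem kappa_pos (hL : 0 < L) (hμ1 : μ < 1) (hη : ρ * μ < η * (1 - μ)) :
    0 < kappa L μ ρ η :=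
  Nat.ceil_pos.2 (div_pos (mul_pos hL (by linarith)) (by linarith))

variable {H : Type*} [NormedAddCommGroup H] [InnerProductSpace ℝ H] [CompleteSpace H]
  [MeasurableSpace H] [BorelSpace H] [SecondCountableTopology H]
  {Ω Ξ : Type*} [mΩ : MeasurableSpace Ω] [MeasurableSpace Ξ] {P : Measure Ω} [IsProbabilityMeasure P]
  {ν : Measure Ξ} [IsProbabilityMeasure ν] {m : ℕ → ℕ} {X : (k : ℕ) → Fin (m k) → Ω → Ξ}
  {S : Ξ → H →L[ℝ] H} {yd : H} {g : H → ℝ} {Uad : Set H} {α C : ℝ}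
  {v₀ s₀ l₀ : H} {u v z s lam psi : ℕ → Ω → H} {ust zst lst : H}

/-- The tail bounds with the accelerated weights in the strongly convex case. -/
theorem IsADMMRun.tail_strongly_convex
    (hr : IsADMMRun (trackingCost S yd α) g Uad m X μ (fun k => ρ * nesterovTheta k)
      (fun k => η * nesterovTheta k) nesterovTheta v₀ s₀ l₀ u v z s lam psi)
    (hμ0 : 0 < μ) (hμ1 : μ < 1) (hρ : 0 < ρ) (hη0 : 0 < η) (hα : 0 < α) (hρη : ρ + η ≤ α)
    (hη : ρ * μ < η * (1 - μ))
    (hS : ∀ t x y, ⟪S t x, y⟫_ℝ = ⟪x, S t y⟫_ℝ) (hC : ∀ t x, ‖S t x‖ ≤ C * ‖x‖) (hC0 : 0 ≤ C)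
    (hmeas : ∀ x, Measurable fun t => S t x)
    (hU : Convex ℝ Uad) (hv₀ : v₀ ∈ Uad) (hg : ConvexOn ℝ univ g)
    (hstar : IsSaddlePoint (fun x => ∫ t, trackingCost S yd α x t ∂ν) g Uad ust zst lst)
    {R N : ℝ} (hR : ∀ x ∈ Uad, ∀ y ∈ Uad, ‖x - y‖ ≤ R) (hN : ∀ x ∈ Uad, ‖x‖ ≤ N)
    (hX : ∀ k i, Measurable (X k i))
    (hind : iIndepFun (fun p : (k : ℕ) × Fin (m k) => X p.1 p.2) P)
    (hν : ∀ k i, P.map (X k i) = ν) (hm : ∀ k, 0 < m k) {M : ℝ} (hM : 0 < M)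
    (hsum : HasSum (fun k => 1 / (m k : ℝ)) (1 / M))
    {c : ℝ} (hc0 : 0 < c) (hc : 2 * ‖lst‖ ≤ c)
    {B Γ c₄ δ : ℝ} {K : ℕ} (hK : 1 ≤ K) (hδ : 0 < δ) (hB : B = C ^ 2 * N + C * ‖yd‖)
    (hc₄0 : 0 ≤ c₄) (hc₄ : 8 * (B * R) ^ 2 / M ≤ c₄ ^ 2) (hL : L = α + C ^ 2)
    (hΓ : Γ = 8 * phi L μ ρ η (nesterovTheta (2 * kappa L μ ρ η)) * B ^ 2 / M
      + 2 * R ^ 2 * L * nesterovTheta (2 * kappa L μ ρ η - 1) ^ 2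
      + 4 * (‖l₀‖ ^ 2 + c ^ 2) / (μ * ρ)) :
    1 - (1 / (K : ℝ)) ^ (δ ^ 2 / 3) ≤ P.real {ω |
      ∫ t, trackingCost S yd α (u K ω) t ∂ν + g (z K ω) - ∫ t, trackingCost S yd α ust t ∂ν - g zst
        < Γ / (K : ℝ) ^ 2 + δ * c₄ * √(Real.log K) / K} ∧
    1 - (1 / (K : ℝ)) ^ (δ ^ 2 / 3) ≤ P.real {ω |
      ‖u K ω - z K ω‖ < 2 * (Γ / (K : ℝ) ^ 2 + δ * c₄ * √(Real.log K) / K) / c} := by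
  have hL0 : 0 < L := by rw [hL]; positivity
  have hφ := phi_kappa_pos (L := L) hμ1 hη
  have hκ := kappa_pos hL0 hμ1 hη
  set n := 2 * kappa L μ ρ η with hn
  set φ := phi L μ ρ η (nesterovTheta n) with hφdef
  have hw := stepWeights_nesterov ρ
  have hR0 : 0 ≤ R := (norm_nonneg _).trans (hR _ hv₀ _ hv₀)
  obtain ⟨j, rfl⟩ : ∃ j, K = j + 1 := ⟨K - 1, by omega⟩
  have hK0 : (0 : ℝ) < ((j + 1 : ℕ) : ℝ) := by positivity
  have hTK : ((j + 1 : ℕ) : ℝ) ^ 2 ≤ 4 * ∑ i ∈ Finset.range (j + 1), nesterovTheta i := by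
    rw [sum_nesterovTheta]
    have h1 := nesterovTheta_ge j
    have h2 : ((j + 1 : ℕ) : ℝ) ≤ 2 * nesterovTheta j := by push_cast; linarith
    have h3 : ((j + 1 : ℕ) : ℝ) ^ 2 ≤ (2 * nesterovTheta j) ^ 2 := by gcongr
    linarith
  have hT0 : 0 < ∑ i ∈ Finset.range (j + 1), nesterovTheta i := hw.succ_pos j
  have hphi : φ⁻¹ = η - μ * ρ / (1 - μ) - L / nesterovTheta n := by
    rw [hφdef, phi_eq hμ1, inv_inv]
  have he : 0 < η - μ * ρ / (1 - μ) := by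
    rw [sub_pos, div_lt_iff₀ (by linarith)]
    linarith
  -- For `k ≥ n = 2κ` monotonicity gives `L ≤ L θ_k / θ_n`, and the proximal term dominates. For `k
  -- < n` the excess is at most `L/2 · R²`, collected in `rest`, with weighted sum at most `L/2 · R²
  -- θ_{n-1}²`. As `W` one may take `T K`, because `θ_k²` is itself the partial sum of the weights
  -- through index `k`.
  refine hr.tail hw (fun k => mul_pos hη0 (nesterovTheta_pos k)) hμ0 hμ1 hρ hα.le hS hC hC0 hmeas hU
    hv₀ hg hstar hR hN hX hind hν hm hM hsum hc0 hc
    (rest := fun k => if k < n then L / 2 * R ^ 2 else 0) hφ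
    (q := fun k => nesterovTheta k * φ⁻¹)
    (fun k => by rw [mul_left_comm, mul_inv_cancel₀ hφ.ne', mul_one]) ?_
    (A := L / 2 * R ^ 2 * nesterovTheta (n - 1) ^ 2) hK hδ hB hc₄0 hc₄ ?_
    (W := ∑ i ∈ Finset.range (j + 1), nesterovTheta i) ?_ ?_ ?_
  · intro k d hd0 hdR
    have hθ := nesterovTheta_pos k
    have hθn := nesterovTheta_pos n
    have h1 : μ * (ρ * nesterovTheta k) / (1 - μ) = nesterovTheta k * (μ * ρ / (1 - μ)) := by ring
    rw [← hL, hphi, h1]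
    have h3 : nesterovTheta k * (L / nesterovTheta n) = L * (nesterovTheta k / nesterovTheta n) := by
      ring
    by_cases hk : k < n
    · simp only [hk, if_true]
      have h2 : d ^ 2 ≤ R ^ 2 := by gcongr
      have h4 := mul_le_mul_of_nonneg_left h2 hL0.le
      have h5 : 0 ≤ nesterovTheta k * (L / nesterovTheta n) * d ^ 2 := by positivity
      linarith
    · simp only [hk, if_false]
      have h2 : 1 ≤ nesterovTheta k / nesterovTheta n := by
        rw [one_le_div hθn]
        exact nesterovTheta_mono (not_lt.1 hk)
      have h4 : L * 1 ≤ L * (nesterovTheta k / nesterovTheta n) :=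
        mul_le_mul_of_nonneg_left h2 hL0.le
      rw [← h3] at h4
      have h5 := mul_le_mul_of_nonneg_right h4 (sq_nonneg d)
      linarith
  · intro x hx _
    have h1 := telescope_nesterov_le hρη hx (j + 1)
    have h2 : 0 ≤ (ρ + η) / 2 * (∑ i ∈ Finset.range (j + 1), nesterovTheta i) * x (j + 1) :=
      mul_nonneg (by positivity) (hx _)
    have h3 := sum_range_ite_le (f := fun k => nesterovTheta k * (L / 2 * R ^ 2))
      (fun k => mul_nonneg (nesterovTheta_pos k).le (by positivity)) n (j + 1)
    -- Positivity of `κ` keeps the natural subtraction in `θ_{2κ-1}` honest.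
    have hn1 : n = (n - 1) + 1 := by omega
    rw [← Finset.sum_mul] at h3
    have h4 : ∑ k ∈ Finset.range n, nesterovTheta k = nesterovTheta (n - 1) ^ 2 := by
      conv_lhs => rw [hn1]
      exact sum_nesterovTheta _
    rw [h4] at h3
    have h5 : ∑ k ∈ Finset.range (j + 1), nesterovTheta k *
        ((ρ * nesterovTheta k + η * nesterovTheta k) / 2 * (x k - x (k + 1)) - α / 2 * x k
          + if k < n then L / 2 * R ^ 2 else 0)
        = ∑ k ∈ Finset.range (j + 1), nesterovTheta k *
          ((ρ + η) * nesterovTheta k / 2 * (x k - x (k + 1)) - α / 2 * x k)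
        + ∑ k ∈ Finset.range (j + 1),
          (if k < n then nesterovTheta k * (L / 2 * R ^ 2) else 0) := by
      rw [← Finset.sum_add_distrib]
      refine Finset.sum_congr rfl fun k _ => ?_
      split_ifs <;> ring
    rw [h5]
    linarith
  · intro k hk
    rw [← sum_nesterovTheta]
    exact Finset.sum_le_sum_of_subset_of_nonneg (Finset.range_mono (by omega))
      fun i _ _ => (nesterovTheta_pos i).le
  · have := mul_le_mul_of_nonneg_left hTK hT0.le
    linarith
  · rw [hΓ]
    have h1 : 0 ≤ 8 * φ * B ^ 2 / M + 2 * R ^ 2 * L * nesterovTheta (n - 1) ^ 2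
        + 4 * (‖l₀‖ ^ 2 + c ^ 2) / (μ * ρ) := by positivity
    rw [mul_div_assoc', le_div_iff₀ (by positivity)]
    have h2 := mul_le_mul_of_nonneg_right hTK h1
    -- The deterministic terms are exactly a quarter of `Γ`, matching `T K ≥ K²/4`.
    have h3 : (L / 2 * R ^ 2 * nesterovTheta (n - 1) ^ 2 + 2 * φ * B ^ 2 / M
        + (‖l₀‖ ^ 2 + c ^ 2) / (μ * ρ)) = 1 / 4 * (8 * φ * B ^ 2 / M
        + 2 * R ^ 2 * L * nesterovTheta (n - 1) ^ 2 + 4 * (‖l₀‖ ^ 2 + c ^ 2) / (μ * ρ)) := by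
      ring
    rw [h3]
    linarith

/-- The tail bounds with constant parameters in the general convex case. -/
theorem IsADMMRun.tail_convex
    (hr : IsADMMRun (trackingCost S yd α) g Uad m X μ (fun _ => ρ) (fun _ => η)
      (fun k => (k : ℝ) + 1) v₀ s₀ l₀ u v z s lam psi)
    (hμ0 : 0 < μ) (hμ1 : μ < 1) (hρ : 0 < ρ) (hη0 : 0 < η) (hα : 0 ≤ α)
    (hη : μ * ρ / (1 - μ) + L < η)
    (hS : ∀ t x y, ⟪S t x, y⟫_ℝ = ⟪x, S t y⟫_ℝ) (hC : ∀ t x, ‖S t x‖ ≤ C * ‖x‖) (hC0 : 0 ≤ C)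
    (hmeas : ∀ x, Measurable fun t => S t x)
    (hU : Convex ℝ Uad) (hv₀ : v₀ ∈ Uad) (hg : ConvexOn ℝ univ g)
    (hstar : IsSaddlePoint (fun x => ∫ t, trackingCost S yd α x t ∂ν) g Uad ust zst lst)
    {R N : ℝ} (hR : ∀ x ∈ Uad, ∀ y ∈ Uad, ‖x - y‖ ≤ R) (hN : ∀ x ∈ Uad, ‖x‖ ≤ N)
    (hX : ∀ k i, Measurable (X k i))
    (hind : iIndepFun (fun p : (k : ℕ) × Fin (m k) => X p.1 p.2) P)
    (hν : ∀ k i, P.map (X k i) = ν) (hm : ∀ k, 0 < m k) {M : ℝ} (hM : 0 < M)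
    (hsum : HasSum (fun k => 1 / (m k : ℝ)) (1 / M))
    {c : ℝ} (hc0 : 0 < c) (hc : 2 * ‖lst‖ ≤ c)
    {B Γ c₄ δ : ℝ} {K : ℕ} (hK : 1 ≤ K) (hδ : 0 < δ) (hB : B = C ^ 2 * N + C * ‖yd‖)
    (hc₄0 : 0 ≤ c₄) (hc₄ : 8 * (B * R) ^ 2 / M ≤ c₄ ^ 2) (hL : L = α + C ^ 2)
    (hΓ : Γ = 2 * phi L μ ρ η 1 * B ^ 2 / M + (η + ρ) / 2 * ‖v₀ - ust‖ ^ 2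
      + (‖l₀‖ ^ 2 + c ^ 2) / (μ * ρ)) :
    1 - (1 / (K : ℝ)) ^ (δ ^ 2 / 3) ≤ P.real {ω |
      ∫ t, trackingCost S yd α (u K ω) t ∂ν + g (z K ω) - ∫ t, trackingCost S yd α ust t ∂ν - g zst
        < Γ / K + δ * c₄ * √(Real.log K) / K} ∧
    1 - (1 / (K : ℝ)) ^ (δ ^ 2 / 3) ≤ P.real {ω |
      ‖u K ω - z K ω‖ < 2 * (Γ / K + δ * c₄ * √(Real.log K) / K) / c} := by
  set φ := phi L μ ρ η 1 with hφdef
  have hphi : φ⁻¹ = η - μ * ρ / (1 - μ) - L := by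
    rw [hφdef, phi_eq hμ1, inv_inv, div_one]
  have hφ : 0 < φ := inv_pos.1 (by rw [hphi]; linarith)
  have hK0 : (0 : ℝ) < K := by exact_mod_cast hK
  -- Here `η` exceeds `μρ/(1 - μ) + L` from the start, so no iteration needs a remainder. The
  -- quadratic coefficient equals `-φ⁻¹/2` exactly.
  refine hr.tail (stepWeights_const ρ) (fun _ => hη0) hμ0 hμ1 hρ hα hS hC hC0 hmeas hU
    hv₀ hg hstar hR hN hX hind hν hm hM hsum hc0 hc (rest := fun _ => 0) hφ (q := fun _ => φ⁻¹)
    (fun _ => (mul_inv_cancel₀ hφ.ne').symm) ?_ (A := (η + ρ) / 2 * ‖v₀ - ust‖ ^ 2)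
    hK hδ hB hc₄0 hc₄ ?_ (W := 1) (fun _ _ => by norm_num) ?_ ?_
  · intro k d _ _
    rw [← hL, hphi]
    linarith
  · intro x hx hx0
    have h1 : ∑ k ∈ Finset.range K, 1 * ((ρ + η) / 2 * (x k - x (k + 1)) - α / 2 * x k + 0)
        ≤ ∑ k ∈ Finset.range K, (ρ + η) / 2 * (x k - x (k + 1)) := by
      refine Finset.sum_le_sum fun k _ => ?_
      have : 0 ≤ α / 2 * x k := mul_nonneg (by positivity) (hx k)
      linarith
    refine h1.trans ?_
    rw [← Finset.mul_sum, Finset.sum_range_sub', hx0]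
    have : 0 ≤ (ρ + η) / 2 * x K := mul_nonneg (by positivity) (hx K)
    linarith
  · have : 0 ≤ (K : ℝ) ^ 2 := by positivity
    linarith
  · rw [hΓ, mul_div_cancel₀ _ hK0.ne']
    linarith

end Cases

/-! ### The control problem -/

section Control

variable {d : ℕ} {D : Set (EuclideanSpace ℝ (Fin d))} {umin umax : ℝ}

theorem convex_admissible : Convex ℝ (admissible D umin umax) := by
  intro x hx y hy a b ha hb hab
  filter_upwards [hx, hy, Lp.coeFn_add (a • x) (b • y), Lp.coeFn_smul a x, Lp.coeFn_smul b y]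
    with t h1 h2 h3 h4 h5
  rw [h3, Pi.add_apply, h4, h5, Pi.smul_apply, Pi.smul_apply, smul_eq_mul, smul_eq_mul]
  constructor
  · have e1 := mul_le_mul_of_nonneg_left h1.1 ha
    have e2 := mul_le_mul_of_nonneg_left h2.1 hb
    have e3 : a * umin + b * umin = umin := by rw [← add_mul, hab, one_mul]
    linarith
  · have e1 := mul_le_mul_of_nonneg_left h1.2 ha
    have e2 := mul_le_mul_of_nonneg_left h2.2 hb
    have e3 : a * umax + b * umax = umax := by rw [← add_mul, hab, one_mul]
    linarith

theorem norm_le_of_ae_bound [IsFiniteMeasure (volume.restrict D)] {x : L2 D} {C : ℝ} (hC : 0 ≤ C)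
    (h : ∀ᵐ t ∂(volume.restrict D), |x t| ≤ C) : ‖x‖ ≤ √(volume.real D) * C := by
  refine abs_le_of_sq_le_sq' ?_ (by positivity) |>.2
  rw [norm_sq_eq_integral, mul_pow, Real.sq_sqrt measureReal_nonneg]
  have h1 : ∫ t in D, ‖x t‖ ^ 2 ≤ ∫ _ in D, C ^ 2 := by
    refine integral_mono_of_nonneg (Filter.Eventually.of_forall fun t => by positivity)
      (integrable_const _) ?_
    filter_upwards [h] with t ht
    have : ‖x t‖ ≤ C := ht
    gcongr
  refine h1.trans_eq ?_
  simp

theorem norm_sub_le_of_admissible [IsFiniteMeasure (volume.restrict D)] (hu : umin ≤ umax)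
    {x y : L2 D} (hx : x ∈ admissible D umin umax) (hy : y ∈ admissible D umin umax) :
    ‖x - y‖ ≤ √(volume.real D) * (umax - umin) := by
  refine norm_le_of_ae_bound (by linarith) ?_
  filter_upwards [hx, hy, Lp.coeFn_sub x y] with t h1 h2 h3
  rw [h3, Pi.sub_apply, abs_sub_le_iff]
  constructor <;> linarith [h1.1, h1.2, h2.1, h2.2]

theorem norm_le_of_admissible [IsFiniteMeasure (volume.restrict D)]
    {x : L2 D} (hx : x ∈ admissible D umin umax) :
    ‖x‖ ≤ √(volume.real D) * max |umin| |umax| := by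
  refine norm_le_of_ae_bound (le_max_of_le_left (abs_nonneg _)) ?_
  filter_upwards [hx] with t h1
  exact abs_le_max_abs_abs h1.1 h1.2

theorem convexOn_l1Cost [IsFiniteMeasure (volume.restrict D)] {β : ℝ} (hβ : 0 ≤ β) :
    ConvexOn ℝ univ (l1Cost D β) := by
  refine ⟨convex_univ, fun x _ y _ a b ha hb _ => ?_⟩
  have hint : ∀ x : L2 D, Integrable (fun t => |x t|) (volume.restrict D) := fun x =>
    ((Lp.memLp x).integrable (by norm_num)).abs
  have h1 : ∫ t in D, |(a • x + b • y : L2 D) t| ≤ ∫ t in D, (a * |x t| + b * |y t|) := by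
    refine integral_mono_ae (hint _) (((hint x).const_mul a).add ((hint y).const_mul b)) ?_
    filter_upwards [Lp.coeFn_add (a • x) (b • y), Lp.coeFn_smul a x, Lp.coeFn_smul b y]
      with t h3 h4 h5
    rw [h3, Pi.add_apply, h4, h5, Pi.smul_apply, Pi.smul_apply, smul_eq_mul, smul_eq_mul]
    refine (abs_add_le _ _).trans_eq ?_
    rw [abs_mul, abs_mul, abs_of_nonneg ha, abs_of_nonneg hb]
  rw [integral_add ((hint x).const_mul a) ((hint y).const_mul b), integral_const_mul,
    integral_const_mul] at h1
  have h2 := mul_le_mul_of_nonneg_left h1 hβ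
  simp only [l1Cost, smul_eq_mul]
  linarith

theorem constC4_nonneg {amin : ℝ} (hamin : 0 < amin) (hu : umin ≤ umax) (yd : L2 D) (M : ℝ) :
    0 ≤ constC4 D amin umin umax yd M := by
  have h1 : 0 ≤ umax - umin := by linarith
  have h2 : 0 ≤ max |umin| |umax| := le_max_of_le_left (abs_nonneg _)
  have h3 := poincareConst_nonneg (D := D)
  rw [constC4, constB1]
  positivity

/-- Of the factor `1 - e⁻²` in `constC4` only positivity and the bound by `1` are needed. -/
theorem le_constC4_sq {amin M : ℝ} (hM : 0 < M) (yd : L2 D) :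
    8 * (constB1 D amin umin umax yd * (√(volume.real D) * (umax - umin))) ^ 2 / M
      ≤ constC4 D amin umin umax yd M ^ 2 := by
  have h1 : 0 < 1 - Real.exp (-2) := by
    have : Real.exp (-2) < 1 := Real.exp_lt_one_iff.2 (by norm_num)
    linarith
  have h2 : 1 - Real.exp (-2) ≤ 1 := by linarith [Real.exp_pos (-2)]
  have h3 : 0 ≤ volume.real D := measureReal_nonneg
  rw [constC4, mul_pow _ (√_), Real.sq_sqrt (by positivity), mul_pow (constB1 D amin umin umax yd),
    mul_pow (√_), Real.sq_sqrt h3, ← mul_div_assoc]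
  have h4 : (1 - Real.exp (-2)) * M ≤ M := by nlinarith
  have h5 : 8 * (constB1 D amin umin umax yd ^ 2 * (volume.real D * (umax - umin) ^ 2))
      = (2 * (umax - umin) * constB1 D amin umin umax yd) ^ 2 * (2 * volume.real D) := by ring
  rw [h5]
  exact div_le_div_of_nonneg_left (by positivity) (by positivity) h4

end Control

end

/-! ### The theorem for the control problem. -/

theorem theorem4
    -- the domain
    {d : ℕ} (hd : 1 ≤ d) (D : Set (EuclideanSpace ℝ (Fin d)))
    (hDo : IsOpen D) (hDb : Bornology.IsBounded D) (hDn : D.Nonempty)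
    -- the random input and the random diffusion coefficient
    {Ω Ξ : Type*} [MeasurableSpace Ω] [MeasurableSpace Ξ]
    (P : Measure Ω) [IsProbabilityMeasure P] (ξ : Ω → Ξ) (hξ : Measurable ξ)
    (a : EuclideanSpace ℝ (Fin d) → Ξ → ℝ) (ha : Measurable (Function.uncurry a))
    (amin amax : ℝ) (hamin : 0 < amin)
    (habd : ∀ x ∈ D, ∀ t, amin < a x t ∧ a x t < amax)
    -- the data of the control problem
    (yd : L2 D) (α β umin umax : ℝ) (hβ : 0 ≤ β) (hu : umin ≤ umax)
    -- the batch sizes and the samples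
    (m : ℕ → ℕ) (hm : ∀ k, 1 < m k) (M : ℝ) (hM : 0 < M)
    (hsum : HasSum (fun k => 1 / (m k : ℝ)) (1 / M))
    (X : (k : ℕ) → Fin (m k) → Ω → Ξ) (hXm : ∀ k i, Measurable (X k i))
    (hXind : iIndepFun (fun p : (k : ℕ) × Fin (m k) => X p.1 p.2) P)
    (hXid : ∀ k i, IdentDistrib (X k i) ξ P P)
    -- the parameters and the initial points of the algorithm
    (μ ρ η : ℝ) (hμ0 : 0 < μ) (hμ1 : μ < 1) (hρ : 0 < ρ) (hη : 0 < η)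
    (v₀ s₀ l₀ : L2 D) (hv₀ : v₀ ∈ admissible D umin umax)
    (u v z s lam psi : ℕ → Ω → L2 D)
    -- the optimal solution and the optimal multiplier
    (ustar zstar lstar : L2 D)
    (hstar : IsSaddlePoint (expectedCost P ξ D a yd α) (l1Cost D β) (admissible D umin umax)
      ustar zstar lstar)
    (c : ℝ) (hc0 : 0 < c) (hc : 2 * ‖lstar‖ ≤ c) :
    -- (a) the strongly convex case
    (0 < α → ρ + η ≤ α → ρ * μ < η * (1 - μ) →
      IsADMMRun (smoothCost D a yd α) (l1Cost D β) (admissible D umin umax) m X μ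
        (fun k => ρ * nesterovTheta k) (fun k => η * nesterovTheta k) nesterovTheta
        v₀ s₀ l₀ u v z s lam psi →
      ∀ δ : ℝ, 0 < δ → ∀ K : ℕ, 1 ≤ K →
        1 - (1 / (K : ℝ)) ^ (δ ^ 2 / 3) ≤ P.real {ω |
          expectedCost P ξ D a yd α (u K ω) + l1Cost D β (z K ω)
            - expectedCost P ξ D a yd α ustar - l1Cost D β zstar
          < constC3 D amin umin umax yd l₀ α μ ρ η M c / (K : ℝ) ^ 2
            + δ * constC4 D amin umin umax yd M * √(Real.log K) / K} ∧
        1 - (1 / (K : ℝ)) ^ (δ ^ 2 / 3) ≤ P.real {ω |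
          ‖u K ω - z K ω‖
          < 2 * constC3 D amin umin umax yd l₀ α μ ρ η M c / (c * (K : ℝ) ^ 2)
            + 2 * δ * constC4 D amin umin umax yd M * √(Real.log K) / (c * K)}) ∧
    -- (b) the general convex case
    (α = 0 → μ * ρ / (1 - μ) + gradLip D amin α < η →
      IsADMMRun (smoothCost D a yd α) (l1Cost D β) (admissible D umin umax) m X μ
        (fun _ => ρ) (fun _ => η) (fun k => (k : ℝ) + 1)
        v₀ s₀ l₀ u v z s lam psi →
      ∀ δ : ℝ, 0 < δ → ∀ K : ℕ, 1 ≤ K →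
        1 - (1 / (K : ℝ)) ^ (δ ^ 2 / 3) ≤ P.real {ω |
          expectedCost P ξ D a yd α (u K ω) + l1Cost D β (z K ω)
            - expectedCost P ξ D a yd α ustar - l1Cost D β zstar
          < constC5 D amin umin umax yd l₀ v₀ ustar α μ ρ η M c / K
            + δ * constC4 D amin umin umax yd M * √(Real.log K) / K} ∧
        1 - (1 / (K : ℝ)) ^ (δ ^ 2 / 3) ≤ P.real {ω |
          ‖u K ω - z K ω‖
          < 2 * constC5 D amin umin umax yd l₀ v₀ ustar α μ ρ η M c / (c * K)
            + 2 * δ * constC4 D amin umin umax yd M * √(Real.log K) / (c * K)}) := by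
  let _ : MeasurableSpace (L2 D) := borel _
  have : BorelSpace (L2 D) := ⟨rfl⟩
  have : IsFiniteMeasure (volume.restrict D) :=
    isFiniteMeasure_restrict.2 hDb.measure_lt_top.ne
  have : IsProbabilityMeasure (P.map ξ) := Measure.isProbabilityMeasure_map hξ.aemeasurable
  have hell : ∀ t, IsEllipticCoeff D amin amax fun x => a x t := fun t =>
    { measurable := ha.comp (measurable_id.prodMk measurable_const)
      pos := hamin
      bounds := by
        filter_upwards [ae_restrict_mem hDo.measurableSet] with x hx
        exact ⟨(habd x hx t).1.le, (habd x hx t).2.le⟩ }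
  -- From here on `C = C_P²/amin`, so `C²` is the `C_P⁴/amin²` in `gradLip` and `constB1`.
  obtain ⟨S, hS, hSsymm, hSbd, hSmeas⟩ := exists_stateOps ha hell (poincareConst_nonneg (D := D))
    fun w => norm_fst_le_poincareConst hd hDb w.2
  have hC0 : 0 ≤ poincareConst D ^ 2 / amin := by positivity
  have hC2 : (poincareConst D ^ 2 / amin) ^ 2 = poincareConst D ^ 4 / amin ^ 2 := by
    rw [div_pow, ← pow_mul]
  have hF : smoothCost D a yd α = trackingCost S yd α := by
    funext x t
    simp only [smoothCost, trackingCost, hS]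
  -- The expectation depends only on the law of `ξ`, which the samples share.
  have hf : expectedCost P ξ D a yd α = fun x => ∫ t, trackingCost S yd α x t ∂(P.map ξ) := by
    funext x
    rw [integral_map hξ.aemeasurable
      (integrable_trackingCost hSbd hSmeas x).aestronglyMeasurable, ← hF]
    rfl
  have hν : ∀ k i, P.map (X k i) = P.map ξ := fun k i => (hXid k i).map_eq
  have hm0 : ∀ k, 0 < m k := fun k => zero_lt_one.trans (hm k)
  have hB : constB1 D amin umin umax yd = (poincareConst D ^ 2 / amin) ^ 2 *
      (√(volume.real D) * max |umin| |umax|) + poincareConst D ^ 2 / amin * ‖yd‖ := by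
    rw [hC2, constB1]
    ring
  have hL : gradLip D amin α = α + (poincareConst D ^ 2 / amin) ^ 2 := by
    rw [hC2, gradLip]
  have hR2 : (√(volume.real D) * (umax - umin)) ^ 2 = volume.real D * (umax - umin) ^ 2 := by
    rw [mul_pow, Real.sq_sqrt measureReal_nonneg]
  have hR : ∀ x ∈ admissible D umin umax, ∀ y ∈ admissible D umin umax,
      ‖x - y‖ ≤ √(volume.real D) * (umax - umin) :=
    fun x hx y hy => norm_sub_le_of_admissible hu hx hy
  have hN : ∀ x ∈ admissible D umin umax, ‖x‖ ≤ √(volume.real D) * max |umin| |umax| :=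
    fun x hx => norm_le_of_admissible hx
  rw [hF, hf]
  rw [hf] at hstar
  refine ⟨fun hα hρη hημ hr δ hδ K hK => ?_, fun hα hη' hr δ hδ K hK => ?_⟩
  · have h := hr.tail_strongly_convex hμ0 hμ1 hρ hη hα hρη hημ hSsymm hSbd hC0 hSmeas
      convex_admissible hv₀ (convexOn_l1Cost hβ) hstar hR hN hXm hXind hν hm0 hM hsum hc0 hc
      hK hδ hB (constC4_nonneg hamin hu yd M) (le_constC4_sq hM yd) hL
      (Γ := constC3 D amin umin umax yd l₀ α μ ρ η M c) (by rw [hR2, constC3]; ring)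
    refine ⟨h.1, h.2.trans_eq ?_⟩
    congr! 4
    ring
  · have h := hr.tail_convex hμ0 hμ1 hρ hη hα.ge hη' hSsymm hSbd hC0 hSmeas
      convex_admissible hv₀ (convexOn_l1Cost hβ) hstar hR hN hXm hXind hν hm0 hM hsum hc0 hc
      hK hδ hB (constC4_nonneg hamin hu yd M) (le_constC4_sq hM yd) hL
      (Γ := constC5 D amin umin umax yd l₀ v₀ ustar α μ ρ η M c) (by rw [constC5])
    refine ⟨h.1, h.2.trans_eq ?_⟩
    congr! 4
    ring
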